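/- All manifolds and maps are smooth ($C^\infty$); manifolds are non-empty, Hausdorff, second countable and without boundary. Let $H$ and $M$ be manifolds of dimensions $n$ and $m$. **Multifoliations.** A foliation $\mathcal F$ of $M$ of dimension $p$ is a partition of $M$ into connected leaves which admits a foliated atlas: charts $\varphi=\alpha\times\beta$ with values in $\mathbb R^{p}\times\mathbb R^{m-p}$ whose domains cover $M$, which map each connected component of the trace of a leaf on the domain onto a plaque (the intersection of an open set with a slice $\beta=\mathrm{const}$), and whose transition maps send $\beta$-coordinates to functions of the $\beta$-coordinates alone. A foliated chart of $\mathcal F$ is any smooth chart with the plaque property. A multifoliation $\mathbf F=\{\mathcal F_\delta\}_{\delta=1}^{\Delta}$ of $M$ is one of the following. * A $\cap$-multifoliation: foliations such that at each $u\in M$, for each non-empty $E\subseteq\{1,\dots,\Delta\}$, $\operatorname{codim}\bigcap_{\delta\in E}T_u\mathcal F_\delta=\sum_{\delta\in E}\operatorname{codim}T_u\mathcal F_\delta$. * A $\cup$-multifoliation: foliations such that at each $u\in M$, for each non-empty $E$, $\dim\big\langle\bigcup_{\delta\in E}T_u\mathcal F_\delta\big\rangle=\sum_{\delta\in E}\dim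 T_u\mathcal F_\delta$. * A (Kodaira–Spencer) $(P,p)$-multifoliation: $P$ is a finite partially ordered set, $p:\{1,\dots,m\}\to P$ is surjective, and $M$ carries a $(P,p)$-multifoliate structure, i.e. a maximal atlas whose transition maps have Jacobian matrices $(a^i_j)$ with $a^i_j=0$ whenever $p(j)\not\ge p(i)$. For a lower set $D\subseteq P$ (for instance $D=\{a\le\delta\}$ or $D=\{a\not\ge\delta\}$ with $\delta\in P$) the structure determines the foliation whose leaves are locally $\{x^j=\mathrm{const}\text{ for }p(j)\notin D\}$, with leaf coordinates $x^j$, $p(j)\in D$; the $\mathcal F_\delta$ are any finite family of such foliations, given by lower sets $D_\delta$. The charts used for $\mathcal F_\delta$ below are either all foliated charts of $\mathcal F_\delta$ or only the charts of the $(P,p)$-structure (with $\alpha^\delta=(x^j)_{p(j)\in D_\delta}$); the theorem holds for both conventions. **Jets.** Let $r=(r_1,\dots,r_\Delta)$ with integers $r_\delta\ge0$. Smooth maps $f,g:H\to M$ have contact of multiorder $r$ modulo $\mathbf F$ at $h\in H$ if $f(h)=g(h)=u$ and for every $\Delta$-tuple of charts $\varphi^\delta=\alpha^\delta\times\beta^\delta$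 around $u$, the $\delta$-th one adapted to $\mathcal F_\delta$ with $\alpha^\delta$ its coordinates along the leaves, the maps $\alpha^\delta\circ f$ and $\alpha^\delta\circ g$ have the same $r_\delta$-jet at $h$ for each $\delta$, i.e. for every smooth curve $\gamma:\mathbb R\to H$ with $\gamma(0)=h$ the derivatives at $0$ of $\alpha^\delta\circ f\circ\gamma$ and $\alpha^\delta\circ g\circ\gamma$ agree up to order $r_\delta$. The class of $f$ is its $r$-jet modulo $\mathbf F$ with source $h$ and target $u$. Let $J^{r}(H,M;\mathbf F)$ be the set of all these jets, and let $J^{r}_h(H,M;\mathbf F)$, $J^{r}(H,M;\mathbf F)_u$ and $J^{r}_h(H,M;\mathbf F)_u$ be its subsets with fixed source, fixed target, and fixed source and target. **Theorem.** The sets $J^{r}(H,M;\mathbf F)$, for all multiorders $r$, carry smooth manifold structures such that: 1. (The structures are the canonical ones.) The jet coordinates are smooth: for a chart $\psi$ of $H$, a chart adapted to $\mathcal F_\delta$ as above and a component $\alpha$ of its leaf coordinates $\alpha^\delta$, the derivatives of order $\le r_\delta$ of $\alpha\circ f\circ\psi^{-1}$ at $\psi(h)$ are well-defined smooth functions of the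 jet of $f$ at $h$. Conversely, if $t\mapsto\sigma(t)\in H$ and $(t,h)\mapsto\Phi_t(h)\in M$ are smooth, $t\in\mathbb R^k$, then the jet of $\Phi_t$ at $\sigma(t)$ depends smoothly on $t$. 2. $J^{r}_h(H,M;\mathbf F)_u$, $J^{r}_h(H,M;\mathbf F)$ and $J^{r}(H,M;\mathbf F)_u$ have smooth manifold structures, as embedded submanifolds of $J^{r}(H,M;\mathbf F)$, for all $h\in H$, $u\in M$. 3. The source map $J^{r}(H,M;\mathbf F)\to H$ and the target map $J^{r}(H,M;\mathbf F)\to M$ are projections of smooth (locally trivial) fibre bundles. 4. If $0\le\tilde r_\delta\le r_\delta$ for all $\delta$, the canonical map $J^{r}(H,M;\mathbf F)\to J^{\tilde r}(H,M;\mathbf F)$ that sends the $r$-jet of $f$ at $h$ to its $\tilde r$-jet is the projection of a smooth fibre bundle. 5. $J^{0,\dots,0}(H,M;\mathbf F)=H\times M$: the map (source, target) is a diffeomorphism. -/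

import Mathlib

open scoped Manifold ContDiff
open Set

noncomputable section

universe u v

/-! ## Foliations and transversality -/

section Foliations

variable {m : ℕ} {M : Type v} [TopologicalSpace M] [ChartedSpace (EuclideanSpace ℝ (Fin m)) M]

/-- The chart `φ` flattens the partition `leaf` in the directions `S`: every connected component
of the trace of a leaf on the domain of `φ` is mapped by `φ` onto a plaque, i.e. onto the
intersection of an open set with a slice on which exactly the coordinates `x j`, `j ∈ S`, vary. -/
def Flattens (leaf : Setoid M) (φ : OpenPartialHomeomorph M (EuclideanSpace ℝ (Fin m)))
    (S : Finset (Fin m)) : Prop :=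
  ∀ u ∈ φ.source, ∃ W : Set (EuclideanSpace ℝ (Fin m)), IsOpen W ∧
    φ '' connectedComponentIn ({v | leaf u v} ∩ φ.source) u =
      W ∩ {x | ∀ j, j ∉ S → x j = φ u j}

/-- The indices of the first `p` coordinates, the factor `ℝ^p` of `ℝ^m = ℝ^p × ℝ^q`. -/
def firstDirs (m p : ℕ) : Finset (Fin m) :=
  Finset.univ.filter fun j => j.val < p

variable (m M) in
/-- A foliation of dimension `dim` (and codimension `m - dim`) of the `m`-dimensional manifold `M`:
a partition into connected leaves that admits a foliated atlas. For a chart `φ = α × β` of this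
atlas `α` consists of the first `dim` coordinates, and `β` of the other ones. -/
structure Foliation where
  /-- two points are related if they lie on the same leaf -/
  leaf : Setoid M
  isConnected_leaf : ∀ u, IsConnected {v | leaf u v}
  dim : ℕ
  dim_le : dim ≤ m
  exists_foliated_atlas :
    ∃ A : Set (OpenPartialHomeomorph M (EuclideanSpace ℝ (Fin m))),
      A ⊆ IsManifold.maximalAtlas (𝓡 m) ∞ M ∧
      (∀ u, ∃ φ ∈ A, u ∈ φ.source) ∧
      (∀ φ ∈ A, Flattens leaf φ (firstDirs m dim)) ∧
      ∀ φ ∈ A, ∀ φ' ∈ A, ∀ u ∈ φ.source ∩ φ'.source, ∀ v ∈ φ.source ∩ φ'.source,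
        (∀ j, j ∉ firstDirs m dim → φ u j = φ v j) →
          ∀ j, j ∉ firstDirs m dim → φ' u j = φ' v j

/-- The foliated charts of a foliation: all smooth charts that map the components of the traces of
the leaves onto plaques. -/
def Foliation.charts (F : Foliation m M) :
    Set (OpenPartialHomeomorph M (EuclideanSpace ℝ (Fin m))) :=
  {φ | φ ∈ IsManifold.maximalAtlas (𝓡 m) ∞ M ∧ Flattens F.leaf φ (firstDirs m F.dim)}

/-- The tangent space at `u` of the leaf through `u`: the tangent vectors on which the differentials
of the transverse coordinates of all foliated charts vanish. -/
def Foliation.tangent (F : Foliation m M) (u : M) : Submodule ℝ (TangentSpace (𝓡 m) u) where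
  carrier := {v | ∀ φ ∈ F.charts, u ∈ φ.source → ∀ j, j ∉ firstDirs m F.dim →
    (show EuclideanSpace ℝ (Fin m) from mfderiv (𝓡 m) (𝓡 m) φ u v) j = 0}
  add_mem' := by
    intro a b ha hb φ hφ hu j hj
    have h1 := ha φ hφ hu j hj
    have h2 := hb φ hφ hu j hj
    have h3 := congrArg (fun w : EuclideanSpace ℝ (Fin m) => w j)
      ((mfderiv (𝓡 m) (𝓡 m) φ u).map_add a b)
    exact h3.trans ((congrArg₂ (· + ·) h1 h2).trans (add_zero 0))
  zero_mem' := by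
    intro φ hφ hu j hj
    exact congrArg (fun w : EuclideanSpace ℝ (Fin m) => w j) (mfderiv (𝓡 m) (𝓡 m) φ u).map_zero
  smul_mem' := by
    intro c a ha φ hφ hu j hj
    have h1 := ha φ hφ hu j hj
    have h3 := congrArg (fun w : EuclideanSpace ℝ (Fin m) => w j)
      ((mfderiv (𝓡 m) (𝓡 m) φ u).map_smul c a)
    exact h3.trans ((congrArg (c * ·) h1).trans (mul_zero c))

variable {ι : Type} [Fintype ι]

/-- A family of foliations is a ∩-multifoliation: the codimension of any intersection of tangent
spaces of leaves is the sum of the codimensions. -/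
def IsCapMultifoliation (F : ι → Foliation m M) : Prop :=
  ∀ E : Finset ι, E.Nonempty → ∀ u : M,
    Module.finrank ℝ (TangentSpace (𝓡 m) u ⧸ ⨅ δ ∈ E, (F δ).tangent u) =
      ∑ δ ∈ E, Module.finrank ℝ (TangentSpace (𝓡 m) u ⧸ (F δ).tangent u)

/-- A family of foliations is a ∪-multifoliation: the dimension of the span of any number of tangent
spaces of leaves is the sum of the dimensions. -/
def IsCupMultifoliation (F : ι → Foliation m M) : Prop :=
  ∀ E : Finset ι, E.Nonempty → ∀ u : M,
    ∑ δ ∈ E, Module.finrank ℝ ((F δ).tangent u) =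
      Module.finrank ℝ (⨆ δ ∈ E, (F δ).tangent u : Submodule ℝ (TangentSpace (𝓡 m) u))

end Foliations

/-! ## Multifoliate structures of Kodaira and Spencer -/

section KodairaSpencer

variable {m : ℕ} {P : Type} [PartialOrder P]

/-- Membership in the pseudogroup `Γ(P, p)`: local diffeomorphisms `e` of `ℝ^m` whose Jacobian
matrices `(∂ e^i / ∂ x^j)` have zero entries wherever `p j ≱ p i`. -/
def InPseudogroup (p : Fin m → P)
    (e : OpenPartialHomeomorph (EuclideanSpace ℝ (Fin m)) (EuclideanSpace ℝ (Fin m))) : Prop :=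
  ContDiffOn ℝ ∞ e e.source ∧ ContDiffOn ℝ ∞ e.symm e.target ∧
    ∀ x ∈ e.source, ∀ i j, ¬ p i ≤ p j → (fderiv ℝ e x (EuclideanSpace.single j 1)) i = 0

/-- A `(P, p)`-multifoliate structure on the manifold `M`: a maximal atlas compatible
with `Γ(P, p)`. -/
structure MultifoliateStructure (p : Fin m → P) (M : Type v) [TopologicalSpace M]
    [ChartedSpace (EuclideanSpace ℝ (Fin m)) M] where
  charts : Set (OpenPartialHomeomorph M (EuclideanSpace ℝ (Fin m)))
  subset_maximalAtlas : charts ⊆ IsManifold.maximalAtlas (𝓡 m) ∞ M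
  cover : ∀ u, ∃ φ ∈ charts, u ∈ φ.source
  compatible : ∀ φ ∈ charts, ∀ φ' ∈ charts, InPseudogroup p (φ.symm.trans φ')
  maximal : ∀ φ ∈ IsManifold.maximalAtlas (𝓡 m) ∞ M,
    (∀ φ' ∈ charts, InPseudogroup p (φ.symm.trans φ') ∧ InPseudogroup p (φ'.symm.trans φ)) →
      φ ∈ charts

open Classical in
/-- The coordinate directions whose class lies in the lower set `D` of `P`. They span, in every
chart of a `(P, p)`-structure, the same integrable distribution, so `D` determines a foliation,
with leaves `x j = const` for `p j ∉ D`. In particular every `δ : P` determines the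
foliations for `D = {a | a ≤ δ}` and for `D = {a | a ≱ δ}`. -/
def classDirs (p : Fin m → P) (D : LowerSet P) : Finset (Fin m) :=
  Finset.univ.filter fun j => p j ∈ D

/-- The foliations `F δ` are determined by the lower sets `D δ` in the structure `A`. -/
def IsFoliationFamilyOf {ι : Type} {M : Type v} [TopologicalSpace M]
    [ChartedSpace (EuclideanSpace ℝ (Fin m)) M] {p : Fin m → P} (A : MultifoliateStructure p M)
    (D : ι → LowerSet P) (F : ι → Foliation m M) : Prop :=
  ∀ δ, ∀ φ ∈ A.charts, Flattens (F δ).leaf φ (classDirs p (D δ))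

end KodairaSpencer

/-! ## Multifoliations -/

/-- Multifoliations `{F_δ}`, `δ ∈ ι`, of `M`: ∩-multifoliations, ∪-multifoliations and
`(P, p)`-multifoliations. The last ones occur twice: as families of foliations determined by a
`(P, p)`-structure, where the charts for `F_δ` are all foliated charts of `F_δ`,
and as `(P, p)`-structures themselves, where only the charts of the structure are used. -/
inductive Multifoliation (ι : Type) [Fintype ι] (m : ℕ) (M : Type v) [TopologicalSpace M]
    [ChartedSpace (EuclideanSpace ℝ (Fin m)) M] : Type (max 1 v)
  | cap (F : ι → Foliation m M) (hF : IsCapMultifoliation F) : Multifoliation ι m M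
  | cup (F : ι → Foliation m M) (hF : IsCupMultifoliation F) : Multifoliation ι m M
  | kodairaSpencerFoliations (P : Type) [PartialOrder P] (p : Fin m → P)
      (hp : Function.Surjective p) (A : MultifoliateStructure p M) (D : ι → LowerSet P)
      (F : ι → Foliation m M) (hF : IsFoliationFamilyOf A D F) : Multifoliation ι m M
  | kodairaSpencer (P : Type) [PartialOrder P] (p : Fin m → P)
      (hp : Function.Surjective p) (A : MultifoliateStructure p M) (D : ι → LowerSet P) :
      Multifoliation ι m M

namespace Multifoliation

variable {ι : Type} [Fintype ι] {m : ℕ} {M : Type v} [TopologicalSpace M]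
  [ChartedSpace (EuclideanSpace ℝ (Fin m)) M]

/-- The charts `φ^δ = α^δ × β^δ` adapted to the `δ`-th foliation. -/
def charts : Multifoliation ι m M → ι → Set (OpenPartialHomeomorph M (EuclideanSpace ℝ (Fin m)))
  | cap F _, δ => (F δ).charts
  | cup F _, δ => (F δ).charts
  | kodairaSpencerFoliations _ _ _ _ _ F _, δ => (F δ).charts
  | kodairaSpencer _ _ _ A _, _ => A.charts

/-- The indices of the coordinates that vary along the leaves of the `δ`-th foliation, i.e. of the
components of `α^δ`. -/
def leafDirs : Multifoliation ι m M → ι → Finset (Fin m)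
  | cap F _, δ => firstDirs m (F δ).dim
  | cup F _, δ => firstDirs m (F δ).dim
  | kodairaSpencerFoliations _ _ _ _ _ F _, δ => firstDirs m (F δ).dim
  | kodairaSpencer _ p _ _ D, δ => classDirs p (D δ)

end Multifoliation

/-! ## Jets modulo multifoliations -/

section Jets

/-- The coordinates `α : U → ℝ^p` of the chart `φ`, with indices in `S`. -/
def leafCoord {m : ℕ} {M : Type v} [TopologicalSpace M]
    (φ : OpenPartialHomeomorph M (EuclideanSpace ℝ (Fin m))) (S : Finset (Fin m)) :
    M → (S → ℝ) :=
  fun w j => φ w j.val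

/-- The maps `a`, `b` (smooth near `h`) belong to the same classical `r`-jet at `h`: for all smooth
curves `γ` with `γ 0 = h` the curves `a ∘ γ` and `b ∘ γ` have contact of order `r` at `0`. -/
def SameJet (n : ℕ) {H : Type u} [TopologicalSpace H] [ChartedSpace (EuclideanSpace ℝ (Fin n)) H]
    {V : Type} [NormedAddCommGroup V] [NormedSpace ℝ V] (r : ℕ) (a b : H → V) (h : H) : Prop :=
  ∀ γ : ℝ → H, ContMDiff 𝓘(ℝ, ℝ) (𝓡 n) ∞ γ → γ 0 = h →
    ∀ k ≤ r, iteratedDeriv k (a ∘ γ) 0 = iteratedDeriv k (b ∘ γ) 0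

variable (n : ℕ) (H : Type u) [TopologicalSpace H] [ChartedSpace (EuclideanSpace ℝ (Fin n)) H]
  {ι : Type} [Fintype ι] {m : ℕ} {M : Type v} [TopologicalSpace M]
  [ChartedSpace (EuclideanSpace ℝ (Fin m)) M]

/-- `f` and `g` have contact of multiorder `r` modulo `F` at `h`. -/
def Contact (F : Multifoliation ι m M) (r : ι → ℕ) (h : H) (f g : C^∞⟮𝓡 n, H; 𝓡 m, M⟯) : Prop :=
  f h = g h ∧
    ∀ φ : ι → OpenPartialHomeomorph M (EuclideanSpace ℝ (Fin m)),
      (∀ δ, φ δ ∈ F.charts δ ∧ f h ∈ (φ δ).source) →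
        ∀ δ, SameJet n (r δ) (leafCoord (φ δ) (F.leafDirs δ) ∘ f)
          (leafCoord (φ δ) (F.leafDirs δ) ∘ g) h

/-- The relation on pairs (source, map) whose classes are the jets modulo `F`. -/
def jetSetoid (F : Multifoliation ι m M) (r : ι → ℕ) : Setoid (H × C^∞⟮𝓡 n, H; 𝓡 m, M⟯) where
  r a b := a.1 = b.1 ∧ Contact n H F r a.1 a.2 b.2
  iseqv :=
    { refl := fun _ => ⟨rfl, rfl, fun _ _ _ _ _ _ _ _ => rfl⟩
      symm := by
        rintro ⟨h, f⟩ ⟨h', g⟩ ⟨hh, h1, h2⟩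
        dsimp only at hh
        subst hh
        refine ⟨rfl, h1.symm, fun φ hφ δ γ hγ h0 k hk => (h2 φ ?_ δ γ hγ h0 k hk).symm⟩
        exact fun δ => ⟨(hφ δ).1, h1 ▸ (hφ δ).2⟩
      trans := by
        rintro ⟨h, f⟩ ⟨h', g⟩ ⟨h'', k⟩ ⟨hh, h1, h2⟩ ⟨hh', h3, h4⟩
        dsimp only at hh hh'
        subst hh
        subst hh'
        refine ⟨rfl, h1.trans h3, fun φ hφ δ γ hγ h0 i hi =>
          (h2 φ hφ δ γ hγ h0 i hi).trans (h4 φ ?_ δ γ hγ h0 i hi)⟩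
        exact fun δ => ⟨(hφ δ).1, h1 ▸ (hφ δ).2⟩ }

/-- The space of all jets of multiorder `r` modulo `F` of smooth maps `H → M`. -/
def JetSpace (F : Multifoliation ι m M) (r : ι → ℕ) : Type (max u v) :=
  Quotient (jetSetoid n H F r)

variable {n H}

namespace JetSpace

variable {F : Multifoliation ι m M}

/-- The jet of `f` at `h`. -/
def mk (F : Multifoliation ι m M) (r : ι → ℕ) (h : H) (f : C^∞⟮𝓡 n, H; 𝓡 m, M⟯) :
    JetSpace n H F r :=
  Quotient.mk (jetSetoid n H F r) (h, f)

/-- The source of a jet. -/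
def source {r : ι → ℕ} : JetSpace n H F r → H :=
  Quotient.lift (fun a => a.1) fun _ _ hab => hab.1

/-- The target of a jet. -/
def target {r : ι → ℕ} : JetSpace n H F r → M :=
  Quotient.lift (fun a => a.2 a.1) fun a b hab => by
    have h2 : a.2 a.1 = b.2 a.1 := hab.2.1
    have h1 : a.1 = b.1 := hab.1
    rw [h2, h1]

/-- Lowering the multiorder of a jet. -/
def lower {r r' : ι → ℕ} (hr : r' ≤ r) : JetSpace n H F r → JetSpace n H F r' :=
  Quotient.map' (s₁ := jetSetoid n H F r) (s₂ := jetSetoid n H F r') id fun _ _ hab =>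
    ⟨hab.1, hab.2.1, fun φ hφ δ γ hγ h0 k hk => hab.2.2 φ hφ δ γ hγ h0 k (hk.trans (hr δ))⟩

end JetSpace

end Jets

/-! ## Smooth manifold structures and bundles -/

/-- A structure of a smooth (Hausdorff, second countable) manifold of dimension `dim` on a set. -/
structure SmoothStructure (X : Type u) where
  dim : ℕ
  top : TopologicalSpace X
  t2 : T2Space X
  secondCountable : SecondCountableTopology X
  charted : ChartedSpace (EuclideanSpace ℝ (Fin dim)) X
  isManifold : IsManifold (𝓡 dim) ∞ X

/-- The set `X` considered as the manifold defined by `S`. -/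
def SmoothStructure.Space {X : Type u} (_S : SmoothStructure X) : Type u := X

section

variable {X : Type u} (S : SmoothStructure X)

instance : TopologicalSpace S.Space := S.top
instance : T2Space S.Space := S.t2
instance : SecondCountableTopology S.Space := S.secondCountable
instance : ChartedSpace (EuclideanSpace ℝ (Fin S.dim)) S.Space := S.charted
instance : IsManifold (𝓡 S.dim) ∞ S.Space := S.isManifold

/-- An element of `X` as a point of the manifold. -/
def SmoothStructure.point (x : X) : S.Space := x

/-- A point of the manifold as an element of `X`. -/
def SmoothStructure.elt {S : SmoothStructure X} (x : S.Space) : X := x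

end

/-- `Y ⊆ X` is an embedded submanifold of the manifold given by `S`: it has a manifold structure for
which the inclusion is a smooth embedding. -/
def IsEmbeddedSubmanifold {X : Type u} (S : SmoothStructure X) (Y : Set X) : Prop :=
  ∃ T : SmoothStructure Y,
    Manifold.IsSmoothEmbedding (𝓡 T.dim) (𝓡 S.dim) ∞ 
      (fun y : T.Space => S.point (SmoothStructure.elt y).val)

/-- `π : Z → B` is the projection of a smooth fibre bundle: a surjective smooth map, locally
isomorphic to the product of the base with a manifold. -/
def IsSmoothBundle (a b : ℕ) {Z : Type u} {B : Type v} [TopologicalSpace Z]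
    [ChartedSpace (EuclideanSpace ℝ (Fin a)) Z] [TopologicalSpace B]
    [ChartedSpace (EuclideanSpace ℝ (Fin b)) B] (π : Z → B) : Prop :=
  Function.Surjective π ∧ ContMDiff (𝓡 a) (𝓡 b) ∞ π ∧
    ∃ (X : Type u) (T : SmoothStructure X), ∀ x : B, ∃ e : Bundle.Trivialization T.Space π,
      x ∈ e.baseSet ∧
      ContMDiffOn (𝓡 a) ((𝓡 b).prod (𝓡 T.dim)) ∞ e.toOpenPartialHomeomorph e.source ∧
      ContMDiffOn ((𝓡 b).prod (𝓡 T.dim)) (𝓡 a) ∞ e.toOpenPartialHomeomorph.symm e.target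

section

variable {n : ℕ} {H : Type u} [TopologicalSpace H] [ChartedSpace (EuclideanSpace ℝ (Fin n)) H]
  {ι : Type} [Fintype ι] {m : ℕ} {M : Type v} [TopologicalSpace M]
  [ChartedSpace (EuclideanSpace ℝ (Fin m)) M]

/-- All jet coordinates are smooth functions: for a chart `ψ` of `H`, a chart `φ` adapted to `F_δ`
and a component `α` of `α^δ`, the `k`-th derivative (`k ≤ r δ`) of `α ∘ f ∘ ψ⁻¹` at `ψ h`
depends only on the jet of `f` at `h`, and depends on it smoothly. -/
def HasSmoothJetCoordinates {F : Multifoliation ι m M} {r : ι → ℕ}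
    (S : SmoothStructure (JetSpace n H F r)) : Prop :=
  ∀ ψ ∈ IsManifold.maximalAtlas (𝓡 n) ∞ H, ∀ δ, ∀ φ ∈ F.charts δ, ∀ j ∈ F.leafDirs δ,
    ∀ k ≤ r δ, ∃ G : S.Space → (EuclideanSpace ℝ (Fin n) [×k]→L[ℝ] ℝ),
      (∀ (h : H) (f : C^∞⟮𝓡 n, H; 𝓡 m, M⟯), h ∈ ψ.source → f h ∈ φ.source →
        G (S.point (JetSpace.mk F r h f)) = iteratedFDeriv ℝ k (fun z => φ (f (ψ.symm z)) j) (ψ h)) ∧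
      ContMDiffOn (𝓡 S.dim) 𝓘(ℝ, EuclideanSpace ℝ (Fin n) [×k]→L[ℝ] ℝ) ∞ G
        {c | JetSpace.source (SmoothStructure.elt c) ∈ ψ.source ∧ JetSpace.target (SmoothStructure.elt c) ∈ φ.source}

/-- Jets of smooth families of maps, at smoothly varying sources, depend smoothly on the
parameters. -/
def HasSmoothJetFamilies {F : Multifoliation ι m M} {r : ι → ℕ}
    (S : SmoothStructure (JetSpace n H F r)) : Prop :=
  ∀ (k : ℕ) (σ : EuclideanSpace ℝ (Fin k) → H)
    (Φ : EuclideanSpace ℝ (Fin k) → C^∞⟮𝓡 n, H; 𝓡 m, M⟯),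
    ContMDiff (𝓡 k) (𝓡 n) ∞ σ →
    ContMDiff ((𝓡 k).prod (𝓡 n)) (𝓡 m) ∞ (fun q : EuclideanSpace ℝ (Fin k) × H => Φ q.1 q.2) →
      ContMDiff (𝓡 k) (𝓡 S.dim) ∞ (fun t => S.point (JetSpace.mk F r (σ t) (Φ t)))

end

end

/-! The point is to see what contact modulo `F` means in coordinates. Let `x^i` be a leaf coordinate
of a chart adapted to the `δ`-th foliation, and suppose that the shear which adds another coordinate
`x^j` to `x^i` gives an adapted chart again. Then `x^j` is the difference of two leaf coordinates of
adapted charts, so contact modulo `F` forces agreement of the `j`-th coordinates up to order `r δ`,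
even if `x^j` is transverse to the leaves.

If all foliated charts are admitted, every such shear is allowed as soon as the leaves have positive
dimension. Jets modulo `F` are then classical jets, of order the maximum of the `r δ` over the
foliations with leaves of positive dimension (or 0 if there are none). If only the charts of a `(P,
p)`-structure are admitted, the shear is allowed when `p i ≤ p j`. The `j`-th coordinate is then
controlled up to order `o j`, the maximum of the `r δ` over those `δ` for which `D δ` contains some
`p i ≤ p j`. Conversely, the `i`-th coordinate of a new chart depends only on the old `x^j` with `p
i ≤ p j`, and these satisfy `o i ≤ o j`. Hence agreement up to the orders `o j` in one chart implies
it in all charts. `AdaptedAtlas` collects the data common to both cases; the resulting description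
of contact is `AdaptedAtlas.contact_iff`.

A chart of `H` and a chart of the adapted atlas thus give coordinates of jets in `JetModel`: source,
target, and derivatives of the `j`-th component of orders `1, …, o j`. By `exists_jetFamily` all
values near a given one are taken by jets of a family of globally defined maps that depends smoothly
on the coordinates. This gives surjectivity onto the expected open set. It also gives smooth
transition maps, because derivatives of a smooth family depend smoothly on the parameters
(`contDiffAt_jetCoord_family`). The topology is Hausdorff because jets with equal source and target
lie in a common chart.

Fixing source or target fixes coordinates, which gives the submanifolds. For the source and target
bundles, composition with maps that are translations in charts moves jets from one fibre to another
without changing the remaining coordinates (`isSmoothBundle_of_transport`). Lowering the order is a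
surjective linear map on the derivative coordinates, and a linear splitting trivializes it over a
whole chart. -/

open scoped Topology
noncomputable section
universe u v

/-! ## Jets of functions on normed spaces -/

section NormedJets

variable {E F G : Type*} [NormedAddCommGroup E] [NormedSpace ℝ E] [NormedAddCommGroup F]
  [NormedSpace ℝ F] [NormedAddCommGroup G] [NormedSpace ℝ G]

/-- The maps `f` and `g` have the same derivatives up to order `r` at `x`. -/
def SameDerivs (r : ℕ) (f g : E → F) (x : E) : Prop :=
  ∀ k ≤ r, iteratedFDeriv ℝ k f x = iteratedFDeriv ℝ k g x

theorem SameDerivs.symm {r : ℕ} {f g : E → F} {x : E} (h : SameDerivs r f g x) :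
    SameDerivs r g f x := fun k hk => (h k hk).symm

theorem SameDerivs.trans {r : ℕ} {f g k : E → F} {x : E} (h : SameDerivs r f g x)
    (h' : SameDerivs r g k x) : SameDerivs r f k x := fun i hi => (h i hi).trans (h' i hi)

theorem SameDerivs.mono {r r' : ℕ} {f g : E → F} {x : E} (h : SameDerivs r f g x)
    (hr : r' ≤ r) : SameDerivs r' f g x := fun k hk => h k (hk.trans hr)

theorem SameDerivs.apply_eq {r : ℕ} {f g : E → F} {x : E} (h : SameDerivs r f g x) :
    f x = g x := by
  have := congrArg (fun T => T 0) (h 0 (Nat.zero_le r))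
  simpa using this

theorem sameDerivs_of_eventuallyEq {f g : E → F} {x : E} (h : f =ᶠ[𝓝 x] g) (r : ℕ) :
    SameDerivs r f g x := fun k _ => (h.iteratedFDeriv ℝ k).eq_of_nhds

/-- In the Faà di Bruno formula a partition of `k` elements has at most `k` parts, each of size at
most `k`. So the term of order `k` involves no derivatives of higher order. This is what makes jets
composable. -/
theorem taylorComp_congr {q q' : FormalMultilinearSeries ℝ F G}
    {p p' : FormalMultilinearSeries ℝ E F} {k : ℕ} (hq : ∀ i ≤ k, q i = q' i)
    (hp : ∀ i ≤ k, p i = p' i) : q.taylorComp p k = q'.taylorComp p' k := by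
  unfold FormalMultilinearSeries.taylorComp FormalMultilinearSeries.compAlongOrderedFinpartition
  refine Finset.sum_congr rfl fun c _ => ?_
  rw [hq _ c.length_le]
  congr 1
  funext i
  exact hp _ (c.partSize_le i)

theorem SameDerivs.comp {r : ℕ} {a b : E → F} {f g : F → G} {x : E}
    (hfg : SameDerivs r f g (a x)) (hab : SameDerivs r a b x) (hf : ContDiffAt ℝ ∞ f (a x))
    (hg : ContDiffAt ℝ ∞ g (a x)) (ha : ContDiffAt ℝ ∞ a x) (hb : ContDiffAt ℝ ∞ b x) :
    SameDerivs r (f ∘ a) (g ∘ b) x := by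
  intro k hk
  have h0 : a x = b x := hab.apply_eq
  have hk' : ((k : ℕ) : ℕ∞ω) ≤ ∞ := by exact_mod_cast le_top
  rw [iteratedFDeriv_comp hf ha hk', iteratedFDeriv_comp (h0 ▸ hg) hb hk']
  refine taylorComp_congr (fun i hi => ?_) fun i hi => hab i (hi.trans hk)
  rw [← h0]
  exact hfg i (hi.trans hk)

theorem SameDerivs.comp_left {r : ℕ} {a b : E → F} {f : F → G} {x : E}
    (hab : SameDerivs r a b x) (hf : ContDiffAt ℝ ∞ f (a x)) (ha : ContDiffAt ℝ ∞ a x)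
    (hb : ContDiffAt ℝ ∞ b x) : SameDerivs r (f ∘ a) (f ∘ b) x :=
  SameDerivs.comp (fun _ _ => rfl) hab hf hf ha hb

theorem SameDerivs.comp_right {r : ℕ} {a : E → F} {f g : F → G} {x : E}
    (hfg : SameDerivs r f g (a x)) (hf : ContDiffAt ℝ ∞ f (a x)) (hg : ContDiffAt ℝ ∞ g (a x))
    (ha : ContDiffAt ℝ ∞ a x) : SameDerivs r (f ∘ a) (g ∘ a) x :=
  hfg.comp (fun _ _ => rfl) hf hg ha ha

theorem SameDerivs.pi {κ : Type*} [Fintype κ] {r : ℕ} {f g : E → EuclideanSpace ℝ κ} {x : E}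
    (hf : ContDiffAt ℝ ∞ f x) (hg : ContDiffAt ℝ ∞ g x)
    (h : ∀ i, SameDerivs r (fun y => f y i) (fun y => g y i) x) : SameDerivs r f g x := by
  intro k hk
  have hk' : ((k : ℕ) : ℕ∞ω) ≤ ∞ := by exact_mod_cast le_top
  ext v i
  have e : ∀ u : E → EuclideanSpace ℝ κ, ContDiffAt ℝ ∞ u x →
      iteratedFDeriv ℝ k u x v i = iteratedFDeriv ℝ k (fun y => u y i) x v := by
    intro u hu
    have := (EuclideanSpace.proj (𝕜 := ℝ) i : EuclideanSpace ℝ κ →L[ℝ] ℝ).iteratedFDeriv_comp_left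
      hu hk'
    exact (congrArg (fun T => T v) this).symm
  rw [e f hf, e g hg, h i k hk]

/-- Schwarz's theorem for derivatives of any order. -/
theorem iteratedFDeriv_comp_perm_of_contDiffAt {k : ℕ} {f : E → F} {x : E}
    (hf : ContDiffAt ℝ k f x) (σ : Equiv.Perm (Fin k)) (v : Fin k → E) :
    iteratedFDeriv ℝ k f x (v ∘ σ) = iteratedFDeriv ℝ k f x v := by
  induction k generalizing x with
  | zero => congr 1; exact Subsingleton.elim _ _
  | succ k ih =>
    -- Adjacent transpositions generate all permutations. The swap of the first two arguments is the
    -- symmetry of the second derivative of the `k`-th derivative. The other swaps fix the first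
    -- argument, and follow by differentiating the induction hypothesis, which holds at all nearby
    -- points.
    have hmem : σ ∈ Submonoid.closure (Set.range fun i : Fin k =>
        Equiv.swap i.castSucc i.succ) := by
      rw [Equiv.Perm.mclosure_swap_castSucc_succ]; trivial
    induction hmem using Submonoid.closure_induction generalizing v with
    | one => rfl
    | mul s t _ _ hs ht =>
      rw [Equiv.Perm.coe_mul, ← Function.comp_assoc, ht, hs]
    | mem s hs =>
      obtain ⟨i, rfl⟩ := hs
      cases k with
      | zero => exact i.elim0
      | succ k =>
        refine Fin.cases ?_ (fun j => ?_) i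
        · have h2 : ContDiffAt ℝ 2 (iteratedFDeriv ℝ k f) x :=
            hf.iteratedFDeriv_right (by push_cast; rw [add_assoc, add_comm]; norm_num)
          have hs := h2.isSymmSndFDerivAt (by simp)
          have e : ∀ w : Fin (k + 2) → E, iteratedFDeriv ℝ (k + 2) f x w =
              fderiv ℝ (fderiv ℝ (iteratedFDeriv ℝ k f)) x (w 0) (w 1) (Fin.tail (Fin.tail w)) := by
            intro w
            rw [iteratedFDeriv_succ_apply_left]
            have hd : DifferentiableAt ℝ (fderiv ℝ (iteratedFDeriv ℝ k f)) x :=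
              (h2.fderiv_right (m := 1) (by norm_num)).differentiableAt (by norm_num)
            have hd' : DifferentiableAt ℝ (iteratedFDeriv ℝ (k + 1) f) x :=
              (hf.iteratedFDeriv_right (m := 1) (by push_cast; rw [add_comm])).differentiableAt
                (by norm_num)
            have e1 := ((ContinuousMultilinearMap.apply ℝ (fun _ : Fin (k + 1) => E) F
              (Fin.tail w)).hasFDerivAt.comp x hd'.hasFDerivAt)
            have e2 := (ContinuousMultilinearMap.apply ℝ (fun _ : Fin k => E) F
              (Fin.tail (Fin.tail w))).hasFDerivAt.comp x
              (hd.hasFDerivAt.clm_apply (hasFDerivAt_const (w 1) x))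
            simpa using congrArg (fun T => T (w 0)) (e1.unique e2)
          rw [e, e]
          have h0 : (v ∘ (Equiv.swap (Fin.castSucc 0) (Fin.succ 0) : Equiv.Perm (Fin (k+2)))) 0 = v 1 := by
            simp
          have h1 : (v ∘ (Equiv.swap (Fin.castSucc 0) (Fin.succ 0) : Equiv.Perm (Fin (k+2)))) 1 = v 0 := by
            simp
          have h3 : Fin.tail (Fin.tail (v ∘ (Equiv.swap (Fin.castSucc 0) (Fin.succ 0) : Equiv.Perm (Fin (k+2)))))
              = Fin.tail (Fin.tail v) := by
            funext j
            simp only [Fin.tail, Function.comp]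
            rw [Equiv.swap_apply_of_ne_of_ne]
            · simp [Fin.ext_iff]
            · simp [Fin.ext_iff]
          rw [h0, h1, h3, hs.eq]
        · rw [iteratedFDeriv_succ_apply_left, iteratedFDeriv_succ_apply_left]
          have h0 : (v ∘ (Equiv.swap j.succ.castSucc j.succ.succ : Equiv.Perm (Fin (k+2)))) 0 = v 0 := by
            simp only [Function.comp]
            rw [Equiv.swap_apply_of_ne_of_ne]
            · simp [Fin.ext_iff]
            · simp [Fin.ext_iff]
          have h1 : Fin.tail (v ∘ (Equiv.swap j.succ.castSucc j.succ.succ : Equiv.Perm (Fin (k+2))))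
              = Fin.tail v ∘ (Equiv.swap j.castSucc j.succ : Equiv.Perm (Fin (k + 1))) := by
            funext l
            simp only [Fin.tail, Function.comp]
            congr 1
            rw [← Fin.succ_castSucc]
            exact (Fin.succ_injective _).swap_apply _ _ _ 
          rw [h0, h1]
          have hd : DifferentiableAt ℝ (iteratedFDeriv ℝ (k + 1) f) x :=
            (hf.iteratedFDeriv_right (m := 1) (by push_cast; rw [add_comm])).differentiableAt
              (by norm_num)
          have e : ∀ w : Fin (k + 1) → E, fderiv ℝ (iteratedFDeriv ℝ (k + 1) f) x (v 0) w =
              fderiv ℝ (fun y => iteratedFDeriv ℝ (k + 1) f y w) x (v 0) := by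
            intro w
            have := ((ContinuousMultilinearMap.apply ℝ (fun _ : Fin (k + 1) => E) F
              w).hasFDerivAt.comp x hd.hasFDerivAt).fderiv
            exact (congrArg (fun T => T (v 0)) this).symm
          rw [e, e]
          congr 1
          refine Filter.EventuallyEq.fderiv_eq ?_
          have hev := (hf.of_le (m := ((k + 1 : ℕ) : ℕ∞ω)) (by exact_mod_cast Nat.le_succ _)).eventually
            (by simp)
          filter_upwards [hev] with y hy
          exact ih hy _ _

theorem iteratedDeriv_line {k : ℕ} {f : E → F} {x : E} (hf : ContDiffAt ℝ k f x) (v : E) :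
    iteratedDeriv k (fun t : ℝ => f (x + t • v)) 0 = iteratedFDeriv ℝ k f x fun _ => v := by
  have hg : ContDiffAt ℝ k (fun y => f (x + y)) 0 := by
    refine ContDiffAt.comp (0 : E) (g := f) (f := fun y => x + y) (by simpa using hf) (by fun_prop)
  obtain ⟨u, hu, hgu⟩ := hg.contDiffOn (m := k) le_rfl (by simp)
  obtain ⟨s, hsu, hs, h0⟩ := mem_nhds_iff.1 (by simpa using hu : u ∈ 𝓝 (0 : E))
  set L : ℝ →L[ℝ] E := ContinuousLinearMap.toSpanSingleton ℝ v with hL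
  have hLs : IsOpen (L ⁻¹' s) := hs.preimage L.continuous
  have h0' : L 0 ∈ s := by simpa using h0
  have key := L.iteratedFDerivWithin_comp_right (hgu.mono hsu) hs.uniqueDiffOn hLs.uniqueDiffOn
    h0' (i := k) le_rfl
  rw [iteratedFDerivWithin_of_isOpen k hLs h0', iteratedFDerivWithin_of_isOpen k hs h0'] at key
  rw [iteratedDeriv_eq_iteratedFDeriv]
  have e : (fun t : ℝ => f (x + t • v)) = (fun y => f (x + y)) ∘ L := by
    funext t; simp [hL]
  rw [e, key]
  simp [hL, iteratedFDeriv_comp_add_left]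

/-- Lines detect only the diagonal values of the `k`-th derivatives. By polarization the diagonal
values determine a symmetric multilinear map, and iterated derivatives are symmetric. -/
theorem sameDerivs_of_lines {r : ℕ} {f g : E → F} {x : E} (hf : ContDiffAt ℝ ∞ f x)
    (hg : ContDiffAt ℝ ∞ g x)
    (h : ∀ v : E, ∀ k ≤ r, iteratedDeriv k (fun t : ℝ => f (x + t • v)) 0 =
      iteratedDeriv k (fun t : ℝ => g (x + t • v)) 0) : SameDerivs r f g x := by
  intro k hk
  have hf' : ContDiffAt ℝ k f x := hf.of_le (by exact_mod_cast le_top)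
  have hg' : ContDiffAt ℝ k g x := hg.of_le (by exact_mod_cast le_top)
  set T := iteratedFDeriv ℝ k f x - iteratedFDeriv ℝ k g x with hT
  have hz : (fun y : E => T fun _ => y) = fun _ => 0 := by
    funext v
    have := h v k hk
    rw [iteratedDeriv_line hf', iteratedDeriv_line hg'] at this
    simp [hT, this]
  -- The `k`-th derivative of `y ↦ T (y, …, y)` is the sum of `T` over all permutations of the
  -- arguments, hence `k! • T` by symmetry.
  have key : ∀ v, (k.factorial : ℝ) • T v = 0 := by
    intro v
    have h1 := T.iteratedFDeriv_comp_diagonal 0 v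
    rw [hz] at h1
    have h2 : iteratedFDeriv ℝ k (fun _ : E => (0 : F)) 0 v = 0 := by
      simp [iteratedFDeriv_fun_zero]
    have h3 : ∀ σ : Equiv.Perm (Fin k), (T fun i => v (σ i)) = T v := by
      intro σ
      simp only [hT, sub_apply]
      have a := iteratedFDeriv_comp_perm_of_contDiffAt hf' σ v
      have b := iteratedFDeriv_comp_perm_of_contDiffAt hg' σ v
      rw [← a, ← b]; rfl
    rw [h2] at h1
    simp only [h3, Finset.sum_const, Finset.card_univ, Fintype.card_perm, Fintype.card_fin] at h1
    rw [← Nat.cast_smul_eq_nsmul ℝ] at h1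
    exact h1.symm
  have hT0 : T = 0 := by
    ext v
    have := key v
    rw [smul_eq_zero] at this
    rcases this with h | h
    · exact absurd h (by exact_mod_cast k.factorial_ne_zero)
    · exact h
  exact sub_eq_zero.1 hT0

theorem ContDiffAt.iteratedFDeriv_param {P : Type*} [NormedAddCommGroup P] [NormedSpace ℝ P]
    {g : P → E → F} {ξ : P → E} {t : P} (hg : ContDiffAt ℝ ∞ (Function.uncurry g) (t, ξ t))
    (hξ : ContDiffAt ℝ ∞ ξ t) (k : ℕ) :
    ContDiffAt ℝ ∞ (fun s => iteratedFDeriv ℝ k (g s) (ξ s)) t := by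
  -- The induction needs smoothness jointly in the parameter and the point; the moving point `ξ` is
  -- substituted only at the end.
  have key : ContDiffAt ℝ ∞ (fun q : P × E => iteratedFDeriv ℝ k (g q.1) q.2) (t, ξ t) := by
    induction k with
    | zero =>
      simp only [iteratedFDeriv_zero_eq_comp]
      exact hg.continuousLinearMap_comp
        ((continuousMultilinearCurryFin0 ℝ E F).symm : _ →L[ℝ] E [×0]→L[ℝ] F)
    | succ k ih =>
      simp only [iteratedFDeriv_succ_eq_comp_left]
      refine ContDiffAt.continuousLinearMap_comp
        (f := fun q : P × E => fderiv ℝ (iteratedFDeriv ℝ k (g q.1)) q.2)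
        ((continuousMultilinearCurryLeftEquiv ℝ (fun _ : Fin (k + 1) => E) F).symm :
          _ →L[ℝ] E [×(k + 1)]→L[ℝ] F) ?_
      refine ContDiffAt.fderiv (n := ∞) (f := fun (q : P × E) y => iteratedFDeriv ℝ k (g q.1) y) ?_
        contDiffAt_snd le_rfl
      exact ContDiffAt.comp (((t, ξ t), ξ t) : (P × E) × E) (f := fun q : (P × E) × E => (q.1.1, q.2)) ih
        (by fun_prop)
  exact ContDiffAt.comp t (f := fun s => (s, ξ s)) key (contDiffAt_id.prodMk hξ)

end NormedJets

/-! ### Truncations, used to extend local maps to global ones -/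

section Cutoff

variable {E : Type*} [NormedAddCommGroup E] [NormedSpace ℝ E] [FiniteDimensional ℝ E]

/-- A smooth map with values in a small ball that is the identity near the origin. -/
theorem exists_contDiff_truncation {ε : ℝ} (hε : 0 < ε) :
    ∃ ρ : E → E, ContDiff ℝ ∞ ρ ∧ ρ =ᶠ[𝓝 0] id ∧ ∀ y, ‖ρ y‖ < ε := by
  let χ : ContDiffBump (0 : E) := ⟨ε / 4, ε / 2, by positivity, by linarith⟩
  refine ⟨fun y => χ y • y, χ.contDiff.smul contDiff_id, ?_, fun y => ?_⟩
  · filter_upwards [χ.eventuallyEq_one] with y hy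
    simp [hy]
  · by_cases hy : ‖y‖ < ε / 2
    · rw [norm_smul, Real.norm_of_nonneg χ.nonneg]
      nlinarith [χ.le_one (x := y), χ.nonneg (x := y), norm_nonneg y]
    · have : χ y = 0 := χ.zero_of_le_dist (by simpa [χ] using hy)
      simp [this, hε]

end Cutoff

/-! ### Functions that depend on some of the coordinates only -/

section Dependence

variable {m : ℕ} {E G : Type*} [NormedAddCommGroup E] [NormedSpace ℝ E]
  [NormedAddCommGroup G] [NormedSpace ℝ G]

open Classical in
/-- Replace the coordinates of `y` outside of `K` by those of `y₀`. -/
def freeze (K : Set (Fin m)) (y₀ y : EuclideanSpace ℝ (Fin m)) : EuclideanSpace ℝ (Fin m) :=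
  WithLp.toLp 2 fun j => if j ∈ K then y j else y₀ j

theorem contDiff_freeze (K : Set (Fin m)) (y₀ : EuclideanSpace ℝ (Fin m)) :
    ContDiff ℝ ∞ (freeze K y₀) := by
  rw [contDiff_euclidean]
  intro j
  by_cases hj : j ∈ K
  · simp only [freeze, hj, if_true]; fun_prop
  · simp only [freeze, hj, if_false]; fun_prop

theorem freeze_self (K : Set (Fin m)) (y : EuclideanSpace ℝ (Fin m)) : freeze K y y = y := by
  ext j; simp [freeze]

/-- A function whose partial derivatives vanish in the directions outside of `K` locally depends
on the coordinates in `K` only. -/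
theorem eventuallyEq_comp_freeze {e : EuclideanSpace ℝ (Fin m) → ℝ} {K : Set (Fin m)}
    {y₀ : EuclideanSpace ℝ (Fin m)}
    (he : ∀ᶠ y in 𝓝 y₀, DifferentiableAt ℝ e y ∧
      ∀ j, j ∉ K → fderiv ℝ e y (EuclideanSpace.single j 1) = 0) :
    e =ᶠ[𝓝 y₀] e ∘ freeze K y₀ := by
  obtain ⟨ε, hε, hb⟩ := Metric.eventually_nhds_iff_ball.1 he
  have hc : Filter.Tendsto (freeze K y₀) (𝓝 y₀) (𝓝 y₀) := by
    have := (contDiff_freeze K y₀).continuous.tendsto y₀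
    rwa [freeze_self] at this
  filter_upwards [Metric.ball_mem_nhds y₀ hε, hc (Metric.ball_mem_nhds y₀ hε)] with y h1 h2
  set p := freeze K y₀ y with hp
  have hmem : ∀ t ∈ Icc (0 : ℝ) 1, p + t • (y - p) ∈ Metric.ball y₀ ε := fun t ht =>
    (convex_ball y₀ ε).add_smul_sub_mem h2 h1 ht
  -- The points `y` and `p` differ only in coordinates outside of `K`, so the derivative of `e`
  -- along the segment between them vanishes. The segment stays in the ball, which is convex.
  have hdir : ∀ z ∈ Metric.ball y₀ ε, fderiv ℝ e z (y - p) = 0 := by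
    intro z hz
    have : y - p = ∑ j, (y j - p j) • EuclideanSpace.single j (1 : ℝ) := by
      ext i
      simp [Finset.sum_apply, Pi.single_apply]
    rw [this, map_sum]
    refine Finset.sum_eq_zero fun j _ => ?_
    rw [map_smul]
    by_cases hj : j ∈ K
    · simp [hp, freeze, hj]
    · rw [(hb z hz).2 j hj, smul_zero]
  have hder : ∀ t ∈ Icc (0 : ℝ) 1, HasDerivAt (fun t : ℝ => e (p + t • (y - p))) 0 t := by
    intro t ht
    have h := (hb _ (hmem t ht)).1.hasFDerivAt
    have hl : HasDerivAt (fun t : ℝ => p + t • (y - p)) (y - p) t := by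
      simpa using ((hasDerivAt_id t).smul_const (y - p)).const_add p
    have := h.comp_hasDerivAt t hl
    rwa [hdir _ (hmem t ht)] at this
  have := constant_of_has_deriv_right_zero
    (fun t ht => (hder t ht).continuousAt.continuousWithinAt)
    (fun t ht => (hder t (Ico_subset_Icc_self ht)).hasDerivWithinAt) 1 (by simp)
  simpa using this

/-- Since `e` ignores the coordinates outside of `K`, those of `a` and `b` may be replaced by the
constants `a x j`. The new maps agree up to order `r` in every coordinate, so the chain rule
applies. -/
theorem SameDerivs.comp_of_dependence {r : ℕ} {e : EuclideanSpace ℝ (Fin m) → ℝ}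
    {K : Set (Fin m)} {a b : E → EuclideanSpace ℝ (Fin m)} {x : E}
    (he : ∀ᶠ y in 𝓝 (a x), DifferentiableAt ℝ e y ∧
      ∀ j, j ∉ K → fderiv ℝ e y (EuclideanSpace.single j 1) = 0)
    (hes : ContDiffAt ℝ ∞ e (a x)) (ha : ContDiffAt ℝ ∞ a x) (hb : ContDiffAt ℝ ∞ b x)
    (h0 : a x = b x) (hK : ∀ j ∈ K, SameDerivs r (fun y => a y j) (fun y => b y j) x) :
    SameDerivs r (e ∘ a) (e ∘ b) x := by
  have hev := eventuallyEq_comp_freeze he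
  have h1 : e ∘ a =ᶠ[𝓝 x] e ∘ (freeze K (a x) ∘ a) := ha.continuousAt.eventually hev
  have h2 : e ∘ b =ᶠ[𝓝 x] e ∘ (freeze K (a x) ∘ b) := by
    have hbc := hb.continuousAt
    rw [ContinuousAt, ← h0] at hbc
    exact hbc.eventually hev
  have hfa : ContDiffAt ℝ ∞ (freeze K (a x) ∘ a) x := (contDiff_freeze K _).contDiffAt.comp x ha
  have hfb : ContDiffAt ℝ ∞ (freeze K (a x) ∘ b) x := (contDiff_freeze K _).contDiffAt.comp x hb
  refine (sameDerivs_of_eventuallyEq h1 r).trans (SameDerivs.trans ?_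
    (sameDerivs_of_eventuallyEq h2 r).symm)
  refine SameDerivs.comp_left (SameDerivs.pi hfa hfb fun j => ?_) ?_ hfa hfb
  · by_cases hj : j ∈ K
    · simpa [freeze, hj] using hK j hj
    · have e (c : E → EuclideanSpace ℝ (Fin m)) :
        (fun y => (freeze K (a x) ∘ c) y j) = fun _ => a x j :=
      funext fun y => if_neg hj
      rw [e, e]
      exact fun k _ => rfl
  · simpa [freeze_self] using hes

end Dependence

/-! ## The space of jets without constant terms -/

section JetFibre

instance (E F : Type*) [NormedAddCommGroup E] [NormedSpace ℝ E] [FiniteDimensional ℝ E]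
    [NormedAddCommGroup F] [NormedSpace ℝ F] [FiniteDimensional ℝ F] (k : ℕ) :
    FiniteDimensional ℝ (E [×k]→L[ℝ] F) :=
  FiniteDimensional.of_injective
    (ContinuousMultilinearMap.toMultilinearMapLinear :
      (E [×k]→L[ℝ] F) →ₗ[ℝ] MultilinearMap ℝ (fun _ : Fin k => E) F)
    ContinuousMultilinearMap.toMultilinearMap_injective

variable (E : Type) [NormedAddCommGroup E] [NormedSpace ℝ E]

/-- The derivatives of orders `1, …, r`. -/
abbrev DerivTuple (r : ℕ) : Type := (k : Fin r) → E [×(k.val + 1)]→L[ℝ] ℝ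

variable {E} in
/-- The derivatives of orders `1, …, r` of `f` at `x`. -/
def derivTuple (r : ℕ) (f : E → ℝ) (x : E) : DerivTuple E r :=
  fun k => iteratedFDeriv ℝ (k.val + 1) f x

/-- The smooth functions on `E`. -/
def smoothFunctions : Submodule ℝ (E → ℝ) where
  carrier := {f | ContDiff ℝ ∞ f}
  add_mem' {f g} (hf : ContDiff ℝ ∞ f) (hg : ContDiff ℝ ∞ g) := hf.add hg
  zero_mem' := (contDiff_const : ContDiff ℝ ∞ fun _ : E => (0 : ℝ))
  smul_mem' c f (hf : ContDiff ℝ ∞ f) := (contDiff_const (c := c)).smul hf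

variable {E} in
theorem contDiff_of_smoothFunctions (f : smoothFunctions E) : ContDiff ℝ ∞ f.1 := f.2

/-- The map from a smooth function to its derivatives at the origin. -/
def derivTupleMap (r : ℕ) : smoothFunctions E →ₗ[ℝ] DerivTuple E r where
  toFun f := derivTuple r f.1 0
  map_add' f g := by
    funext k
    exact iteratedFDeriv_add_apply
      ((contDiff_of_smoothFunctions f).contDiffAt.of_le (by exact_mod_cast le_top))
      ((contDiff_of_smoothFunctions g).contDiffAt.of_le (by exact_mod_cast le_top))
  map_smul' c f := by
    funext k
    exact iteratedFDeriv_const_smul_apply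
      ((contDiff_of_smoothFunctions f).contDiffAt.of_le (by exact_mod_cast le_top))

/-- A linear map with values in a finite-dimensional space factors through its image, which is
given here by coordinates. -/
theorem exists_linear_factorization {A D : Type*} [AddCommGroup A] [Module ℝ A] [AddCommGroup D]
    [Module ℝ D] [FiniteDimensional ℝ D] (T : A →ₗ[ℝ] D) :
    ∃ (d : ℕ) (i : EuclideanSpace ℝ (Fin d) →ₗ[ℝ] D) (P : D →ₗ[ℝ] EuclideanSpace ℝ (Fin d))
      (g : EuclideanSpace ℝ (Fin d) →ₗ[ℝ] A), (∀ w, P (i w) = w) ∧ (∀ w, T (g w) = i w) ∧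
        ∀ a, i (P (T a)) = T a := by
  have b : LinearMap.range T ≃ₗ[ℝ]
      EuclideanSpace ℝ (Fin (Module.finrank ℝ (LinearMap.range T))) :=
    LinearEquiv.ofFinrankEq _ _ (by simp)
  obtain ⟨g, hg⟩ := T.rangeRestrict.exists_rightInverse_of_surjective T.range_rangeRestrict
  obtain ⟨P, hP⟩ := (LinearMap.range T).subtype.exists_leftInverse_of_injective
    (Submodule.ker_subtype _)
  have hP' : ∀ w : LinearMap.range T, P w.1 = w := fun w => congrArg (fun T => T w) hP
  have hg' : ∀ w : LinearMap.range T, T (g w) = w.1 := fun w =>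
    congrArg (fun T => (T w).1) hg
  refine ⟨_, (LinearMap.range T).subtype ∘ₗ b.symm.toLinearMap, b.toLinearMap ∘ₗ P,
    g ∘ₗ b.symm.toLinearMap, fun w => ?_, fun w => ?_, fun a => ?_⟩
  · simp [hP']
  · simp [hg']
  · have : P (T a) = ⟨T a, a, rfl⟩ := hP' ⟨T a, a, rfl⟩
    simp [this]

variable [FiniteDimensional ℝ E]

/-- The dimension of the space of `r`-jets without constant terms. -/
def jetDim (r : ℕ) : ℕ := (exists_linear_factorization (derivTupleMap E r)).choose

/-- The `r`-jets of functions on `E` at a point without their constant terms. -/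
abbrev JetFibre (r : ℕ) : Type := EuclideanSpace ℝ (Fin (jetDim E r))

/-- The fibre is the image of the derivative map on smooth functions, which avoids a description by
symmetric tensors. Here `i` is the inclusion of the image, `P` a linear retraction, and `s` comes
from a linear choice of preimages, normalized to vanish at the origin. A linear family over a
finite-dimensional space is a finite combination of fixed smooth functions, so `s` is jointly
smooth. -/
theorem exists_jetFibre_maps (r : ℕ) : ∃ (i : JetFibre E r →L[ℝ] DerivTuple E r)
    (P : DerivTuple E r →L[ℝ] JetFibre E r) (s : JetFibre E r → E → ℝ),
      (∀ w, P (i w) = w) ∧ (∀ f : smoothFunctions E, i (P (derivTuple r f.1 0)) =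
        derivTuple r f.1 0) ∧ ContDiff ℝ ∞ (fun q : JetFibre E r × E => s q.1 q.2) ∧
      (∀ w, s w 0 = 0) ∧ ∀ w, derivTuple r (s w) 0 = i w := by
  obtain ⟨i, P, g, h1, h2, h3⟩ : ∃ (i : JetFibre E r →ₗ[ℝ] DerivTuple E r)
      (P : DerivTuple E r →ₗ[ℝ] JetFibre E r) (g : JetFibre E r →ₗ[ℝ] smoothFunctions E),
      (∀ w, P (i w) = w) ∧ (∀ w, derivTupleMap E r (g w) = i w) ∧
        ∀ a, i (P (derivTupleMap E r a)) = derivTupleMap E r a :=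
    (exists_linear_factorization (derivTupleMap E r)).choose_spec
  refine ⟨LinearMap.toContinuousLinearMap i, LinearMap.toContinuousLinearMap P,
    fun w y => (g w).1 y - (g w).1 0, h1, h3, ?_, fun w => sub_self _, fun w => ?_⟩
  · let b := Module.finBasis ℝ (JetFibre E r)
    have e : ∀ w : JetFibre E r, ∀ y, (g w).1 y = ∑ i, b.repr w i * (g (b i)).1 y := by
      intro w y
      conv_lhs => rw [← b.sum_repr w]
      rw [map_sum]
      simp [Finset.sum_apply]
    have hs : ContDiff ℝ ∞ (fun q : JetFibre E r × E => (g q.1).1 q.2) := by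
      rw [show (fun q : JetFibre E r × E => (g q.1).1 q.2) = _ from funext fun q => e q.1 q.2]
      refine ContDiff.sum fun i _ => ContDiff.mul ?_
        ((contDiff_of_smoothFunctions (g (b i))).comp contDiff_snd)
      exact ((LinearMap.toContinuousLinearMap (b.coord i)).contDiff).comp contDiff_fst
    exact hs.sub (hs.comp (contDiff_fst.prodMk contDiff_const))
  · refine Eq.trans ?_ (h2 w)
    funext k
    have e : (fun y => (g w).1 y - (g w).1 0) = (g w).1 - fun _ => (g w).1 0 := rfl
    simp only [derivTuple]
    rw [e, iteratedFDeriv_sub_apply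
      ((contDiff_of_smoothFunctions (g w)).contDiffAt.of_le (by exact_mod_cast le_top))
      contDiffAt_const, iteratedFDeriv_const_of_ne (by omega)]
    simp only [Pi.zero_apply, sub_zero]
    rfl

variable {E}

/-- The derivatives given by a jet. -/
def jetDerivs {r : ℕ} : JetFibre E r →L[ℝ] DerivTuple E r := (exists_jetFibre_maps E r).choose

/-- A left inverse of `jetDerivs`. -/
def jetRetraction (r : ℕ) : DerivTuple E r →L[ℝ] JetFibre E r :=
  (exists_jetFibre_maps E r).choose_spec.choose

/-- A smooth function with given jet at the origin that vanishes there. -/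
def jetSection {r : ℕ} : JetFibre E r → E → ℝ :=
  (exists_jetFibre_maps E r).choose_spec.choose_spec.choose

theorem jetFibre_maps_spec (r : ℕ) : (∀ w : JetFibre E r, jetRetraction r (jetDerivs w) = w) ∧
    (∀ f : smoothFunctions E, jetDerivs (jetRetraction r (derivTuple r f.1 0)) =
        derivTuple r f.1 0) ∧ ContDiff ℝ ∞ (fun q : JetFibre E r × E => jetSection q.1 q.2) ∧
      (∀ w : JetFibre E r, jetSection w 0 = 0) ∧
      ∀ w : JetFibre E r, derivTuple r (jetSection w) 0 = jetDerivs w :=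
  (exists_jetFibre_maps E r).choose_spec.choose_spec.choose_spec

theorem jetRetraction_jetDerivs {r : ℕ} (w : JetFibre E r) :
    jetRetraction r (jetDerivs w) = w := (jetFibre_maps_spec r).1 w

theorem contDiff_jetSection {r : ℕ} :
    ContDiff ℝ ∞ (fun q : JetFibre E r × E => jetSection q.1 q.2) := (jetFibre_maps_spec r).2.2.1

theorem jetSection_zero {r : ℕ} (w : JetFibre E r) : jetSection w 0 = 0 :=
  (jetFibre_maps_spec r).2.2.2.1 w

theorem derivTuple_jetSection {r : ℕ} (w : JetFibre E r) :
    derivTuple r (jetSection w) 0 = jetDerivs w := (jetFibre_maps_spec r).2.2.2.2 w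

/-- The jet of `f` at `x` without its constant term. -/
def jetAt (r : ℕ) (f : E → ℝ) (x : E) : JetFibre E r := jetRetraction r (derivTuple r f x)

/-- Local representatives of maps are smooth only near a point, whereas `JetFibre` is defined by
functions smooth on all of `E`. Truncating the argument of `f (x + ·)` bridges this without changing
derivatives at the origin. -/
theorem exists_smoothFunctions_derivTuple {f : E → ℝ} {x : E}
    (hf : ∀ᶠ y in 𝓝 x, ContDiffAt ℝ ∞ f y) :
    ∃ g : smoothFunctions E, ∀ r, derivTuple r g.1 0 = derivTuple r f x := by
  obtain ⟨ε, hε, hb⟩ := Metric.eventually_nhds_iff_ball.1 hf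
  obtain ⟨ρ, hρ, h0, hs⟩ := exists_contDiff_truncation (E := E) hε
  have hsm : ContDiff ℝ ∞ (fun y => f (x + ρ y)) := by
    rw [contDiff_iff_contDiffAt]
    intro y
    exact ContDiffAt.comp y (g := f) (f := fun y => x + ρ y) (hb _ (by simpa using hs y))
      (contDiffAt_const.add hρ.contDiffAt)
  refine ⟨⟨_, hsm⟩, fun r => ?_⟩
  funext k
  change iteratedFDeriv ℝ (k.val + 1) (fun y => f (x + ρ y)) 0 = iteratedFDeriv ℝ (k.val + 1) f x
  have : (fun y => f (x + ρ y)) =ᶠ[𝓝 0] fun y => f (x + y) := by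
    filter_upwards [h0] with y hy
    rw [hy, id]
  rw [(this.iteratedFDeriv ℝ _).eq_of_nhds, iteratedFDeriv_comp_add_left, add_zero]

theorem jetDerivs_jetAt {r : ℕ} {f : E → ℝ} {x : E} (hf : ∀ᶠ y in 𝓝 x, ContDiffAt ℝ ∞ f y) :
    jetDerivs (jetAt r f x) = derivTuple r f x := by
  obtain ⟨g, hg⟩ := exists_smoothFunctions_derivTuple hf
  rw [jetAt, ← hg]
  exact (jetFibre_maps_spec r).2.1 g

theorem sameDerivs_iff_jetAt {r : ℕ} {f g : E → ℝ} {x : E}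
    (hf : ∀ᶠ y in 𝓝 x, ContDiffAt ℝ ∞ f y) (hg : ∀ᶠ y in 𝓝 x, ContDiffAt ℝ ∞ g y) :
    SameDerivs r f g x ↔ f x = g x ∧ jetAt r f x = jetAt r g x := by
  have e : jetAt r f x = jetAt r g x ↔ derivTuple r f x = derivTuple r g x :=
    ⟨fun h => by rw [← jetDerivs_jetAt hf, h, jetDerivs_jetAt hg], fun h => by simp [jetAt, h]⟩
  rw [e]
  constructor
  · exact fun h => ⟨h.apply_eq, funext fun k => h _ k.2⟩
  · rintro ⟨h0, h1⟩ k hk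
    cases k with
    | zero => ext v; simpa using h0
    | succ k => exact congrFun h1 ⟨k, hk⟩

theorem jetAt_congr {r : ℕ} {f g : E → ℝ} {x : E} (h : f =ᶠ[𝓝 x] g) :
    jetAt r f x = jetAt r g x := by
  unfold jetAt
  congr 1
  funext k
  exact (h.iteratedFDeriv ℝ _).eq_of_nhds

theorem jetAt_const_add_jetSection {r : ℕ} (c : ℝ) (w : JetFibre E r) (x : E) :
    jetAt r (fun y => c + jetSection w (y - x)) x = w := by
  have hs : ContDiff ℝ ∞ (jetSection w) :=
    contDiff_jetSection.comp (contDiff_const.prodMk contDiff_id)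
  have hf : ContDiff ℝ ∞ (fun y => c + jetSection w (y - x)) := by fun_prop
  refine Eq.trans (congrArg (jetRetraction r) ?_) (jetRetraction_jetDerivs w)
  rw [← derivTuple_jetSection w]
  funext k
  simp only [derivTuple]
  have hs' : ContDiff ℝ ∞ (fun y => jetSection w (y - x)) := by fun_prop
  have e : (fun y => c + jetSection w (y - x)) =
    (fun _ => c) + fun y => jetSection w (y - x) := rfl
  rw [e, iteratedFDeriv_add_apply contDiffAt_const
    (hs'.contDiffAt.of_le (by exact_mod_cast le_top)), iteratedFDeriv_const_of_ne (by omega),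
    iteratedFDeriv_comp_sub]
  simp

theorem ContDiffAt.jetAt_param {P : Type*} [NormedAddCommGroup P] [NormedSpace ℝ P]
    {g : P → E → ℝ} {ξ : P → E} {t : P} (hg : ContDiffAt ℝ ∞ (Function.uncurry g) (t, ξ t))
    (hξ : ContDiffAt ℝ ∞ ξ t) (r : ℕ) :
    ContDiffAt ℝ ∞ (fun s => jetAt r (g s) (ξ s)) t := by
  refine ContDiffAt.continuousLinearMap_comp (jetRetraction (E := E) r) ?_
  rw [contDiffAt_pi]
  exact fun k => hg.iteratedFDeriv_param hξ _

/-- Forgetting the derivatives of high order. -/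
def lowerFibre {r r' : ℕ} (h : r' ≤ r) : JetFibre E r →L[ℝ] JetFibre E r' :=
  jetRetraction r' ∘L
    (ContinuousLinearMap.pi fun k : Fin r' => ContinuousLinearMap.proj (Fin.castLE h k)) ∘L
      jetDerivs

theorem lowerFibre_jetAt {r r' : ℕ} (h : r' ≤ r) {f : E → ℝ} {x : E}
    (hf : ∀ᶠ y in 𝓝 x, ContDiffAt ℝ ∞ f y) :
    lowerFibre h (jetAt r f x) = jetAt r' f x := by
  simp only [lowerFibre, ContinuousLinearMap.comp_apply, jetDerivs_jetAt hf]
  rfl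

theorem exists_jetAt_eq {r : ℕ} (w : JetFibre E r) :
    ∃ f : E → ℝ, ContDiff ℝ ∞ f ∧ jetAt r f 0 = w := by
  refine ⟨_, ?_, jetAt_const_add_jetSection 0 w 0⟩
  exact contDiff_const.add (contDiff_jetSection.comp
    (contDiff_const.prodMk (contDiff_id.sub contDiff_const)))

theorem lowerFibre_surjective {r r' : ℕ} (h : r' ≤ r) :
    Function.Surjective (lowerFibre (E := E) h) := by
  intro w
  obtain ⟨f, hf, rfl⟩ := exists_jetAt_eq w
  exact ⟨jetAt r f 0, lowerFibre_jetAt h (Filter.Eventually.of_forall fun y => hf.contDiffAt)⟩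

end JetFibre

/-! ## Charts with values in normed spaces -/

section SmoothCharts

variable {d : ℕ} {Z : Type*} [TopologicalSpace Z] [ChartedSpace (EuclideanSpace ℝ (Fin d)) Z]
  {V : Type*} [NormedAddCommGroup V] [NormedSpace ℝ V]

variable (d) in
/-- Charts of a manifold with values in a normed space that need not be the model space. -/
def IsSmoothChart (e : OpenPartialHomeomorph Z V) : Prop :=
  ContMDiffOn (𝓡 d) 𝓘(ℝ, V) ∞ e e.source ∧ ContMDiffOn 𝓘(ℝ, V) (𝓡 d) ∞ e.symm e.target

theorem IsSmoothChart.contMDiffAt {e : OpenPartialHomeomorph Z V} (he : IsSmoothChart d e) {z : Z}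
    (hz : z ∈ e.source) : ContMDiffAt (𝓡 d) 𝓘(ℝ, V) ∞ e z :=
  he.1.contMDiffAt (e.open_source.mem_nhds hz)

theorem IsSmoothChart.contMDiffAt_symm {e : OpenPartialHomeomorph Z V} (he : IsSmoothChart d e)
    {y : V} (hy : y ∈ e.target) : ContMDiffAt 𝓘(ℝ, V) (𝓡 d) ∞ e.symm y :=
  he.2.contMDiffAt (e.open_target.mem_nhds hy)

theorem isSmoothChart_of_mem_maximalAtlas [IsManifold (𝓡 d) ∞ Z]
    {e : OpenPartialHomeomorph Z (EuclideanSpace ℝ (Fin d))}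
    (he : e ∈ IsManifold.maximalAtlas (𝓡 d) ∞ Z) : IsSmoothChart d e :=
  ⟨contMDiffOn_of_mem_maximalAtlas he, contMDiffOn_symm_of_mem_maximalAtlas he⟩

theorem IsSmoothChart.mem_maximalAtlas [IsManifold (𝓡 d) ∞ Z]
    {e : OpenPartialHomeomorph Z (EuclideanSpace ℝ (Fin d))} (he : IsSmoothChart d e) :
    e ∈ IsManifold.maximalAtlas (𝓡 d) ∞ Z :=
  e.mem_maximalAtlas_of_contMDiffOn he.1 he.2

theorem IsSmoothChart.trans_equiv {W : Type*} [NormedAddCommGroup W] [NormedSpace ℝ W]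
    {e : OpenPartialHomeomorph Z V} (he : IsSmoothChart d e) (L : V ≃L[ℝ] W) :
    IsSmoothChart d (e.transHomeomorph L.toHomeomorph) := by
  refine ⟨?_, ?_⟩
  · exact L.contDiff.contMDiff.comp_contMDiffOn he.1
  · exact he.2.comp (t := e.target) L.symm.contDiff.contMDiff.contMDiffOn fun _ h => h

section Maps

variable {E' H' Z' : Type*} [NormedAddCommGroup E'] [NormedSpace ℝ E'] [TopologicalSpace H']
  {I' : ModelWithCorners ℝ E' H'} [TopologicalSpace Z'] [ChartedSpace H' Z']

/-- A map with values in the domain of a chart is smooth if it is smooth in the chart. -/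
theorem IsSmoothChart.contMDiffAt_of_comp {e : OpenPartialHomeomorph Z V}
    (he : IsSmoothChart d e) {x : Z'} {f : Z' → Z} (hfe : ∀ᶠ y in 𝓝 x, f y ∈ e.source)
    (hf : ContMDiffAt I' 𝓘(ℝ, V) ∞ (e ∘ f) x) : ContMDiffAt I' (𝓡 d) ∞ f x := by
  refine (ContMDiffAt.comp x (he.contMDiffAt_symm (y := (e ∘ f) x)
    (e.map_source hfe.self_of_nhds)) hf).congr_of_eventuallyEq ?_
  filter_upwards [hfe] with y hy
  simp [e.left_inv hy]

/-- A map on a product is smooth if it is smooth in charts of the factors. -/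
theorem IsSmoothChart.contMDiffAt_prod {d₂ : ℕ} {Z₂ V₂ : Type*} [TopologicalSpace Z₂]
    [ChartedSpace (EuclideanSpace ℝ (Fin d₂)) Z₂] [NormedAddCommGroup V₂] [NormedSpace ℝ V₂]
    {e : OpenPartialHomeomorph Z V} (he : IsSmoothChart d e) {e₂ : OpenPartialHomeomorph Z₂ V₂}
    (he₂ : IsSmoothChart d₂ e₂) {z : Z × Z₂} (hz : z.1 ∈ e.source) (hz₂ : z.2 ∈ e₂.source)
    {f : Z × Z₂ → Z'}
    (hf : ContMDiffAt 𝓘(ℝ, V × V₂) I' ∞ (fun q : V × V₂ => f (e.symm q.1, e₂.symm q.2))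
      (e z.1, e₂ z.2)) :
    ContMDiffAt ((𝓡 d).prod (𝓡 d₂)) I' ∞ f z := by
  have h1 : ContMDiffAt ((𝓡 d).prod (𝓡 d₂)) 𝓘(ℝ, V × V₂) ∞
      (fun q : Z × Z₂ => (e q.1, e₂ q.2)) z := by
    refine ContMDiffAt.prodMk_space ?_ ?_
    · exact (he.contMDiffAt hz).comp z contMDiffAt_fst
    · exact (he₂.contMDiffAt hz₂).comp z contMDiffAt_snd
  refine (ContMDiffAt.comp z hf h1).congr_of_eventuallyEq ?_
  have hn : e.source ×ˢ e₂.source ∈ 𝓝 z :=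
    (e.open_source.prod e₂.open_source).mem_nhds ⟨hz, hz₂⟩
  filter_upwards [hn] with q hq
  simp [e.left_inv hq.1, e₂.left_inv hq.2]

end Maps

/-- A coordinate system near a point extends to a globally defined smooth map. -/
theorem exists_contMDiff_eventuallyEq_chart [T2Space Z] [IsManifold (𝓡 d) ∞ Z]
    {ψ : OpenPartialHomeomorph Z (EuclideanSpace ℝ (Fin d))}
    (hψ : ψ ∈ IsManifold.maximalAtlas (𝓡 d) ∞ Z) {z : Z} (hz : z ∈ ψ.source) :
    ∃ B : Z → EuclideanSpace ℝ (Fin d), ContMDiff (𝓡 d) (𝓡 d) ∞ B ∧ B =ᶠ[𝓝 z] ψ := by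
  obtain ⟨f, -, hf⟩ := (SmoothBumpFunction.nhds_basis_tsupport (I := 𝓡 d) z).mem_iff.1
    (ψ.open_source.mem_nhds hz)
  -- The closed support of the bump function `f` lies in the domain of `ψ`, so the meaningless
  -- values of `ψ` elsewhere are multiplied by zero.
  refine ⟨fun x => f x • ψ x, fun x => ?_, ?_⟩
  · by_cases hx : x ∈ tsupport f
    · exact f.contMDiffAt.smul
        (contMDiffAt_of_mem_maximalAtlas hψ (hf hx))
    · have : (fun x => f x • ψ x) =ᶠ[𝓝 x] fun _ => 0 := by
        filter_upwards [notMem_tsupport_iff_eventuallyEq.1 hx] with y hy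
        simp [hy]
      exact contMDiffAt_const.congr_of_eventuallyEq this
  · filter_upwards [f.eventuallyEq_one] with y hy
    simp [hy]

end SmoothCharts

/-! ## Manifold structures from charts -/

section Construction

variable {X : Type u} {V : Type} [NormedAddCommGroup V] [NormedSpace ℝ V] [FiniteDimensional ℝ V]

/-- A set covered by smoothly compatible charts is a manifold, if the topology defined by the
charts is Hausdorff and second countable. The Hausdorff property is ensured by a continuous map `p`
to a Hausdorff space whose fibres are contained in charts. -/
theorem exists_smoothStructure {I : Type*} (e : I → PartialEquiv X V)
    (hcov : ∀ x, ∃ i, x ∈ (e i).source)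
    (hopen : ∀ i j, IsOpen ((e i).symm.trans (e j)).source)
    (hsm : ∀ i j, ContDiffOn ℝ ∞ ((e i).symm.trans (e j)) ((e i).symm.trans (e j)).source)
    {B : Type*} [TopologicalSpace B] [T2Space B] (p : X → B)
    (hp : ∀ i, ContinuousOn (p ∘ (e i).symm) (e i).target)
    (hsep : ∀ x y, p x = p y → ∃ i, x ∈ (e i).source ∧ y ∈ (e i).source)
    (hcount : ∃ s : Set I, s.Countable ∧ ∀ x, ∃ i ∈ s, x ∈ (e i).source) :
    ∃ (S : SmoothStructure X) (E : I → OpenPartialHomeomorph S.Space V),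
      Nonempty (V ≃L[ℝ] EuclideanSpace ℝ (Fin S.dim)) ∧ ∀ i,
        (E i).toPartialEquiv = e i ∧ IsSmoothChart S.dim (E i) := by
  -- A `SmoothStructure` is modelled on a coordinate space, so the charts are composed with `L` for
  -- the construction. This is undone again in the charts `E`.
  set L : V ≃L[ℝ] EuclideanSpace ℝ (Fin (Module.finrank ℝ V)) := toEuclidean with hL
  choose i₀ hi₀ using hcov
  have hsrc : ∀ i j, (((e i).transEquiv L.toEquiv).symm.trans ((e j).transEquiv L.toEquiv)).source =
      L.symm ⁻¹' ((e i).symm.trans (e j)).source := by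
    intro i j
    ext x
    simp [PartialEquiv.trans_source]
  have hsm' : ∀ i j, ContDiffOn ℝ ∞
      (((e i).transEquiv L.toEquiv).symm.trans ((e j).transEquiv L.toEquiv))
      (((e i).transEquiv L.toEquiv).symm.trans ((e j).transEquiv L.toEquiv)).source := by
    intro i j
    rw [hsrc]
    exact L.contDiff.comp_contDiffOn ((hsm i j).comp L.symm.contDiff.contDiffOn fun _ h => h)
  let core : ChartedSpaceCore (EuclideanSpace ℝ (Fin (Module.finrank ℝ V))) X :=
    { atlas := range fun i => (e i).transEquiv L.toEquiv
      chartAt := fun x => (e (i₀ x)).transEquiv L.toEquiv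
      mem_chart_source := hi₀
      chart_mem_atlas := fun x => ⟨_, rfl⟩
      open_source := by
        rintro _ _ ⟨i, rfl⟩ ⟨j, rfl⟩
        rw [hsrc]
        exact (hopen i j).preimage L.symm.continuous
      continuousOn_toFun := by
        rintro _ _ ⟨i, rfl⟩ ⟨j, rfl⟩
        exact (hsm' i j).continuousOn }
  let τ : TopologicalSpace X := core.toTopologicalSpace
  let cs : ChartedSpace (EuclideanSpace ℝ (Fin (Module.finrank ℝ V))) X := core.toChartedSpace
  let c : I → OpenPartialHomeomorph X (EuclideanSpace ℝ (Fin (Module.finrank ℝ V))) := fun i =>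
    core.openPartialHomeomorph ((e i).transEquiv L.toEquiv) ⟨i, rfl⟩
  have hc : ∀ i, c i ∈ atlas (EuclideanSpace ℝ (Fin (Module.finrank ℝ V))) X := by
    intro i
    exact mem_iUnion₂.2 ⟨_, ⟨i, rfl⟩, rfl⟩
  have hc' : ∀ f ∈ atlas (EuclideanSpace ℝ (Fin (Module.finrank ℝ V))) X, ∃ i, f = c i := by
    intro f hf
    obtain ⟨_, ⟨i, rfl⟩, h⟩ := mem_iUnion₂.1 hf
    exact ⟨i, h⟩
  have man : IsManifold (𝓡 (Module.finrank ℝ V)) ∞ X := by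
    refine isManifold_of_contDiffOn _ _ _ fun f f' hf hf' => ?_
    obtain ⟨i, rfl⟩ := hc' f hf
    obtain ⟨j, rfl⟩ := hc' f' hf'
    have := hsm' i j
    simpa using! this
  let E : I → OpenPartialHomeomorph X V := fun i => (c i).transHomeomorph L.symm.toHomeomorph
  have hE : ∀ i, (E i).toPartialEquiv = e i := by
    intro i
    refine PartialEquiv.ext (fun x => ?_) (fun x => ?_) ?_
    · exact L.symm_apply_apply _
    · exact congrArg (e i).symm (L.symm_apply_apply _)
    · rfl
  have hEc : ∀ i, IsSmoothChart (Module.finrank ℝ V) (E i) := fun i =>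
    (isSmoothChart_of_mem_maximalAtlas (IsManifold.subset_maximalAtlas (hc i))).trans_equiv L.symm
  have hEs : ∀ i, (E i).source = (e i).source := fun i => congrArg PartialEquiv.source (hE i)
  have hpc : Continuous p := by
    rw [continuous_iff_continuousAt]
    intro x
    have hx : x ∈ (E (i₀ x)).source := by rw [hEs]; exact hi₀ x
    have h1 : ContinuousAt ((p ∘ (e (i₀ x)).symm) ∘ E (i₀ x)) x := by
      refine ContinuousAt.comp ?_ ((E (i₀ x)).continuousAt hx)
      refine (hp (i₀ x)).continuousAt ?_
      rw [← hE]
      exact (E (i₀ x)).open_target.mem_nhds ((E (i₀ x)).map_source hx)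
    refine h1.congr ?_
    filter_upwards [(E (i₀ x)).open_source.mem_nhds hx] with y hy
    have : (e (i₀ x)).symm (E (i₀ x) y) = y := by
      rw [← hE]; exact (E (i₀ x)).left_inv hy
    simp [this]
  -- Points in different fibres of `p` are separated in the Hausdorff space `B`; points of the same
  -- fibre lie in one chart and are separated there.
  have ht2 : T2Space X := by
    refine ⟨fun x y hxy => ?_⟩
    by_cases hpxy : p x = p y
    · obtain ⟨i, hx, hy⟩ := hsep x y hpxy
      rw [← hEs] at hx hy
      have hne : E i x ≠ E i y := fun h => hxy ((E i).injOn hx hy h)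
      obtain ⟨U, W, hU, hW, hxU, hyW, hd⟩ := t2_separation hne
      refine ⟨_, _, (E i).isOpen_inter_preimage hU, (E i).isOpen_inter_preimage hW, ⟨hx, hxU⟩,
        ⟨hy, hyW⟩, ?_⟩
      exact (hd.preimage (E i)).mono inter_subset_right inter_subset_right
    · obtain ⟨U, W, hU, hW, hxU, hyW, hd⟩ := t2_separation hpxy
      exact ⟨_, _, hU.preimage hpc, hW.preimage hpc, hxU, hyW, hd.preimage p⟩
  have hsc : SecondCountableTopology X := by
    obtain ⟨s, hs, hcov⟩ := hcount
    have := hs.to_subtype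
    have : ∀ i : s, SecondCountableTopology (E i).source := fun i =>
      (E i).secondCountableTopology_source
    refine TopologicalSpace.secondCountableTopology_of_countable_cover (U := fun i : s => (E i).source)
      (fun i => (E i).open_source) ?_
    rw [eq_univ_iff_forall]
    intro x
    obtain ⟨i, hi, hx⟩ := hcov x
    exact mem_iUnion.2 ⟨⟨i, hi⟩, by rw [hEs]; exact hx⟩
  exact ⟨⟨_, τ, ht2, hsc, cs, man⟩, E, ⟨L⟩, fun i => ⟨hE i, hEc i⟩⟩

end Construction

/-! ## Slices -/

section Slices

variable {b : ℕ} {A : Type} [NormedAddCommGroup A]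

open Classical in
/-- The chart of a slice. -/
def sliceChart {Z : Type*} [TopologicalSpace Z] {Y : Set Z}
    (e : OpenPartialHomeomorph Z (A × EuclideanSpace ℝ (Fin b)))
    (he : ∀ x ∈ e.source, x ∈ Y ↔ (e x).1 = 0) (y₀ : Y) :
    OpenPartialHomeomorph Y (EuclideanSpace ℝ (Fin b)) where
  toFun y := (e y).2
  -- Outside of the target, `e.symm (0, w)` need not lie in `Y`; the point `y₀` is only a default
  -- value.
  invFun w := if h : ((0, w) : A × EuclideanSpace ℝ (Fin b)) ∈ e.target then
    ⟨e.symm (0, w), (he _ (e.map_target h)).2 (by rw [e.right_inv h])⟩ else y₀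
  source := {y | y.1 ∈ e.source}
  target := {w | (0, w) ∈ e.target}
  map_source' := by
    intro y hy
    have h0 : (e y).1 = 0 := (he _ hy).1 y.2
    have := e.map_source hy
    rwa [← Prod.mk.eta (p := e y), h0] at this
  map_target' := by
    intro w hw
    have hw' : ((0, w) : A × EuclideanSpace ℝ (Fin b)) ∈ e.target := hw
    simp only [mem_ofPred_eq, hw', dif_pos]
    exact e.map_target hw'
  left_inv' := by
    intro y hy
    have h0 : (e y).1 = 0 := (he _ hy).1 y.2
    have h1 : ((0, (e y).2) : A × EuclideanSpace ℝ (Fin b)) = e y := by rw [← h0]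
    have h2 : ((0, (e y).2) : A × EuclideanSpace ℝ (Fin b)) ∈ e.target := by
      rw [h1]; exact e.map_source hy
    simp only [h2, dif_pos]
    refine Subtype.ext ?_
    simp only [h1]
    exact e.left_inv hy
  right_inv' := by
    intro w hw
    have hw' : ((0, w) : A × EuclideanSpace ℝ (Fin b)) ∈ e.target := hw
    simp only [hw', dif_pos]
    rw [e.right_inv hw']
  open_source := e.open_source.preimage continuous_subtype_val
  open_target := e.open_target.preimage (by fun_prop)
  continuousOn_toFun := continuous_snd.comp_continuousOn
    (e.continuousOn.comp continuous_subtype_val.continuousOn fun _ h => h)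
  continuousOn_invFun := by
    rw [Topology.IsInducing.subtypeVal.continuousOn_iff]
    refine ContinuousOn.congr (f := fun w => e.symm (0, w)) ?_ ?_
    · exact e.symm.continuousOn.comp (by fun_prop) fun _ h => h
    · intro w hw
      have hw' : ((0, w) : A × EuclideanSpace ℝ (Fin b)) ∈ e.target := hw
      simp only [Function.comp, hw', dif_pos]

theorem coe_sliceChart_symm {Z : Type*} [TopologicalSpace Z] {Y : Set Z}
    (e : OpenPartialHomeomorph Z (A × EuclideanSpace ℝ (Fin b)))
    (he : ∀ x ∈ e.source, x ∈ Y ↔ (e x).1 = 0) (y₀ : Y) {w : EuclideanSpace ℝ (Fin b)}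
    (hw : ((0, w) : A × EuclideanSpace ℝ (Fin b)) ∈ e.target) :
    ((sliceChart e he y₀).symm w).1 = e.symm (0, w) :=
  congrArg Subtype.val (dif_pos hw)

variable [NormedSpace ℝ A]

/-- Slice charts are smoothly compatible because their transition maps are restrictions of ambient
ones to the zero slice. They induce the subspace topology, and with respect to them the inclusion is
`w ↦ (0, w)`, the normal form of an immersion. -/
theorem exists_embedding_of_zero_slices {X : Type u} (S : SmoothStructure X) (Y : Set X)
    (L : (A × EuclideanSpace ℝ (Fin b)) ≃L[ℝ] EuclideanSpace ℝ (Fin S.dim))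
    (h : ∀ y ∈ Y, ∃ e : OpenPartialHomeomorph S.Space (A × EuclideanSpace ℝ (Fin b)),
      IsSmoothChart S.dim e ∧ S.point y ∈ e.source ∧ ∀ x ∈ e.source, x ∈ Y ↔ (e x).1 = 0) :
    IsEmbeddedSubmanifold S Y := by
  have h' : ∀ y : Y, ∃ e : OpenPartialHomeomorph S.Space (A × EuclideanSpace ℝ (Fin b)),
      IsSmoothChart S.dim e ∧ S.point y ∈ e.source ∧ ∀ x ∈ e.source, x ∈ Y ↔ (e x).1 = 0 :=
    fun y => h y y.2
  choose e he hye hY using h'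
  let Y' : Set S.Space := Y
  let c : Y' → OpenPartialHomeomorph Y' (EuclideanSpace ℝ (Fin b)) := fun y =>
    sliceChart (e y) (hY y) y
  have hsource : ∀ y z, z ∈ (c y).source ↔ z.1 ∈ (e y).source := fun y z => Iff.rfl
  let cs : ChartedSpace (EuclideanSpace ℝ (Fin b)) Y' :=
    { atlas := range c
      chartAt := c
      mem_chart_source := hye
      chart_mem_atlas := fun y => ⟨y, rfl⟩ }
  have man : IsManifold (𝓡 b) ∞ Y' := by
    refine isManifold_of_contDiffOn _ _ _ ?_
    rintro _ _ ⟨y, rfl⟩ ⟨z, rfl⟩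
    have key : ContDiffOn ℝ ∞ ((c y).symm.trans (c z)) ((c y).symm.trans (c z)).source := by
      have h1 : ContDiffOn ℝ ∞ ((e z) ∘ (e y).symm) ((e y).symm.trans (e z)).source := by
        rw [← contMDiffOn_iff_contDiffOn]
        exact (he z).1.comp ((he y).2.mono (fun x hx => hx.1)) fun x hx => hx.2
      have h2 : ContDiffOn ℝ ∞ (fun w => (((e z) ∘ (e y).symm) (0, w)).2)
          ((c y).symm.trans (c z)).source := by
        refine contDiff_snd.comp_contDiffOn (h1.comp (by fun_prop) ?_)
        intro w hw
        have hw1 : ((0, w) : A × EuclideanSpace ℝ (Fin b)) ∈ (e y).target := hw.1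
        have hw2 : ((c y).symm w).1 ∈ (e z).source := hw.2
        rw [coe_sliceChart_symm _ _ _ hw1] at hw2
        exact ⟨hw1, hw2⟩
      refine h2.congr fun w hw => ?_
      have hw1 : ((0, w) : A × EuclideanSpace ℝ (Fin b)) ∈ (e y).target := hw.1
      change (e z ((c y).symm w).1).2 = _
      rw [coe_sliceChart_symm _ _ _ hw1]
      rfl
    simpa using! key
  let τ : TopologicalSpace Y' := instTopologicalSpaceSubtype
  have t2 : T2Space Y' := inferInstance
  have sc : SecondCountableTopology Y' := inferInstance
  suffices hemb : Manifold.IsSmoothEmbedding (𝓡 b) (𝓡 S.dim) ∞ (Subtype.val : Y' → S.Space) from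
    ⟨⟨b, τ, t2, sc, cs, man⟩, hemb⟩
  refine ⟨?_, Topology.IsEmbedding.subtypeVal⟩
  refine Manifold.IsImmersionOfComplement.isImmersion (F := A) fun (y : Y') => ?_
  -- The normal form of an immersion is `w ↦ (w, 0)`, with the complement last, so the factors are
  -- swapped.
  let L' : (EuclideanSpace ℝ (Fin b) × A) ≃L[ℝ] EuclideanSpace ℝ (Fin S.dim) :=
    (ContinuousLinearEquiv.prodComm ℝ _ _).trans L
  refine Manifold.IsImmersionAtOfComplement.mk_of_charts L' (c y)
    ((e y).transHomeomorph L.toHomeomorph) (hye y) (hye y)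
    (IsManifold.subset_maximalAtlas ⟨y, rfl⟩) ((he y).trans_equiv L).mem_maximalAtlas
    (fun z hz => hz) ?_
  intro w hw
  have hw1 : ((0, w) : A × EuclideanSpace ℝ (Fin b)) ∈ (e y).target := by
    simpa [c, sliceChart] using hw
  change L (e y ((c y).symm w).1) = L (0, w)
  rw [coe_sliceChart_symm _ _ _ hw1, (e y).right_inv hw1]

/-- A subset that is locally given by fixing some coordinates of charts is a submanifold. -/
theorem isEmbeddedSubmanifold_of_slices {X : Type u} (S : SmoothStructure X) (Y : Set X)
    {C V : Type} [NormedAddCommGroup C] [NormedSpace ℝ C] [FiniteDimensional ℝ C]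
    [NormedAddCommGroup V] [NormedSpace ℝ V]
    (L : V ≃L[ℝ] EuclideanSpace ℝ (Fin S.dim)) (K : V ≃L[ℝ] A × C)
    (h : ∀ y ∈ Y, ∃ (e : OpenPartialHomeomorph S.Space V) (a : A), IsSmoothChart S.dim e ∧
      S.point y ∈ e.source ∧ ∀ x ∈ e.source, x ∈ Y ↔ (K (e x)).1 = a) :
    IsEmbeddedSubmanifold S Y := by
  let K' : V ≃L[ℝ] A × EuclideanSpace ℝ (Fin (Module.finrank ℝ C)) :=
    K.trans ((ContinuousLinearEquiv.refl ℝ A).prodCongr toEuclidean)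
  refine exists_embedding_of_zero_slices (A := A) (b := Module.finrank ℝ C) S Y
    (K'.symm.trans L) fun y hy => ?_
  obtain ⟨e, a, he, hye, hY⟩ := h y hy
  refine ⟨(e.transHomeomorph K'.toHomeomorph).transHomeomorph
    (Homeomorph.addRight (-a, 0)), ?_, hye, fun x hx => ?_⟩
  · have h1 := he.trans_equiv K'
    refine ⟨?_, ?_⟩
    · exact (contDiff_id.add contDiff_const).contMDiff.comp_contMDiffOn h1.1
    · have hd : ContDiff ℝ ∞ (fun q : A × EuclideanSpace ℝ (Fin (Module.finrank ℝ C)) =>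
          q + -(-a, 0)) := contDiff_id.add contDiff_const
      exact h1.2.comp hd.contMDiff.contMDiffOn fun q hq => hq
  · rw [hY x hx]
    change _ ↔ (K (e x)).1 + -a = 0
    rw [add_neg_eq_zero]

end Slices

section Embeddings

variable {E₁ E₂ E₃ : Type*} [NormedAddCommGroup E₁] [NormedSpace ℝ E₁] [NormedAddCommGroup E₂]
  [NormedSpace ℝ E₂] [NormedAddCommGroup E₃] [NormedSpace ℝ E₃]
  {H₁ H₂ H₃ : Type*} [TopologicalSpace H₁] [TopologicalSpace H₂] [TopologicalSpace H₃]
  {I₁ : ModelWithCorners ℝ E₁ H₁} {I₂ : ModelWithCorners ℝ E₂ H₂} {I₃ : ModelWithCorners ℝ E₃ H₃}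
  {M₁ M₂ M₃ : Type*} [TopologicalSpace M₁] [ChartedSpace H₁ M₁] [TopologicalSpace M₂]
  [ChartedSpace H₂ M₂] [TopologicalSpace M₃] [ChartedSpace H₃ M₃]

/-- A map to an embedded submanifold is smooth if it is smooth as a map to the ambient manifold. -/
theorem Manifold.IsSmoothEmbedding.contMDiffAt_of_comp {i : M₂ → M₃}
    (hi : Manifold.IsSmoothEmbedding I₂ I₃ ∞ i) {f : M₁ → M₂} {x : M₁}
    (hf : ContMDiffAt I₁ I₃ ∞ (fun y => i (f y)) x) : ContMDiffAt I₁ I₂ ∞ f x := by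
  rw [ContMDiffAt.iff_comp_isImmersionAt (hi.isImmersion.isImmersionAt (f x))]
  exact ⟨hi.isEmbedding.isInducing.continuousAt_iff.2 hf.continuousAt, hf⟩

end Embeddings

/-! ### Local triviality -/

section Bundles

variable {a b : ℕ} {Z : Type u} {B : Type v} [TopologicalSpace Z]
    [ChartedSpace (EuclideanSpace ℝ (Fin a)) Z] [TopologicalSpace B]
    [ChartedSpace (EuclideanSpace ℝ (Fin b)) B] {π : Z → B}

theorem isSmoothBundle_of_local_product (hs : Function.Surjective π)
    (hπ : ContMDiff (𝓡 a) (𝓡 b) ∞ π) {X : Type u} (T : SmoothStructure X)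
    (h : ∀ x : B, ∃ (U : Set B) (f : Z → T.Space) (g : B × T.Space → Z), IsOpen U ∧ x ∈ U ∧
      ContMDiffOn (𝓡 a) (𝓡 T.dim) ∞ f (π ⁻¹' U) ∧
      ContMDiffOn ((𝓡 b).prod (𝓡 T.dim)) (𝓡 a) ∞ g (U ×ˢ univ) ∧
      (∀ z, π z ∈ U → g (π z, f z) = z) ∧
      ∀ y ∈ U, ∀ t, π (g (y, t)) = y ∧ f (g (y, t)) = t) :
    IsSmoothBundle a b π := by
  refine ⟨hs, hπ, X, T, fun x => ?_⟩
  obtain ⟨U, f, g, hU, hx, hf, hg, h1, h2⟩ := h x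
  have hpf : ContMDiffOn (𝓡 a) ((𝓡 b).prod (𝓡 T.dim)) ∞ (fun z => (π z, f z)) (π ⁻¹' U) :=
    hπ.contMDiffOn.prodMk hf
  exact ⟨{
    toFun := fun z => (π z, f z)
    invFun := g
    source := π ⁻¹' U
    target := U ×ˢ univ
    map_source' := fun z hz => ⟨hz, trivial⟩
    map_target' := fun q hq => by
      have := (h2 q.1 hq.1 q.2).1
      rw [mem_preimage, this]
      exact hq.1
    left_inv' := fun z hz => h1 z hz
    right_inv' := fun q hq => Prod.ext (h2 q.1 hq.1 q.2).1 (h2 q.1 hq.1 q.2).2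
    open_source := hU.preimage hπ.continuous
    open_target := hU.prod isOpen_univ
    continuousOn_toFun := hpf.continuousOn
    continuousOn_invFun := hg.continuousOn
    baseSet := U
    open_baseSet := hU
    source_eq := rfl
    target_eq := rfl
    proj_toFun := fun _ _ => rfl }, hx, hpf, hg⟩

end Bundles

/-- The Euclidean space as a manifold in a higher universe. -/
theorem exists_smoothStructure_uliftEuclidean (d : ℕ) :
    ∃ (T : SmoothStructure (ULift.{u} (EuclideanSpace ℝ (Fin d))))
      (e : OpenPartialHomeomorph T.Space (EuclideanSpace ℝ (Fin d))),
        IsSmoothChart T.dim e ∧ e.source = univ ∧ e.target = univ := by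
  obtain ⟨S, E, -, hE⟩ := exists_smoothStructure (X := ULift.{u} (EuclideanSpace ℝ (Fin d)))
    (V := EuclideanSpace ℝ (Fin d)) (I := Unit) (fun _ => Equiv.ulift.toPartialEquiv)
    (fun x => ⟨(), trivial⟩) (fun _ _ => by simp) (fun _ _ => by
      simp only [PartialEquiv.trans_source, PartialEquiv.coe_trans]
      exact contDiff_id.contDiffOn) (B := EuclideanSpace ℝ (Fin d)) ULift.down
      (fun _ => continuous_id.continuousOn) (fun x y _ => ⟨(), trivial, trivial⟩)
      ⟨univ, countable_univ, fun x => ⟨(), trivial, trivial⟩⟩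
  exact ⟨S, E (), (hE ()).2, congrArg PartialEquiv.source (hE ()).1,
    congrArg PartialEquiv.target (hE ()).1⟩

/-! ## Jets in local coordinates -/

theorem SameDerivs.pi_iff {E κ : Type*} [NormedAddCommGroup E] [NormedSpace ℝ E] [Fintype κ] {r : ℕ}
    {f g : E → κ → ℝ} {x : E} (hf : ContDiffAt ℝ ∞ f x) (hg : ContDiffAt ℝ ∞ g x) :
    SameDerivs r f g x ↔ ∀ i, SameDerivs r (fun y => f y i) (fun y => g y i) x := by
  constructor
  · exact fun h i => h.comp_left (f := fun y : κ → ℝ => y i) (by fun_prop) hf hg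
  · intro h k hk
    have hk' : ((k : ℕ) : ℕ∞ω) ≤ ∞ := by exact_mod_cast le_top
    ext v i
    have e : ∀ u : E → κ → ℝ, ContDiffAt ℝ ∞ u x →
        iteratedFDeriv ℝ k u x v i = iteratedFDeriv ℝ k (fun y => u y i) x v := fun u hu =>
      (congrArg (fun T => T v) ((ContinuousLinearMap.proj (R := ℝ) (φ := fun _ : κ => ℝ)
        i).iteratedFDeriv_comp_left hu hk')).symm
    rw [e f hf, e g hg, h i k hk]

/-- This serves the transverse coordinates that are differences of leaf coordinates, as in
`AdaptedAtlas.generated`. -/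
theorem SameDerivs.sub_const_mul {E : Type*} [NormedAddCommGroup E] [NormedSpace ℝ E] {r : ℕ}
    {f₁ g₁ f₂ g₂ : E → ℝ} {x : E} (h₁ : SameDerivs r f₁ g₁ x) (h₂ : SameDerivs r f₂ g₂ x)
    (hf₁ : ContDiffAt ℝ ∞ f₁ x) (hg₁ : ContDiffAt ℝ ∞ g₁ x) (hf₂ : ContDiffAt ℝ ∞ f₂ x)
    (hg₂ : ContDiffAt ℝ ∞ g₂ x) (c : ℝ) :
    SameDerivs r (fun y => f₁ y - c * f₂ y) (fun y => g₁ y - c * g₂ y) x := by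
  intro k hk
  have hk' : ((k : ℕ) : ℕ∞ω) ≤ ∞ := by exact_mod_cast le_top
  have e : ∀ f g : E → ℝ, ContDiffAt ℝ ∞ f x → ContDiffAt ℝ ∞ g x →
      iteratedFDeriv ℝ k (fun y => f y - c * g y) x =
        iteratedFDeriv ℝ k f x - c • iteratedFDeriv ℝ k g x := by
    intro f g hf hg
    have hcg : ContDiffAt ℝ k (c • g) x := (hg.const_smul c).of_le hk'
    have : (fun y => f y - c * g y) = f - c • g := rfl
    rw [this, iteratedFDeriv_sub_apply (hf.of_le hk') hcg,
      iteratedFDeriv_const_smul_apply (hg.of_le hk')]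
  rw [e _ _ hf₁ hf₂, e _ _ hg₁ hg₂, h₁ k hk, h₂ k hk]

section SameJet

variable {n : ℕ} {H : Type u} [TopologicalSpace H] [ChartedSpace (EuclideanSpace ℝ (Fin n)) H]
  {V : Type} [NormedAddCommGroup V] [NormedSpace ℝ V]
  {ψ : OpenPartialHomeomorph H (EuclideanSpace ℝ (Fin n))} {h : H}

theorem contDiffAt_comp_chart_symm (hψ : ψ ∈ IsManifold.maximalAtlas (𝓡 n) ∞ H)
    (hh : h ∈ ψ.source) {a : H → V} (ha : ContMDiffAt (𝓡 n) 𝓘(ℝ, V) ∞ a h) :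
    ContDiffAt ℝ ∞ (a ∘ ψ.symm) (ψ h) := by
  rw [← contMDiffAt_iff_contDiffAt]
  refine ContMDiffAt.comp (ψ h) ?_ (contMDiffAt_symm_of_mem_maximalAtlas hψ (ψ.map_source hh))
  rwa [ψ.left_inv hh]

/-- Among the test curves are the preimages of straight lines in a chart, and these suffice by
`sameDerivs_of_lines`. The converse is the chain rule. -/
theorem sameJet_iff_sameDerivs (hψ : ψ ∈ IsManifold.maximalAtlas (𝓡 n) ∞ H) (hh : h ∈ ψ.source)
    {a b : H → V} (ha : ContMDiffAt (𝓡 n) 𝓘(ℝ, V) ∞ a h)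
    (hb : ContMDiffAt (𝓡 n) 𝓘(ℝ, V) ∞ b h) {r : ℕ} :
    SameJet n r a b h ↔ SameDerivs r (a ∘ ψ.symm) (b ∘ ψ.symm) (ψ h) := by
  have ha' := contDiffAt_comp_chart_symm hψ hh ha
  have hb' := contDiffAt_comp_chart_symm hψ hh hb
  constructor
  · intro hab
    refine sameDerivs_of_lines ha' hb' fun v k hk => ?_
    -- Test curves are defined on all of `ℝ`, so the line is truncated to remain in the image of the
    -- chart; near `0` nothing changes.
    obtain ⟨ε, hε, hball⟩ := Metric.isOpen_iff.1 ψ.open_target _ (ψ.map_source hh)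
    obtain ⟨ρ, hρ, hρ0, hρε⟩ := exists_contDiff_truncation (E := EuclideanSpace ℝ (Fin n)) hε
    have hmem : ∀ t : ℝ, ψ h + ρ (t • v) ∈ ψ.target := fun t => hball (by simpa using hρε _)
    have hγ : ContMDiff 𝓘(ℝ, ℝ) (𝓡 n) ∞ (fun t : ℝ => ψ.symm (ψ h + ρ (t • v))) := by
      intro t
      have hl : ContDiff ℝ ∞ (fun t : ℝ => ψ h + ρ (t • v)) :=
        contDiff_const.add (hρ.comp (contDiff_id.smul contDiff_const))
      exact ContMDiffAt.comp t (contMDiffAt_symm_of_mem_maximalAtlas hψ (hmem t))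
        hl.contMDiff.contMDiffAt
    have hl : ∀ᶠ t : ℝ in 𝓝 0, ρ (t • v) = t • v := by
      have : Filter.Tendsto (fun t : ℝ => t • v) (𝓝 0) (𝓝 0) := by
        have : Continuous fun t : ℝ => t • v := by fun_prop
        simpa using this.tendsto 0
      exact this hρ0
    have h0 : ψ.symm (ψ h + ρ ((0 : ℝ) • v)) = h := by
      rw [hl.self_of_nhds, zero_smul, add_zero, ψ.left_inv hh]
    have key := hab _ hγ h0 k hk
    have e : ∀ c : H → V, (c ∘ fun t : ℝ => ψ.symm (ψ h + ρ (t • v))) =ᶠ[𝓝 0]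
        fun t => (c ∘ ψ.symm) (ψ h + t • v) := by
      intro c
      filter_upwards [hl] with t ht
      simp [ht]
    rwa [(e a).iteratedDeriv_eq, (e b).iteratedDeriv_eq] at key
  · intro hab γ hγ h0 k hk
    have hψγ : ContDiffAt ℝ ∞ (ψ ∘ γ) 0 := by
      rw [← contMDiffAt_iff_contDiffAt]
      refine ContMDiffAt.comp 0 ?_ hγ.contMDiffAt
      exact contMDiffAt_of_mem_maximalAtlas hψ (by rwa [h0])
    have hx : (ψ ∘ γ) 0 = ψ h := by simp [h0]
    have e : ∀ c : H → V, c ∘ γ =ᶠ[𝓝 0] (c ∘ ψ.symm) ∘ (ψ ∘ γ) := by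
      intro c
      have : γ ⁻¹' ψ.source ∈ 𝓝 0 :=
        hγ.continuous.continuousAt.preimage_mem_nhds
          (ψ.open_source.mem_nhds (by rwa [h0]))
      filter_upwards [this] with t ht
      simp [ψ.left_inv ht]
    rw [(e a).iteratedDeriv_eq, (e b).iteratedDeriv_eq, iteratedDeriv_eq_iteratedFDeriv,
      iteratedDeriv_eq_iteratedFDeriv]
    rw [← hx] at hab ha' hb'
    rw [hab.comp_right ha' hb' hψγ k hk]

end SameJet

section LocalRep

variable {n : ℕ} {H : Type u} [TopologicalSpace H] [ChartedSpace (EuclideanSpace ℝ (Fin n)) H]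
  {m : ℕ} {M : Type v} [TopologicalSpace M] [ChartedSpace (EuclideanSpace ℝ (Fin m)) M]

/-- The map `f` in the charts `ψ` and `φ`. -/
def localRep (ψ : OpenPartialHomeomorph H (EuclideanSpace ℝ (Fin n)))
    (φ : OpenPartialHomeomorph M (EuclideanSpace ℝ (Fin m))) (f : H → M) :
    EuclideanSpace ℝ (Fin n) → EuclideanSpace ℝ (Fin m) := fun z => φ (f (ψ.symm z))

variable {ψ : OpenPartialHomeomorph H (EuclideanSpace ℝ (Fin n))}
  {φ φ' : OpenPartialHomeomorph M (EuclideanSpace ℝ (Fin m))} {h : H}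

omit [ChartedSpace (EuclideanSpace ℝ (Fin n)) H] [ChartedSpace (EuclideanSpace ℝ (Fin m)) M] in
theorem localRep_apply {f : H → M} (hh : h ∈ ψ.source) : localRep ψ φ f (ψ h) = φ (f h) := by
  rw [localRep, ψ.left_inv hh]

theorem contDiffAt_localRep (hψ : ψ ∈ IsManifold.maximalAtlas (𝓡 n) ∞ H)
    (hφ : φ ∈ IsManifold.maximalAtlas (𝓡 m) ∞ M) {f : H → M} (hf : ContMDiffAt (𝓡 n) (𝓡 m) ∞ f h)
    (hh : h ∈ ψ.source) (hu : f h ∈ φ.source) : ContDiffAt ℝ ∞ (localRep ψ φ f) (ψ h) :=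
  contDiffAt_comp_chart_symm (a := φ ∘ f) hψ hh
    ((contMDiffAt_of_mem_maximalAtlas hφ hu).comp h hf)

theorem eventually_contDiffAt_localRep (hψ : ψ ∈ IsManifold.maximalAtlas (𝓡 n) ∞ H)
    (hφ : φ ∈ IsManifold.maximalAtlas (𝓡 m) ∞ M) {f : H → M} (hf : ContMDiff (𝓡 n) (𝓡 m) ∞ f)
    (hh : h ∈ ψ.source) (hu : f h ∈ φ.source) :
    ∀ᶠ z in 𝓝 (ψ h), ContDiffAt ℝ ∞ (localRep ψ φ f) z := by
  have h1 : ContinuousAt (fun z => f (ψ.symm z)) (ψ h) := by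
    refine ContinuousAt.comp (g := f) ?_ (ψ.continuousAt_symm (ψ.map_source hh))
    exact hf.continuous.continuousAt
  have h2 : (fun z => f (ψ.symm z)) ⁻¹' φ.source ∈ 𝓝 (ψ h) :=
    h1.preimage_mem_nhds (φ.open_source.mem_nhds (by rwa [ψ.left_inv hh]))
  filter_upwards [h2, ψ.open_target.mem_nhds (ψ.map_source hh)] with z hz hz'
  have := contDiffAt_localRep hψ hφ (hf.contMDiffAt (x := ψ.symm z)) (ψ.map_target hz') hz
  rwa [ψ.right_inv hz'] at this

theorem ContDiffAt.coord {E : Type*} [NormedAddCommGroup E] [NormedSpace ℝ E]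
    {f : E → EuclideanSpace ℝ (Fin m)} {x : E} (hf : ContDiffAt ℝ ∞ f x) (j : Fin m) :
    ContDiffAt ℝ ∞ (fun z => f z j) x := (contDiffAt_euclidean.1 hf) j

/-- Change of the chart of the target. -/
theorem sameDerivs_localRep_of_dependence (hψ : ψ ∈ IsManifold.maximalAtlas (𝓡 n) ∞ H)
    (hφ : φ ∈ IsManifold.maximalAtlas (𝓡 m) ∞ M) (hφ' : φ' ∈ IsManifold.maximalAtlas (𝓡 m) ∞ M)
    {f g : H → M} (hf : ContMDiffAt (𝓡 n) (𝓡 m) ∞ f h) (hg : ContMDiffAt (𝓡 n) (𝓡 m) ∞ g h)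
    (hfg : f h = g h) (hh : h ∈ ψ.source) (hu : f h ∈ φ.source) (hu' : f h ∈ φ'.source) {r : ℕ}
    (i : Fin m) (K : Set (Fin m)) (hK : ∀ x ∈ (φ.symm.trans φ').source, ∀ j, j ∉ K →
      (fderiv ℝ (φ.symm.trans φ') x (EuclideanSpace.single j 1)) i = 0)
    (hj : ∀ j ∈ K, SameDerivs r (fun z => localRep ψ φ f z j) (fun z => localRep ψ φ g z j) (ψ h)) :
    SameDerivs r (fun z => localRep ψ φ' f z i) (fun z => localRep ψ φ' g z i) (ψ h) := by
  set e := φ.symm.trans φ' with he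
  have hes : ContDiffOn ℝ ∞ e e.source := by
    rw [← contMDiffOn_iff_contDiffOn]
    exact (contMDiffOn_of_mem_maximalAtlas hφ').comp
      ((contMDiffOn_symm_of_mem_maximalAtlas hφ).mono fun x hx => hx.1) fun x hx => hx.2
  have hmem : φ (f h) ∈ e.source := ⟨φ.map_source hu, by
    change φ.symm (φ (f h)) ∈ φ'.source
    rwa [φ.left_inv hu]⟩
  have hes' : ∀ y ∈ e.source, ContDiffAt ℝ ∞ e y := fun y hy =>
    hes.contDiffAt (e.open_source.mem_nhds hy)
  have key : ∀ k : H → M, ContMDiffAt (𝓡 n) (𝓡 m) ∞ k h → k h ∈ φ.source →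
      (fun z => localRep ψ φ' k z i) =ᶠ[𝓝 (ψ h)] (fun y => e y i) ∘ localRep ψ φ k := by
    intro k hk hku
    have h1 : ContinuousAt (fun z => k (ψ.symm z)) (ψ h) := by
      refine ContinuousAt.comp (g := k) ?_ (ψ.continuousAt_symm (ψ.map_source hh))
      rw [ψ.left_inv hh]
      exact hk.continuousAt
    have h2 : (fun z => k (ψ.symm z)) ⁻¹' φ.source ∈ 𝓝 (ψ h) :=
      h1.preimage_mem_nhds (φ.open_source.mem_nhds (by rwa [ψ.left_inv hh]))
    filter_upwards [h2] with z hz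
    simp [localRep, he, φ.left_inv hz]
  have hug : g h ∈ φ.source := hfg ▸ hu
  refine (sameDerivs_of_eventuallyEq (key f hf hu) r).trans (SameDerivs.trans ?_
    (sameDerivs_of_eventuallyEq (key g hg hug) r).symm)
  refine SameDerivs.comp_of_dependence (K := K) ?_ ?_ (contDiffAt_localRep hψ hφ hf hh hu)
    (contDiffAt_localRep hψ hφ hg hh hug) ?_ hj
  · rw [localRep_apply hh]
    filter_upwards [e.open_source.mem_nhds hmem] with y hy
    have hd := (hes' y hy).differentiableAt (by simp)
    have hp := ((EuclideanSpace.proj (𝕜 := ℝ) i : EuclideanSpace ℝ (Fin m) →L[ℝ] ℝ).hasFDerivAt.comp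
      y hd.hasFDerivAt)
    refine ⟨hp.differentiableAt, fun j hj => ?_⟩
    have := hp.fderiv
    change (fderiv ℝ (fun y => e y i) y) _ = 0
    rw [show (fun y => e y i) = (EuclideanSpace.proj (𝕜 := ℝ) i : EuclideanSpace ℝ (Fin m) →L[ℝ] ℝ) ∘ e
      from rfl, this]
    exact hK y hy j hj
  · rw [localRep_apply hh]
    exact (hes' _ hmem).coord i
  · rw [localRep_apply hh, localRep_apply hh, hfg]

theorem sameJet_leafCoord_iff (hψ : ψ ∈ IsManifold.maximalAtlas (𝓡 n) ∞ H)
    (hφ : φ ∈ IsManifold.maximalAtlas (𝓡 m) ∞ M)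
    {f g : H → M} (hf : ContMDiffAt (𝓡 n) (𝓡 m) ∞ f h) (hg : ContMDiffAt (𝓡 n) (𝓡 m) ∞ g h)
    (hfg : f h = g h) (hh : h ∈ ψ.source) (hu : f h ∈ φ.source) {r : ℕ} (S : Finset (Fin m)) :
    SameJet n r (leafCoord φ S ∘ f) (leafCoord φ S ∘ g) h ↔ ∀ j ∈ S,
      SameDerivs r (fun z => localRep ψ φ f z j) (fun z => localRep ψ φ g z j) (ψ h) := by
  have hs : ∀ k : H → M, ContMDiffAt (𝓡 n) (𝓡 m) ∞ k h → k h ∈ φ.source →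
      ContMDiffAt (𝓡 n) 𝓘(ℝ, S → ℝ) ∞ (leafCoord φ S ∘ k) h := by
    intro k hk hku
    have h1 : ContMDiffAt (𝓡 m) 𝓘(ℝ, S → ℝ) ∞ (leafCoord φ S) (k h) := by
      have hc : ContDiff ℝ ∞ (fun (y : EuclideanSpace ℝ (Fin m)) (j : S) => y j.1) := by fun_prop
      exact hc.contMDiff.contMDiffAt.comp (k h) (contMDiffAt_of_mem_maximalAtlas hφ hku)
    exact h1.comp h hk
  have hf' := hs f hf hu
  have hg' := hs g hg (hfg ▸ hu)
  rw [sameJet_iff_sameDerivs hψ hh hf' hg', SameDerivs.pi_iff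
    (contDiffAt_comp_chart_symm hψ hh hf') (contDiffAt_comp_chart_symm hψ hh hg')]
  exact ⟨fun hj j hS => hj ⟨j, hS⟩, fun hj j => hj j.1 j.2⟩

end LocalRep

/-! ## Adapted atlases of multifoliations -/

section Shear

variable {m : ℕ}

/-- The shear that adds the `j`-th coordinate to the `i`-th one. -/
def shear (i j : Fin m) (hij : i ≠ j) :
    EuclideanSpace ℝ (Fin m) ≃L[ℝ] EuclideanSpace ℝ (Fin m) :=
  ContinuousLinearEquiv.equivOfInverse
    (ContinuousLinearMap.id ℝ _ +
      (EuclideanSpace.proj j : EuclideanSpace ℝ (Fin m) →L[ℝ] ℝ).smulRight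
        (EuclideanSpace.single i (1 : ℝ)))
    (ContinuousLinearMap.id ℝ _ -
      (EuclideanSpace.proj j : EuclideanSpace ℝ (Fin m) →L[ℝ] ℝ).smulRight
        (EuclideanSpace.single i (1 : ℝ)))
    (fun y => by
      ext k
      simp [hij.symm])
    (fun y => by
      ext k
      simp [hij.symm])

theorem shear_apply {i j : Fin m} (hij : i ≠ j) (y : EuclideanSpace ℝ (Fin m)) (k : Fin m) :
    shear i j hij y k = y k + if k = i then y j else 0 := by
  simp [shear, PiLp.single_apply]

theorem shear_symm_apply {i j : Fin m} (hij : i ≠ j) (y : EuclideanSpace ℝ (Fin m)) (k : Fin m) :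
    (shear i j hij).symm y k = y k - if k = i then y j else 0 := by
  simp [shear, PiLp.single_apply]

theorem shear_single {i j : Fin m} (hij : i ≠ j) (b : Fin m) :
    (shear i j hij).symm (EuclideanSpace.single b (1 : ℝ)) =
      EuclideanSpace.single b (1 : ℝ) - if b = j then EuclideanSpace.single i (1 : ℝ) else 0 := by
  ext k
  rw [shear_symm_apply]
  by_cases hb : b = j
  · subst hb; simp [PiLp.single_apply]
  · have : ¬ j = b := fun h => hb h.symm
    simp [PiLp.single_apply, hb, this]

end Shear

section Charts

variable {m : ℕ} {M : Type v} [TopologicalSpace M] [ChartedSpace (EuclideanSpace ℝ (Fin m)) M]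
  {φ φ' : OpenPartialHomeomorph M (EuclideanSpace ℝ (Fin m))}

theorem contDiffOn_transition (hφ : φ ∈ IsManifold.maximalAtlas (𝓡 m) ∞ M)
    (hφ' : φ' ∈ IsManifold.maximalAtlas (𝓡 m) ∞ M) :
    ContDiffOn ℝ ∞ (φ.symm.trans φ') (φ.symm.trans φ').source := by
  rw [← contMDiffOn_iff_contDiffOn]
  exact (contMDiffOn_of_mem_maximalAtlas hφ').comp
    ((contMDiffOn_symm_of_mem_maximalAtlas hφ).mono fun x hx => hx.1) fun x hx => hx.2

theorem trans_equiv_mem_maximalAtlas [IsManifold (𝓡 m) ∞ M]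
    (hφ : φ ∈ IsManifold.maximalAtlas (𝓡 m) ∞ M)
    (L : EuclideanSpace ℝ (Fin m) ≃L[ℝ] EuclideanSpace ℝ (Fin m)) :
    φ.transHomeomorph L.toHomeomorph ∈ IsManifold.maximalAtlas (𝓡 m) ∞ M :=
  ((isSmoothChart_of_mem_maximalAtlas hφ).trans_equiv L).mem_maximalAtlas

-- Only a leaf coordinate is changed, so plaques go to plaques. The added coordinate `j` may well be
-- transverse, which is what allows transverse coordinates to be recovered from leaf coordinates.
omit [ChartedSpace (EuclideanSpace ℝ (Fin m)) M] in
theorem Flattens.trans_shear {leaf : Setoid M} {S : Finset (Fin m)} (h : Flattens leaf φ S)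
    {i j : Fin m} (hij : i ≠ j) (hi : i ∈ S) :
    Flattens leaf (φ.transHomeomorph (shear i j hij).toHomeomorph) S := by
  intro u hu
  obtain ⟨W, hW, hWe⟩ := h u hu
  set L := shear i j hij with hL
  refine ⟨L.symm ⁻¹' W, hW.preimage L.symm.continuous, ?_⟩
  have h1 : ((φ.transHomeomorph L.toHomeomorph : OpenPartialHomeomorph M _) : M → _) = L ∘ φ := rfl
  have h2 : (φ.transHomeomorph L.toHomeomorph).source = φ.source := rfl
  have hk : ∀ k, k ∉ S → k ≠ i := fun k hk hki => hk (hki ▸ hi)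
  rw [h1, h2, image_comp, hWe]
  ext x
  constructor
  · rintro ⟨y, ⟨hy, hy'⟩, rfl⟩
    refine ⟨by simpa using hy, fun k hkS => ?_⟩
    simp [hL, shear_apply, hk k hkS, hy' k hkS]
  · rintro ⟨hx, hx'⟩
    refine ⟨L.symm x, ⟨hx, fun k hkS => ?_⟩, by simp⟩
    have := hx' k hkS
    simpa [hL, shear_apply, shear_symm_apply, hk k hkS] using this

/-- The off-diagonal entry of the shear is at an admissible place. Multiplying a Jacobian by the
shear or its inverse combines column `j` with column `i`, or row `i` with row `j`; by transitivity
of the order the prescribed zeros persist. Maximality then puts the sheared chart into the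
structure. -/
theorem MultifoliateStructure.trans_shear_mem [IsManifold (𝓡 m) ∞ M] {P : Type} [PartialOrder P]
    {p : Fin m → P} (A : MultifoliateStructure p M) (hφ : φ ∈ A.charts) {i j : Fin m}
    (hij : i ≠ j) (hp : p i ≤ p j) :
    φ.transHomeomorph (shear i j hij).toHomeomorph ∈ A.charts := by
  set L := shear i j hij with hL
  have hm := trans_equiv_mem_maximalAtlas (A.subset_maximalAtlas hφ) L
  refine A.maximal _ hm fun φ' hφ' => ?_
  have hm' := A.subset_maximalAtlas hφ'
  have hsymm : ∀ φ₁ ∈ IsManifold.maximalAtlas (𝓡 m) ∞ M,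
      ∀ φ₂ ∈ IsManifold.maximalAtlas (𝓡 m) ∞ M,
      ContDiffOn ℝ ∞ (φ₁.symm.trans φ₂).symm (φ₁.symm.trans φ₂).target := by
    intro φ₁ h₁ φ₂ h₂
    have := contDiffOn_transition h₂ h₁
    rwa [← OpenPartialHomeomorph.symm_source, OpenPartialHomeomorph.trans_symm_eq_symm_trans_symm,
      OpenPartialHomeomorph.symm_symm]
  refine ⟨⟨contDiffOn_transition hm hm', hsymm _ hm _ hm', fun x hx a b hab => ?_⟩,
    ⟨contDiffOn_transition hm' hm, hsymm _ hm' _ hm, fun x hx a b hab => ?_⟩⟩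
  · have hc := (A.compatible φ hφ φ' hφ').2.2 (L.symm x) hx
    have he : (((φ.transHomeomorph L.toHomeomorph).symm.trans φ' :
        OpenPartialHomeomorph (EuclideanSpace ℝ (Fin m)) (EuclideanSpace ℝ (Fin m))) :
        EuclideanSpace ℝ (Fin m) → EuclideanSpace ℝ (Fin m)) = (φ.symm.trans φ') ∘ L.symm := rfl
    rw [he, ContinuousLinearEquiv.comp_right_fderiv]
    change (fderiv ℝ (φ.symm.trans φ') (L.symm x) (L.symm (EuclideanSpace.single b 1))) a = 0
    rw [hL, shear_single, map_sub]
    have h0 := hc a b hab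
    by_cases hb : b = j
    · have h1 := hc a i fun h => hab (hb ▸ h.trans hp)
      simp [hb, ← hL] at h0 h1 ⊢
      rw [h0, h1, sub_zero]
    · simpa [hb] using h0
  · have hc := (A.compatible φ' hφ' φ hφ).2.2 x hx
    have he : ((φ'.symm.trans (φ.transHomeomorph L.toHomeomorph) :
        OpenPartialHomeomorph (EuclideanSpace ℝ (Fin m)) (EuclideanSpace ℝ (Fin m))) :
        EuclideanSpace ℝ (Fin m) → EuclideanSpace ℝ (Fin m)) = L ∘ (φ'.symm.trans φ) := rfl
    rw [he, ContinuousLinearEquiv.comp_fderiv]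
    change (L (fderiv ℝ (φ'.symm.trans φ) x (EuclideanSpace.single b 1))) a = 0
    rw [hL, shear_apply, hc a b hab, zero_add]
    split_ifs with ha
    · exact hc j b fun h => hab (ha ▸ hp.trans h)
    · rfl

-- The `i`-th coordinates of the sheared and the original chart differ by the `j`-th coordinate, so
-- `c = 1`. For `i = j` there is nothing to shear, and `c = 0` does.
omit [ChartedSpace (EuclideanSpace ℝ (Fin m)) M] in
theorem exists_coord_eq_sub (C : Set (OpenPartialHomeomorph M (EuclideanSpace ℝ (Fin m))))
    (hφ : φ ∈ C) {u : M} (hu : u ∈ φ.source) (i j : Fin m)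
    (hC : ∀ hij : i ≠ j, φ.transHomeomorph (shear i j hij).toHomeomorph ∈ C) :
    ∃ φ₁ ∈ C, ∃ φ₂ ∈ C, u ∈ φ₁.source ∧ u ∈ φ₂.source ∧ ∃ c : ℝ,
      ∀ᶠ v in 𝓝 u, φ v j = φ₁ v i - c * φ₂ v i := by
  by_cases hij : i = j
  · exact ⟨φ, hφ, φ, hφ, hu, hu, 0, by simp [hij]⟩
  · refine ⟨_, hC hij, φ, hφ, hu, hu, 1, Filter.Eventually.of_forall fun v => ?_⟩
    have : φ.transHomeomorph (shear i j hij).toHomeomorph v = shear i j hij (φ v) := rfl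
    rw [this, shear_apply]
    simp

end Charts

section AdaptedAtlas

variable {ι : Type} [Fintype ι] {m : ℕ} {M : Type v} [TopologicalSpace M]
  [ChartedSpace (EuclideanSpace ℝ (Fin m)) M]

/-- An atlas of the target in which contact modulo `F` means equality of the derivatives of the
`j`-th coordinate up to an order depending on `j`. -/
structure AdaptedAtlas (F : Multifoliation ι m M) where
  charts : Set (OpenPartialHomeomorph M (EuclideanSpace ℝ (Fin m)))
  /-- the `i`-th coordinate of a chart may depend on the `j`-th coordinate of another one -/
  rel : Fin m → Fin m → Prop
  order : (ι → ℕ) → Fin m → ℕ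
  subset_maximalAtlas : charts ⊆ IsManifold.maximalAtlas (𝓡 m) ∞ M
  cover : ∀ u, ∃ φ ∈ charts, u ∈ φ.source
  compatible : ∀ φ ∈ charts, ∀ φ' ∈ charts, ∀ x ∈ (φ.symm.trans φ').source, ∀ i j, ¬ rel i j →
    (fderiv ℝ (φ.symm.trans φ') x (EuclideanSpace.single j 1)) i = 0
  -- Together with `compatible` this makes agreement up to the orders `order r j` independent of the
  -- chart.
  order_le_of_rel : ∀ r i j, rel i j → order r i ≤ order r j
  order_mono : Monotone order
  adapted_subset : ∀ δ, F.charts δ ⊆ charts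
  adapted_cover : ∀ δ u, ∃ φ ∈ F.charts δ, u ∈ φ.source
  le_order : ∀ r δ, ∀ j ∈ F.leafDirs δ, r δ ≤ order r j
  -- This says that the orders are not too large: contact forces agreement up to `order r j` because
  -- `x^j` is made of leaf coordinates of a foliation that attains this order. Order zero is
  -- excluded, since equality of targets is part of contact.
  generated : ∀ r u, ∃ φ ∈ charts, u ∈ φ.source ∧ ∀ j, order r j ≠ 0 → ∃ δ, order r j = r δ ∧
    ∃ φ₁ ∈ F.charts δ, ∃ φ₂ ∈ F.charts δ, u ∈ φ₁.source ∧ u ∈ φ₂.source ∧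
      ∃ i ∈ F.leafDirs δ, ∃ c : ℝ, ∀ᶠ v in 𝓝 u, φ v j = φ₁ v i - c * φ₂ v i

open Classical in
/-- The largest entry of a multiorder among those satisfying a condition. -/
def maxOrder (q : ι → Prop) (r : ι → ℕ) : ℕ :=
  Finset.univ.sup fun δ => if q δ then r δ else 0

theorem le_maxOrder {q : ι → Prop} {δ : ι} (h : q δ) (r : ι → ℕ) : r δ ≤ maxOrder q r := by
  classical
  have := Finset.le_sup (f := fun δ => if q δ then r δ else 0) (Finset.mem_univ δ)
  simp only [h, if_true] at this
  unfold maxOrder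
  convert this

theorem maxOrder_mono (q : ι → Prop) : Monotone (maxOrder q) := by
  intro r r' h
  refine Finset.sup_mono_fun fun δ _ => ?_
  split_ifs
  · exact h δ
  · exact le_rfl

theorem maxOrder_mono_left {q q' : ι → Prop} (h : ∀ δ, q δ → q' δ) (r : ι → ℕ) :
    maxOrder q r ≤ maxOrder q' r := by
  refine Finset.sup_le fun δ _ => ?_
  split_ifs with hq
  · exact le_maxOrder (h δ hq) r
  · exact Nat.zero_le _

theorem exists_eq_maxOrder {q : ι → Prop} {r : ι → ℕ} (h : maxOrder q r ≠ 0) :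
    ∃ δ, q δ ∧ maxOrder q r = r δ := by
  classical
  have hne : (Finset.univ : Finset ι).Nonempty := by
    by_contra hn
    rw [Finset.not_nonempty_iff_eq_empty] at hn
    exact h (by simp [maxOrder, hn])
  obtain ⟨δ, -, hδ⟩ := Finset.exists_mem_eq_sup _ hne fun δ => if q δ then r δ else 0
  have hδ' : maxOrder q r = if q δ then r δ else 0 := by
    unfold maxOrder
    convert hδ
  by_cases hq : q δ
  · exact ⟨δ, hq, by rw [hδ', if_pos hq]⟩
  · exact absurd (by rw [hδ', if_neg hq]) h

variable [IsManifold (𝓡 m) ∞ M]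

omit [IsManifold (𝓡 m) ∞ M] in
theorem Foliation.exists_chart (G : Foliation m M) (u : M) : ∃ φ ∈ G.charts, u ∈ φ.source := by
  obtain ⟨A, hA, hc, hf, -⟩ := G.exists_foliated_atlas
  obtain ⟨φ, hφ, hu⟩ := hc u
  exact ⟨φ, ⟨hA hφ, hf φ hφ⟩, hu⟩

/-- When all foliated charts are admitted, shears recover every coordinate from one leaf coordinate.
Contact is then classical contact of a single order, so arbitrary smooth charts of `M` can be used.
-/
theorem nonempty_adaptedAtlas_of_foliations (F : Multifoliation ι m M) (G : ι → Foliation m M)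
    (hc : F.charts = fun δ => (G δ).charts)
    (hl : F.leafDirs = fun δ => firstDirs m (G δ).dim) : Nonempty (AdaptedAtlas F) := by
  -- A foliation by points has no leaf coordinates, so its entry of the multiorder imposes nothing.
  let q : ι → Prop := fun δ => 0 < (G δ).dim
  refine ⟨{ charts := IsManifold.maximalAtlas (𝓡 m) ∞ M
            rel := fun _ _ => True
            order := fun r _ => maxOrder q r
            subset_maximalAtlas := subset_rfl
            cover := fun u => ⟨chartAt _ u, IsManifold.chart_mem_maximalAtlas u, mem_chart_source _ u⟩
            compatible := fun _ _ _ _ _ _ _ _ h => absurd trivial h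
            order_le_of_rel := fun _ _ _ _ => le_rfl
            order_mono := fun _ _ h _ => maxOrder_mono q h
            adapted_subset := fun δ φ hφ => ?_
            adapted_cover := fun δ u => ?_
            le_order := fun r δ j hj => le_maxOrder ?_ r
            generated := fun r u => ?_ }⟩
  · rw [hc] at hφ
    exact hφ.1
  · rw [hc]
    exact (G δ).exists_chart u
  · rw [hl] at hj
    exact (Nat.zero_le _).trans_lt (Finset.mem_filter.1 hj).2
  · by_cases h0 : maxOrder q r = 0
    · exact ⟨_, IsManifold.chart_mem_maximalAtlas u, mem_chart_source _ u, fun j hj => absurd h0 hj⟩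
    · obtain ⟨δ, hδ, he⟩ := exists_eq_maxOrder h0
      obtain ⟨φ, hφ, hu⟩ := (G δ).exists_chart u
      refine ⟨φ, hφ.1, hu, fun j _ => ⟨δ, he, ?_⟩⟩
      have hi : (⟨0, lt_of_lt_of_le hδ (G δ).dim_le⟩ : Fin m) ∈ firstDirs m (G δ).dim :=
        Finset.mem_filter.2 ⟨Finset.mem_univ _, hδ⟩
      obtain ⟨φ₁, h₁, φ₂, h₂, hu₁, hu₂, c, hc'⟩ := exists_coord_eq_sub (G δ).charts hφ hu _ j
        fun hij => ⟨trans_equiv_mem_maximalAtlas hφ.1 _, hφ.2.trans_shear hij hi⟩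
      rw [hc, hl]
      exact ⟨φ₁, h₁, φ₂, h₂, hu₁, hu₂, _, hi, c, hc'⟩

/-- With only the charts of a `(P, p)`-structure fewer shears are available, and the order depends
on the coordinate. In the other cases it does not. -/
theorem nonempty_adaptedAtlas (F : Multifoliation ι m M) : Nonempty (AdaptedAtlas F) := by
  classical
  rcases F with ⟨G, hG⟩ | ⟨G, hG⟩ | ⟨P, p, hp, A, D, G, hG⟩ | ⟨P, p, hp, A, D⟩
  · exact nonempty_adaptedAtlas_of_foliations _ G rfl rfl
  · exact nonempty_adaptedAtlas_of_foliations _ G rfl rfl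
  · exact nonempty_adaptedAtlas_of_foliations _ G rfl rfl
  -- The condition says that `x^j` may be added to some leaf coordinate `x^i` of the `δ`-th
  -- foliation; it is inherited by all larger classes, whence the monotonicity of the orders.
  · let q : Fin m → ι → Prop := fun j δ => ∃ i, p i ≤ p j ∧ p i ∈ D δ
    refine ⟨{ charts := A.charts
              rel := fun i j => p i ≤ p j
              order := fun r j => maxOrder (q j) r
              subset_maximalAtlas := A.subset_maximalAtlas
              cover := A.cover
              compatible := fun φ hφ φ' hφ' => (A.compatible φ hφ φ' hφ').2.2
              order_le_of_rel := fun r i j h =>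
                maxOrder_mono_left (fun δ ⟨k, hk, hD⟩ => ⟨k, hk.trans h, hD⟩) r
              order_mono := fun _ _ h j => maxOrder_mono (q j) h
              adapted_subset := fun δ => subset_rfl
              adapted_cover := fun δ => A.cover
              le_order := fun r δ j hj => le_maxOrder ⟨j, le_rfl, (Finset.mem_filter.1 hj).2⟩ r
              generated := fun r u => ?_ }⟩
    obtain ⟨φ, hφ, hu⟩ := A.cover u
    refine ⟨φ, hφ, hu, fun j hj => ?_⟩
    obtain ⟨δ, ⟨i, hij, hi⟩, he⟩ := exists_eq_maxOrder hj
    obtain ⟨φ₁, h₁, φ₂, h₂, hu₁, hu₂, c, hc⟩ := exists_coord_eq_sub A.charts hφ hu i j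
      fun hne => A.trans_shear_mem hφ hne hij
    exact ⟨δ, he, φ₁, h₁, φ₂, h₂, hu₁, hu₂, i, Finset.mem_filter.2 ⟨Finset.mem_univ _, hi⟩, c, hc⟩

end AdaptedAtlas

/-! ### Contact in an adapted atlas -/

section Contact

variable {n : ℕ} {H : Type u} [TopologicalSpace H] [ChartedSpace (EuclideanSpace ℝ (Fin n)) H]
  {ι : Type} [Fintype ι] {m : ℕ} {M : Type v} [TopologicalSpace M]
  [ChartedSpace (EuclideanSpace ℝ (Fin m)) M] {F : Multifoliation ι m M}
  {ψ : OpenPartialHomeomorph H (EuclideanSpace ℝ (Fin n))}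
  {φ φ' : OpenPartialHomeomorph M (EuclideanSpace ℝ (Fin m))} {h : H}

theorem AdaptedAtlas.sameDerivs_change (𝒜 : AdaptedAtlas F)
    (hψ : ψ ∈ IsManifold.maximalAtlas (𝓡 n) ∞ H) (hφ : φ ∈ 𝒜.charts) (hφ' : φ' ∈ 𝒜.charts)
    {f g : H → M} (hf : ContMDiffAt (𝓡 n) (𝓡 m) ∞ f h) (hg : ContMDiffAt (𝓡 n) (𝓡 m) ∞ g h)
    (hfg : f h = g h) (hh : h ∈ ψ.source) (hu : f h ∈ φ.source) (hu' : f h ∈ φ'.source)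
    {r : ι → ℕ} (hs : ∀ j, SameDerivs (𝒜.order r j) (fun z => localRep ψ φ f z j)
      (fun z => localRep ψ φ g z j) (ψ h)) (i : Fin m) :
    SameDerivs (𝒜.order r i) (fun z => localRep ψ φ' f z i) (fun z => localRep ψ φ' g z i) (ψ h) :=
  sameDerivs_localRep_of_dependence hψ (𝒜.subset_maximalAtlas hφ) (𝒜.subset_maximalAtlas hφ')
    hf hg hfg hh hu hu' i {j | 𝒜.rel i j}
    (fun x hx j hj => 𝒜.compatible φ hφ φ' hφ' x hx i j hj)
    fun j hj => (hs j).mono (𝒜.order_le_of_rel r i j hj)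

/-- From left to right, the coordinates of a special chart are obtained from leaf coordinates by
`generated`, and then the chart is changed. From right to left, the chart is changed to the adapted
ones, where `le_order` gives enough derivatives. -/
theorem AdaptedAtlas.contact_iff (𝒜 : AdaptedAtlas F)
    (hψ : ψ ∈ IsManifold.maximalAtlas (𝓡 n) ∞ H) (hh : h ∈ ψ.source) (hφ : φ ∈ 𝒜.charts)
    {f g : C^∞⟮𝓡 n, H; 𝓡 m, M⟯} (hu : f h ∈ φ.source) {r : ι → ℕ} :
    Contact n H F r h f g ↔ f h = g h ∧ ∀ j, SameDerivs (𝒜.order r j)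
      (fun z => localRep ψ φ f z j) (fun z => localRep ψ φ g z j) (ψ h) := by
  classical
  have hf := f.contMDiff.contMDiffAt (x := h)
  have hg := g.contMDiff.contMDiffAt (x := h)
  constructor
  · rintro ⟨hfg, hc⟩
    refine ⟨hfg, ?_⟩
    obtain ⟨φ₀, hφ₀, hu₀, hgen⟩ := 𝒜.generated r (f h)
    have hug₀ : g h ∈ φ₀.source := hfg ▸ hu₀
    refine 𝒜.sameDerivs_change hψ hφ₀ hφ hf hg hfg hh hu₀ hu fun j => ?_
    by_cases h0 : 𝒜.order r j = 0
    · rw [h0]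
      intro k hk
      obtain rfl := Nat.le_zero.1 hk
      ext v
      simp [localRep_apply hh, hfg]
    · obtain ⟨δ, he, φ₁, h₁, φ₂, h₂, hu₁, hu₂, i, hi, c, hev⟩ := hgen j h0
      -- Contact refers to whole tuples of charts, so a single chart for `δ` has to be completed by
      -- arbitrary charts for the other foliations.
      choose base hbase using fun δ => 𝒜.adapted_cover δ (f h)
      have hjet : ∀ φ₁ ∈ F.charts δ, f h ∈ φ₁.source →
          SameDerivs (r δ) (fun z => localRep ψ φ₁ f z i) (fun z => localRep ψ φ₁ g z i) (ψ h) := by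
        intro φ₁ h₁ hu₁
        have := hc (Function.update base δ φ₁) (fun δ' => by
          by_cases hd : δ' = δ
          · subst hd; simpa using ⟨h₁, hu₁⟩
          · simpa [hd] using hbase δ') δ
        simp only [Function.update_self] at this
        exact (sameJet_leafCoord_iff hψ (𝒜.subset_maximalAtlas (𝒜.adapted_subset δ h₁))
          hf hg hfg hh hu₁ _).1 this i hi
      have hm₁ := 𝒜.subset_maximalAtlas (𝒜.adapted_subset δ h₁)
      have hm₂ := 𝒜.subset_maximalAtlas (𝒜.adapted_subset δ h₂)
      have hcd : ∀ φ₁ ∈ IsManifold.maximalAtlas (𝓡 m) ∞ M, ∀ k : C^∞⟮𝓡 n, H; 𝓡 m, M⟯,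
          k h ∈ φ₁.source → ContDiffAt ℝ ∞ (fun z => localRep ψ φ₁ k z i) (ψ h) :=
        fun φ₁ h₁ k hk => (contDiffAt_localRep hψ h₁ k.contMDiff.contMDiffAt hh hk).coord i
      have key := (hjet φ₁ h₁ hu₁).sub_const_mul (hjet φ₂ h₂ hu₂) (hcd _ hm₁ f hu₁)
        (hcd _ hm₁ g (hfg ▸ hu₁)) (hcd _ hm₂ f hu₂) (hcd _ hm₂ g (hfg ▸ hu₂)) c
      have hloc : ∀ k : C^∞⟮𝓡 n, H; 𝓡 m, M⟯, k h = f h → (fun z => localRep ψ φ₀ k z j) =ᶠ[𝓝 (ψ h)]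
          fun z => localRep ψ φ₁ k z i - c * localRep ψ φ₂ k z i := by
        intro k hk
        have h1 : ContinuousAt (fun z => k (ψ.symm z)) (ψ h) :=
          ContinuousAt.comp (g := k) k.contMDiff.continuous.continuousAt
            (ψ.continuousAt_symm (ψ.map_source hh))
        have h2 : Filter.Tendsto (fun z => k (ψ.symm z)) (𝓝 (ψ h)) (𝓝 (f h)) := by
          have := h1.tendsto
          rwa [ψ.left_inv hh, hk] at this
        exact h2.eventually hev
      rw [he]
      exact (sameDerivs_of_eventuallyEq (hloc f rfl) _).trans
        (key.trans (sameDerivs_of_eventuallyEq (hloc g hfg.symm) _).symm)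
  · rintro ⟨hfg, hs⟩
    refine ⟨hfg, fun φ' hφ' δ => ?_⟩
    have ha := 𝒜.adapted_subset δ (hφ' δ).1
    refine (sameJet_leafCoord_iff hψ (𝒜.subset_maximalAtlas ha) hf hg hfg hh (hφ' δ).2 _).2
      fun j hj => ?_
    exact (𝒜.sameDerivs_change hψ hφ ha hf hg hfg hh hu (hφ' δ).2 hs j).mono (𝒜.le_order r δ j hj)

end Contact

/-! ## The manifold of jets -/

/-- The model space of the manifold of jets: source, target and derivatives, where the `j`-th
coordinate is differentiated up to order `o j`. -/
abbrev JetModel (n : ℕ) {m : ℕ} (o : Fin m → ℕ) : Type :=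
  EuclideanSpace ℝ (Fin n) × EuclideanSpace ℝ (Fin m) ×
    ((j : Fin m) → JetFibre (EuclideanSpace ℝ (Fin n)) (o j))

section JetCoord

variable {n : ℕ} {H : Type u} [TopologicalSpace H] [ChartedSpace (EuclideanSpace ℝ (Fin n)) H]
  {m : ℕ} {M : Type v} [TopologicalSpace M] [ChartedSpace (EuclideanSpace ℝ (Fin m)) M]
  {ψ : OpenPartialHomeomorph H (EuclideanSpace ℝ (Fin n))}
  {φ : OpenPartialHomeomorph M (EuclideanSpace ℝ (Fin m))}

/-- The coordinates of the jet of `f` at `h`. -/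
def jetCoord (o : Fin m → ℕ) (ψ : OpenPartialHomeomorph H (EuclideanSpace ℝ (Fin n)))
    (φ : OpenPartialHomeomorph M (EuclideanSpace ℝ (Fin m))) (h : H) (f : H → M) : JetModel n o :=
  (ψ h, φ (f h), fun j => jetAt (o j) (fun z => localRep ψ φ f z j) (ψ h))

/-- Coordinates of jets of smooth families depend smoothly on the parameters. -/
theorem contDiffAt_jetCoord_family {P : Type*} [NormedAddCommGroup P] [NormedSpace ℝ P]
    [IsManifold (𝓡 n) ∞ H]
    (hψ : ψ ∈ IsManifold.maximalAtlas (𝓡 n) ∞ H) (hφ : φ ∈ IsManifold.maximalAtlas (𝓡 m) ∞ M)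
    (o : Fin m → ℕ) {σ : P → H} {Φ : P → H → M} {t : P} (hσ : ContMDiffAt 𝓘(ℝ, P) (𝓡 n) ∞ σ t)
    (hΦ : ContMDiffAt (𝓘(ℝ, P).prod (𝓡 n)) (𝓡 m) ∞ (fun q : P × H => Φ q.1 q.2) (t, σ t))
    (hs : σ t ∈ ψ.source) (hu : Φ t (σ t) ∈ φ.source) :
    ContDiffAt ℝ ∞ (fun s => jetCoord o ψ φ (σ s) (Φ s)) t := by
  have h1 : ContDiffAt ℝ ∞ (fun s => ψ (σ s)) t := by
    rw [← contMDiffAt_iff_contDiffAt]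
    exact (contMDiffAt_of_mem_maximalAtlas hψ hs).comp t hσ
  have h2 : ContDiffAt ℝ ∞ (fun q : P × EuclideanSpace ℝ (Fin n) => localRep ψ φ (Φ q.1) q.2)
      (t, ψ (σ t)) := by
    rw [← contMDiffAt_iff_contDiffAt]
    have ha : ContMDiffAt 𝓘(ℝ, P × EuclideanSpace ℝ (Fin n)) (𝓘(ℝ, P).prod (𝓡 n)) ∞
        (fun q : P × EuclideanSpace ℝ (Fin n) => (q.1, ψ.symm q.2)) (t, ψ (σ t)) := by
      refine ContMDiffAt.prodMk contDiff_fst.contMDiff.contMDiffAt ?_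
      exact ContMDiffAt.comp (t, ψ (σ t))
        (contMDiffAt_symm_of_mem_maximalAtlas hψ (ψ.map_source hs))
        contDiff_snd.contMDiff.contMDiffAt
    have he : ((t, ψ.symm (ψ (σ t))) : P × H) = (t, σ t) := by rw [ψ.left_inv hs]
    have hb : ContMDiffAt (𝓘(ℝ, P).prod (𝓡 n)) (𝓡 m) ∞ (fun q : P × H => φ (Φ q.1 q.2))
        (t, σ t) :=
      (contMDiffAt_of_mem_maximalAtlas hφ hu).comp (t, σ t) hΦ
    rw [← he] at hb
    exact ContMDiffAt.comp (t, ψ (σ t)) (g := fun q : P × H => φ (Φ q.1 q.2)) hb ha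
  have h3 : ContDiffAt ℝ ∞ (fun s => φ (Φ s (σ s))) t := by
    rw [← contMDiffAt_iff_contDiffAt]
    refine (contMDiffAt_of_mem_maximalAtlas hφ hu).comp t ?_
    exact hΦ.comp t (contMDiffAt_id.prodMk hσ)
  refine h1.prodMk (h3.prodMk ?_)
  rw [contDiffAt_pi]
  exact fun j => ContDiffAt.jetAt_param (ξ := fun s => ψ (σ s)) (t := t)
    (g := fun s z => localRep ψ φ (Φ s) z j) (h2.coord j) h1 (o j)

/-- The inverse of a chart near a point extends to a globally defined smooth map. -/
theorem exists_contMDiff_eventuallyEq_chart_symm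
    (hφ : φ ∈ IsManifold.maximalAtlas (𝓡 m) ∞ M) {y₀ : EuclideanSpace ℝ (Fin m)}
    (hy : y₀ ∈ φ.target) : ∃ τ : EuclideanSpace ℝ (Fin m) → M,
      ContMDiff (𝓡 m) (𝓡 m) ∞ τ ∧ ∀ᶠ y in 𝓝 y₀, τ y = φ.symm y ∧ y ∈ φ.target := by
  obtain ⟨ε, hε, hball⟩ := Metric.isOpen_iff.1 φ.open_target _ hy
  obtain ⟨ρ, hρ, hρ0, hρε⟩ := exists_contDiff_truncation (E := EuclideanSpace ℝ (Fin m)) hε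
  have hmem : ∀ y, y₀ + ρ y ∈ φ.target := fun y => hball (by simpa using hρε y)
  refine ⟨fun y => φ.symm (y₀ + ρ (y - y₀)), fun y => ?_, ?_⟩
  · refine ContMDiffAt.comp y (contMDiffAt_symm_of_mem_maximalAtlas hφ (hmem _)) ?_
    have : ContDiff ℝ ∞ (fun y => y₀ + ρ (y - y₀)) := by fun_prop
    exact this.contMDiff.contMDiffAt
  · have : Filter.Tendsto (fun y => y - y₀) (𝓝 y₀) (𝓝 0) := by
      have : Continuous (fun y => y - y₀) := by fun_prop
      simpa using this.tendsto y₀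
    filter_upwards [this hρ0, φ.open_target.mem_nhds hy] with y hy1 hy2
    have hy1' : ρ (y - y₀) = y - y₀ := hy1
    exact ⟨by rw [hy1', add_sub_cancel], hy2⟩

/-- The polynomial map with prescribed derivatives. -/
def jetSections {o : Fin m → ℕ} (q : JetModel n o × EuclideanSpace ℝ (Fin n)) :
    EuclideanSpace ℝ (Fin m) :=
  q.1.2.1 + WithLp.toLp 2 fun j => jetSection (q.1.2.2 j) (q.2 - q.1.1)

theorem contDiff_jetSections {o : Fin m → ℕ} :
    ContDiff ℝ ∞ (jetSections : JetModel n o × EuclideanSpace ℝ (Fin n) → _) := by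
  refine ContDiff.add (by fun_prop) (contDiff_euclidean.2 fun j => ?_)
  have h : ContDiff ℝ ∞ (fun q : JetModel n o × EuclideanSpace ℝ (Fin n) => q.1.2.2) := by fun_prop
  exact contDiff_jetSection.comp ((contDiff_pi.1 h j).prodMk (by fun_prop))

theorem jetSections_self {o : Fin m → ℕ} (t : JetModel n o) : jetSections (t, t.1) = t.2.1 := by
  ext j
  simp [jetSections, jetSection_zero]

/-- In the charts, functions with prescribed derivatives are given by `jetSections`. Composing with
a global extension `B` of `ψ` and a truncated inverse `τ'` of `φ` turns them into maps `H → M`. Near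
the source both agree with the charts for parameters close to `t₀`, so the coordinates of the jet
are the parameters themselves. -/
theorem exists_jetFamily [IsManifold (𝓡 n) ∞ H] [T2Space H]
    (hψ : ψ ∈ IsManifold.maximalAtlas (𝓡 n) ∞ H) (hφ : φ ∈ IsManifold.maximalAtlas (𝓡 m) ∞ M)
    {o : Fin m → ℕ} (t₀ : JetModel n o) (hx : t₀.1 ∈ ψ.target) (hu : t₀.2.1 ∈ φ.target) :
    ∃ (σ : JetModel n o → H) (Φ : JetModel n o → C^∞⟮𝓡 n, H; 𝓡 m, M⟯),
      ContMDiff 𝓘(ℝ, JetModel n o) (𝓡 n) ∞ σ ∧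
      ContMDiff (𝓘(ℝ, JetModel n o).prod (𝓡 n)) (𝓡 m) ∞
        (fun q : JetModel n o × H => Φ q.1 q.2) ∧
      ∀ᶠ t in 𝓝 t₀, σ t ∈ ψ.source ∧ Φ t (σ t) ∈ φ.source ∧ jetCoord o ψ φ (σ t) (Φ t) = t := by
  obtain ⟨τ, hτ, hτψ⟩ := exists_contMDiff_eventuallyEq_chart_symm hψ hx
  obtain ⟨τ', hτ', hτφ⟩ := exists_contMDiff_eventuallyEq_chart_symm hφ hu
  obtain ⟨B, hB, hBψ⟩ := exists_contMDiff_eventuallyEq_chart hψ (ψ.map_target hx)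
  have hΦ : ContMDiff (𝓘(ℝ, JetModel n o).prod (𝓡 n)) (𝓡 m) ∞
      (fun q : JetModel n o × H => τ' (jetSections (q.1, B q.2))) := by
    have h1 : ContMDiff (𝓘(ℝ, JetModel n o).prod (𝓡 n))
        𝓘(ℝ, JetModel n o × EuclideanSpace ℝ (Fin n)) ∞
        (fun q : JetModel n o × H => (q.1, B q.2)) :=
      contMDiff_fst.prodMk_space (hB.comp contMDiff_snd)
    exact hτ'.comp (contDiff_jetSections.contMDiff.comp h1)
  have hσ : ContMDiff 𝓘(ℝ, JetModel n o) (𝓡 n) ∞ (fun t : JetModel n o => τ t.1) :=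
    hτ.comp contDiff_fst.contMDiff
  refine ⟨fun t => τ t.1, fun t => ⟨fun z => τ' (jetSections (t, B z)),
    hΦ.comp (contMDiff_const.prodMk contMDiff_id)⟩, hσ, hΦ, ?_⟩
  have e1 : ∀ᶠ t : JetModel n o in 𝓝 t₀, τ t.1 = ψ.symm t.1 ∧ t.1 ∈ ψ.target :=
    continuousAt_fst.eventually hτψ
  have e2 : ∀ᶠ t : JetModel n o in 𝓝 t₀,
      ∀ᶠ y in 𝓝 t.2.1, τ' y = φ.symm y ∧ y ∈ φ.target := by
    have : ContinuousAt (fun t : JetModel n o => t.2.1) t₀ :=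
      (continuous_fst.comp continuous_snd).continuousAt
    exact this.eventually hτφ.eventually_nhds
  have e3 : ∀ᶠ t : JetModel n o in 𝓝 t₀, ∀ᶠ z in 𝓝 (ψ.symm t.1), B z = ψ z :=
    (ContinuousAt.comp (f := fun t : JetModel n o => t.1) (ψ.continuousAt_symm hx)
      continuousAt_fst).eventually hBψ.eventually_nhds
  filter_upwards [e1, e2, e3] with t h1 h2 h3
  have hloc : localRep ψ φ (fun z => τ' (jetSections (t, B z))) =ᶠ[𝓝 t.1]
      fun y => jetSections (t, y) := by
    have k1 : ∀ᶠ y in 𝓝 t.1, B (ψ.symm y) = ψ (ψ.symm y) :=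
      (ψ.continuousAt_symm h1.2).eventually h3
    have k2 : ∀ᶠ y in 𝓝 t.1, τ' (jetSections (t, y)) = φ.symm (jetSections (t, y)) ∧
        jetSections (t, y) ∈ φ.target := by
      have hc : Continuous fun y => jetSections (t, y) :=
        contDiff_jetSections.continuous.comp (Continuous.prodMk_right t)
      have := hc.tendsto t.1
      rw [jetSections_self] at this
      exact this.eventually h2
    filter_upwards [k1, k2, ψ.open_target.mem_nhds h1.2] with y hy1 hy2 hy3
    rw [localRep, hy1, ψ.right_inv hy3, hy2.1, φ.right_inv hy2.2]
  have hB : B (ψ.symm t.1) = t.1 := by rw [h3.self_of_nhds, ψ.right_inv h1.2]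
  have hval : τ' (jetSections (t, B (τ t.1))) = φ.symm t.2.1 := by
    rw [h1.1, hB, jetSections_self, h2.self_of_nhds.1]
  refine ⟨?_, ?_, ?_⟩
  · rw [h1.1]
    exact ψ.map_target h1.2
  · simp only [ContMDiffMap.coeFn_mk, hval]
    exact φ.map_target h2.self_of_nhds.2
  · refine Prod.ext ?_ (Prod.ext ?_ ?_)
    · exact (congrArg ψ h1.1).trans (ψ.right_inv h1.2)
    · exact (congrArg φ hval).trans (φ.right_inv h2.self_of_nhds.2)
    · funext j
      simp only [jetCoord, ContMDiffMap.coeFn_mk, h1.1, ψ.right_inv h1.2]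
      have : (fun z => localRep ψ φ (fun z => τ' (jetSections (t, B z))) z j) =ᶠ[𝓝 t.1]
          fun y => t.2.1 j + jetSection (t.2.2 j) (y - t.1) := by
        filter_upwards [hloc] with y hy
        rw [hy]
        rfl
      rw [jetAt_congr this, jetAt_const_add_jetSection]

end JetCoord

/-! ### Charts of the set of jets and their compatibility -/

section JetStructure

variable {n : ℕ} {H : Type u} [TopologicalSpace H] [ChartedSpace (EuclideanSpace ℝ (Fin n)) H]
  {ι : Type} [Fintype ι] {m : ℕ} {M : Type v} [TopologicalSpace M]
  [ChartedSpace (EuclideanSpace ℝ (Fin m)) M] {F : Multifoliation ι m M}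
  {ψ : OpenPartialHomeomorph H (EuclideanSpace ℝ (Fin n))}
  {φ : OpenPartialHomeomorph M (EuclideanSpace ℝ (Fin m))}

theorem JetSpace.exists_mk {r : ι → ℕ} (c : JetSpace n H F r) :
    ∃ (h : H) (f : C^∞⟮𝓡 n, H; 𝓡 m, M⟯), JetSpace.mk F r h f = c := by
  induction c using Quotient.inductionOn with
  | h a => exact ⟨a.1, a.2, rfl⟩

/-- The set of jets with source in the domain of `ψ` and target in the domain of `φ`. -/
def jetDomain (F : Multifoliation ι m M) (r : ι → ℕ)
    (ψ : OpenPartialHomeomorph H (EuclideanSpace ℝ (Fin n)))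
    (φ : OpenPartialHomeomorph M (EuclideanSpace ℝ (Fin m))) : Set (JetSpace n H F r) :=
  {c | JetSpace.source c ∈ ψ.source ∧ JetSpace.target c ∈ φ.source}

/-- The image of a jet chart. -/
def jetRange (o : Fin m → ℕ) (ψ : OpenPartialHomeomorph H (EuclideanSpace ℝ (Fin n)))
    (φ : OpenPartialHomeomorph M (EuclideanSpace ℝ (Fin m))) : Set (JetModel n o) :=
  {t | t.1 ∈ ψ.target ∧ t.2.1 ∈ φ.target}

/-- The coordinates of a jet. -/
def jetChartFun {r : ι → ℕ} (o : Fin m → ℕ)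
    (ψ : OpenPartialHomeomorph H (EuclideanSpace ℝ (Fin n)))
    (φ : OpenPartialHomeomorph M (EuclideanSpace ℝ (Fin m))) (c : JetSpace n H F r) :
    JetModel n o :=
  jetCoord o ψ φ (Quotient.out c).1 (Quotient.out c).2

/-- `S` is the manifold structure whose charts are given by the jet coordinates. -/
structure IsJetStructure (𝒜 : AdaptedAtlas F) (r : ι → ℕ)
    (S : SmoothStructure (JetSpace n H F r)) : Prop where
  model : Nonempty (JetModel n (𝒜.order r) ≃L[ℝ] EuclideanSpace ℝ (Fin S.dim))
  exists_chart : ∀ ψ ∈ IsManifold.maximalAtlas (𝓡 n) ∞ H, ∀ φ ∈ 𝒜.charts,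
    ∃ e : OpenPartialHomeomorph S.Space (JetModel n (𝒜.order r)), IsSmoothChart S.dim e ∧
      e.source = jetDomain F r ψ φ ∧ e.target = jetRange (𝒜.order r) ψ φ ∧
      ∀ (h : H) (f : C^∞⟮𝓡 n, H; 𝓡 m, M⟯), h ∈ ψ.source → f h ∈ φ.source →
        e (S.point (JetSpace.mk F r h f)) = jetCoord (𝒜.order r) ψ φ h f

/-- One direction makes the coordinates well defined on jets, the other makes them injective. -/
theorem AdaptedAtlas.mk_eq_mk_iff (𝒜 : AdaptedAtlas F)
    (hψ : ψ ∈ IsManifold.maximalAtlas (𝓡 n) ∞ H) (hφ : φ ∈ 𝒜.charts) {r : ι → ℕ} {h h' : H}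
    {f f' : C^∞⟮𝓡 n, H; 𝓡 m, M⟯} (hh : h ∈ ψ.source) (hh' : h' ∈ ψ.source) (hu : f h ∈ φ.source)
    (hu' : f' h' ∈ φ.source) : JetSpace.mk F r h f = JetSpace.mk F r h' f' ↔
      jetCoord (𝒜.order r) ψ φ h f = jetCoord (𝒜.order r) ψ φ h' f' := by
  have hm := 𝒜.subset_maximalAtlas hφ
  have key : ∀ (k : C^∞⟮𝓡 n, H; 𝓡 m, M⟯), k h ∈ φ.source → ∀ j,
      ∀ᶠ z in 𝓝 (ψ h), ContDiffAt ℝ ∞ (fun z => localRep ψ φ k z j) z := fun k hk j =>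
    (eventually_contDiffAt_localRep hψ hm k.contMDiff hh hk).mono fun z hz => hz.coord j
  have hc := 𝒜.contact_iff (g := f') (r := r) hψ hh hφ hu
  constructor
  · intro he
    obtain ⟨e1, e2⟩ := Quotient.exact he
    dsimp only at e1 e2
    subst e1
    obtain ⟨e3, e4⟩ := hc.1 e2
    refine Prod.ext rfl (Prod.ext (congrArg φ e3) (funext fun j => ?_))
    exact ((sameDerivs_iff_jetAt (key f hu j) (key f' hu' j)).1 (e4 j)).2
  · intro he
    obtain rfl : h = h' := ψ.injOn hh hh' (congrArg Prod.fst he)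
    have e2 : f h = f' h := φ.injOn hu hu' (congrArg (fun t => t.2.1) he)
    refine Quotient.sound ⟨rfl, hc.2 ⟨e2, fun j => ?_⟩⟩
    refine (sameDerivs_iff_jetAt (key f hu j) (key f' hu' j)).2 ⟨?_, ?_⟩
    · rw [localRep_apply hh, localRep_apply hh, e2]
    · exact congrArg (fun t => t.2.2 j) he

theorem AdaptedAtlas.jetChartFun_mk (𝒜 : AdaptedAtlas F)
    (hψ : ψ ∈ IsManifold.maximalAtlas (𝓡 n) ∞ H) (hφ : φ ∈ 𝒜.charts) {r : ι → ℕ} {h : H}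
    {f : C^∞⟮𝓡 n, H; 𝓡 m, M⟯} (hh : h ∈ ψ.source) (hu : f h ∈ φ.source) :
    jetChartFun (𝒜.order r) ψ φ (JetSpace.mk F r h f) = jetCoord (𝒜.order r) ψ φ h f := by
  have h1 : JetSpace.mk F r (Quotient.out (JetSpace.mk F r h f)).1
      (Quotient.out (JetSpace.mk F r h f)).2 = JetSpace.mk F r h f := Quotient.out_eq _
  have hs : (Quotient.out (JetSpace.mk F r h f)).1 = h := congrArg JetSpace.source h1
  have ht : (Quotient.out (JetSpace.mk F r h f)).2 (Quotient.out (JetSpace.mk F r h f)).1 = f h :=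
    congrArg JetSpace.target h1
  exact (𝒜.mk_eq_mk_iff hψ hφ (by rwa [hs]) hh (by rwa [ht]) hu).1 h1

variable [IsManifold (𝓡 n) ∞ H] [T2Space H]

theorem AdaptedAtlas.bijOn_jetChartFun (𝒜 : AdaptedAtlas F)
    (hψ : ψ ∈ IsManifold.maximalAtlas (𝓡 n) ∞ H) (hφ : φ ∈ 𝒜.charts) (r : ι → ℕ) :
    BijOn (jetChartFun (𝒜.order r) ψ φ) (jetDomain F r ψ φ) (jetRange (𝒜.order r) ψ φ) := by
  refine ⟨?_, ?_, ?_⟩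
  · intro c hc
    obtain ⟨h, f, rfl⟩ := c.exists_mk
    rw [𝒜.jetChartFun_mk hψ hφ (h := h) (f := f) hc.1 hc.2]
    exact ⟨ψ.map_source hc.1, φ.map_source hc.2⟩
  · intro c hc c' hc' he
    obtain ⟨h, f, rfl⟩ := c.exists_mk
    obtain ⟨h', f', rfl⟩ := c'.exists_mk
    rw [𝒜.jetChartFun_mk hψ hφ (h := h) (f := f) hc.1 hc.2,
      𝒜.jetChartFun_mk hψ hφ (h := h') (f := f') hc'.1 hc'.2] at he
    exact (𝒜.mk_eq_mk_iff hψ hφ hc.1 hc'.1 hc.2 hc'.2).2 he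
  · intro t ht
    obtain ⟨σ, Φ, -, -, hev⟩ := exists_jetFamily hψ (𝒜.subset_maximalAtlas hφ) t ht.1 ht.2
    obtain ⟨h1, h2, h3⟩ := hev.self_of_nhds
    exact ⟨JetSpace.mk F r (σ t) (Φ t), ⟨h1, h2⟩, by rw [𝒜.jetChartFun_mk hψ hφ h1 h2, h3]⟩

theorem exists_isJetStructure [SecondCountableTopology H] [Nonempty H] [T2Space M]
    [SecondCountableTopology M] [Nonempty M] (𝒜 : AdaptedAtlas F) (r : ι → ℕ) :
    ∃ S : SmoothStructure (JetSpace n H F r), IsJetStructure 𝒜 r S := by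
  -- Turning a bijection between sets into a `PartialEquiv` needs a default value.
  have hne : Nonempty (JetSpace n H F r) :=
    ⟨JetSpace.mk F r (Classical.arbitrary H) (ContMDiffMap.const (Classical.arbitrary M))⟩
  let I := {q : OpenPartialHomeomorph H (EuclideanSpace ℝ (Fin n)) ×
    OpenPartialHomeomorph M (EuclideanSpace ℝ (Fin m)) //
      q.1 ∈ IsManifold.maximalAtlas (𝓡 n) ∞ H ∧ q.2 ∈ 𝒜.charts}
  let e : I → PartialEquiv (JetSpace n H F r) (JetModel n (𝒜.order r)) := fun i =>
    (𝒜.bijOn_jetChartFun i.2.1 i.2.2 r).toPartialEquiv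
  have hsrc : ∀ i, (e i).source = jetDomain F r i.1.1 i.1.2 := fun _ => rfl
  have hmk : ∀ (i : I) h (f : C^∞⟮𝓡 n, H; 𝓡 m, M⟯), h ∈ i.1.1.source → f h ∈ i.1.2.source →
      e i (JetSpace.mk F r h f) = jetCoord (𝒜.order r) i.1.1 i.1.2 h f :=
    fun i h f hh hu => 𝒜.jetChartFun_mk i.2.1 i.2.2 hh hu
  have hst : ∀ (i : I), ∀ t ∈ (e i).target, JetSpace.source ((e i).symm t) = i.1.1.symm t.1 ∧
      JetSpace.target ((e i).symm t) = i.1.2.symm t.2.1 := by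
    intro i t ht
    obtain ⟨h, f, hc⟩ := ((e i).symm t).exists_mk
    have hm := (e i).map_target ht
    rw [hsrc, ← hc] at hm
    have h1 := (e i).right_inv ht
    rw [← hc, hmk i h f hm.1 hm.2] at h1
    rw [← hc, ← h1]
    exact ⟨(i.1.1.left_inv hm.1).symm, (i.1.2.left_inv hm.2).symm⟩
  have hcont : ∀ i : I, ContinuousOn (fun t : JetModel n (𝒜.order r) =>
      (i.1.1.symm t.1, i.1.2.symm t.2.1)) (e i).target := fun i =>
    (i.1.1.continuousOn_symm.comp continuousOn_fst fun t ht => ht.1).prodMk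
      (i.1.2.continuousOn_symm.comp (continuous_fst.comp continuous_snd).continuousOn
        fun t ht => ht.2)
  have hto : ∀ i, IsOpen (e i).target := fun i =>
    (i.1.1.open_target.preimage continuous_fst).inter
      (i.1.2.open_target.preimage (continuous_fst.comp continuous_snd))
  have hex : ∀ q : H × M, ∃ i : I, q.1 ∈ i.1.1.source ∧ q.2 ∈ i.1.2.source := by
    intro q
    obtain ⟨φ, hφ, hu⟩ := 𝒜.cover q.2
    exact ⟨⟨(chartAt _ q.1, φ), IsManifold.chart_mem_maximalAtlas q.1, hφ⟩,
      mem_chart_source _ q.1, hu⟩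
  have hopen : ∀ i j, IsOpen ((e i).symm.trans (e j)).source := by
    intro i j
    have := (hcont i).isOpen_inter_preimage (hto i) (j.1.1.open_source.prod j.1.2.open_source)
    convert this using 1
    ext t
    rw [PartialEquiv.trans_source, PartialEquiv.symm_source]
    refine and_congr_right fun ht => ?_
    have := hst i t ht
    rw [mem_preimage, hsrc]
    simp only [jetDomain, mem_ofPred_eq, this.1, this.2]
    rfl
  -- Locally the inverse of the `i`-th chart is `s ↦` the jet of `Φ s` at `σ s` for a smooth family,
  -- and the `j`-th coordinates of such jets are smooth in `s`.
  have hsm : ∀ i j, ContDiffOn ℝ ∞ ((e i).symm.trans (e j)) ((e i).symm.trans (e j)).source := by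
    intro i j t ht
    refine ContDiffAt.contDiffWithinAt ?_
    rw [PartialEquiv.trans_source] at ht
    obtain ⟨ht, htj⟩ := ht
    rw [PartialEquiv.symm_source] at ht
    obtain ⟨σ, Φ, hσ, hΦ, hev⟩ :=
      exists_jetFamily i.2.1 (𝒜.subset_maximalAtlas i.2.2) t ht.1 ht.2
    have hfam : ∀ᶠ s in 𝓝 t, (e i).symm s = JetSpace.mk F r (σ s) (Φ s) := by
      filter_upwards [hev] with s hs
      have := (e i).left_inv (x := JetSpace.mk F r (σ s) (Φ s)) ⟨hs.1, hs.2.1⟩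
      rwa [hmk i _ _ hs.1 hs.2.1, hs.2.2] at this
    have hj : (σ t) ∈ j.1.1.source ∧ Φ t (σ t) ∈ j.1.2.source := by
      rw [mem_preimage, hfam.self_of_nhds] at htj
      exact htj
    have hmem : ∀ᶠ s in 𝓝 t, s ∈ ((e i).symm.trans (e j)).source :=
      (hopen i j).mem_nhds (by
        rw [PartialEquiv.trans_source]
        exact ⟨ht, htj⟩)
    refine (contDiffAt_jetCoord_family j.2.1 (𝒜.subset_maximalAtlas j.2.2) (𝒜.order r)
      hσ.contMDiffAt (Φ := fun s => Φ s) hΦ.contMDiffAt hj.1 hj.2).congr_of_eventuallyEq ?_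
    filter_upwards [hfam, hmem] with s hs hs'
    rw [PartialEquiv.trans_source] at hs'
    have h2 : (e i).symm s ∈ (e j).source := hs'.2
    rw [hs] at h2
    rw [PartialEquiv.trans_apply, hs, hmk j (σ s) (Φ s) h2.1 h2.2]
  -- Whether a jet lies in a chart domain depends only on its source and target.
  have hsep : ∀ c c' : JetSpace n H F r, (c.source, c.target) = (c'.source, c'.target) →
      ∃ i, c ∈ (e i).source ∧ c' ∈ (e i).source := by
    intro c c' hc
    obtain ⟨i, hi⟩ := hex (c.source, c.target)
    refine ⟨i, hi, ?_⟩
    rw [hc] at hi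
    exact hi
  have hcount : ∃ s : Set I, s.Countable ∧ ∀ c, ∃ i ∈ s, c ∈ (e i).source := by
    choose i hi using hex
    -- Countably many products of chart domains cover the second countable space `H × M`, and so
    -- countably many jet charts suffice.
    obtain ⟨s, hs, hsu⟩ := TopologicalSpace.countable_cover_nhds (α := H × M)
      (f := fun q => (i q).1.1.source ×ˢ (i q).1.2.source) fun q =>
        ((i q).1.1.open_source.prod (i q).1.2.open_source).mem_nhds (hi q)
    refine ⟨i '' s, hs.image i, fun c => ?_⟩
    have : (c.source, c.target) ∈ ⋃ q ∈ s, (i q).1.1.source ×ˢ (i q).1.2.source := by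
      rw [hsu]; trivial
    simp only [mem_iUnion] at this
    obtain ⟨q, hq, hc⟩ := this
    exact ⟨i q, mem_image_of_mem i hq, hc⟩
  obtain ⟨S, E, hL, hE⟩ := exists_smoothStructure e (fun c => hex (c.source, c.target)) hopen
    hsm (fun c => (c.source, c.target))
    (fun i => (hcont i).congr fun t ht => Prod.ext (hst i t ht).1 (hst i t ht).2) hsep hcount
  refine ⟨S, hL, fun ψ hψ φ hφ => ?_⟩
  let i : I := ⟨(ψ, φ), hψ, hφ⟩
  refine ⟨E i, (hE i).2, congrArg PartialEquiv.source (hE i).1,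
    congrArg PartialEquiv.target (hE i).1, fun h f hh hu => ?_⟩
  exact (congrArg (fun c : PartialEquiv _ _ => c (JetSpace.mk F r h f)) (hE i).1).trans
    (hmk i h f hh hu)

end JetStructure

/-- The coordinates of the target and the other coordinates. -/
def jetModelSwap (n : ℕ) {m : ℕ} (o : Fin m → ℕ) : JetModel n o ≃L[ℝ]
    EuclideanSpace ℝ (Fin m) × EuclideanSpace ℝ (Fin n) ×
      ((j : Fin m) → JetFibre (EuclideanSpace ℝ (Fin n)) (o j)) :=
  (ContinuousLinearEquiv.prodAssoc ℝ _ _ _).symm.trans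
    (((ContinuousLinearEquiv.prodComm ℝ _ _).prodCongr (ContinuousLinearEquiv.refl ℝ _)).trans
      (ContinuousLinearEquiv.prodAssoc ℝ _ _ _))

/-! ### Smooth maps and submanifolds of the manifold of jets -/

namespace IsJetStructure

variable {n : ℕ} {H : Type u} [TopologicalSpace H] [ChartedSpace (EuclideanSpace ℝ (Fin n)) H]
  {ι : Type} [Fintype ι] {m : ℕ} {M : Type v} [TopologicalSpace M]
  [ChartedSpace (EuclideanSpace ℝ (Fin m)) M] {F : Multifoliation ι m M}
  {ψ : OpenPartialHomeomorph H (EuclideanSpace ℝ (Fin n))}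
  {φ : OpenPartialHomeomorph M (EuclideanSpace ℝ (Fin m))} {𝒜 : AdaptedAtlas F} {r : ι → ℕ}
  {S : SmoothStructure (JetSpace n H F r)}

/-- The chart of the manifold of jets defined by charts of `H` and `M`. -/
def chart (hS : IsJetStructure 𝒜 r S) (hψ : ψ ∈ IsManifold.maximalAtlas (𝓡 n) ∞ H)
    (hφ : φ ∈ 𝒜.charts) : OpenPartialHomeomorph S.Space (JetModel n (𝒜.order r)) :=
  (hS.exists_chart ψ hψ φ hφ).choose

section

variable (hS : IsJetStructure 𝒜 r S) (hψ : ψ ∈ IsManifold.maximalAtlas (𝓡 n) ∞ H)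
  (hφ : φ ∈ 𝒜.charts)

theorem isSmoothChart_chart : IsSmoothChart S.dim (hS.chart hψ hφ) :=
  (hS.exists_chart ψ hψ φ hφ).choose_spec.1

theorem chart_source : (hS.chart hψ hφ).source = jetDomain F r ψ φ :=
  (hS.exists_chart ψ hψ φ hφ).choose_spec.2.1

theorem chart_target : (hS.chart hψ hφ).target = jetRange (𝒜.order r) ψ φ :=
  (hS.exists_chart ψ hψ φ hφ).choose_spec.2.2.1

theorem chart_mk {h : H} {f : C^∞⟮𝓡 n, H; 𝓡 m, M⟯} (hh : h ∈ ψ.source) (hu : f h ∈ φ.source) :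
    hS.chart hψ hφ (S.point (JetSpace.mk F r h f)) = jetCoord (𝒜.order r) ψ φ h f :=
  (hS.exists_chart ψ hψ φ hφ).choose_spec.2.2.2 h f hh hu

theorem mem_chart {c : S.Space} : c ∈ (hS.chart hψ hφ).source ↔
    JetSpace.source (SmoothStructure.elt c) ∈ ψ.source ∧
      JetSpace.target (SmoothStructure.elt c) ∈ φ.source := by
  rw [chart_source]
  rfl

theorem chart_fst {c : S.Space} (hc : c ∈ (hS.chart hψ hφ).source) :
    (hS.chart hψ hφ c).1 = ψ (JetSpace.source (SmoothStructure.elt c)) := by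
  rw [hS.mem_chart] at hc
  obtain ⟨h, f, e⟩ := JetSpace.exists_mk (SmoothStructure.elt c)
  have e' : c = S.point (JetSpace.mk F r h f) := e.symm
  subst e'
  rw [hS.chart_mk hψ hφ (h := h) (f := f) hc.1 hc.2]
  rfl

theorem chart_snd_fst {c : S.Space} (hc : c ∈ (hS.chart hψ hφ).source) :
    (hS.chart hψ hφ c).2.1 = φ (JetSpace.target (SmoothStructure.elt c)) := by
  rw [hS.mem_chart] at hc
  obtain ⟨h, f, e⟩ := JetSpace.exists_mk (SmoothStructure.elt c)
  have e' : c = S.point (JetSpace.mk F r h f) := e.symm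
  subst e'
  rw [hS.chart_mk hψ hφ (h := h) (f := f) hc.1 hc.2]
  rfl

end

theorem exists_mem_chart_source [IsManifold (𝓡 n) ∞ H] (hS : IsJetStructure 𝒜 r S) (c : S.Space) :
    ∃ (ψ : OpenPartialHomeomorph H (EuclideanSpace ℝ (Fin n)))
      (φ : OpenPartialHomeomorph M (EuclideanSpace ℝ (Fin m)))
      (hψ : ψ ∈ IsManifold.maximalAtlas (𝓡 n) ∞ H) (hφ : φ ∈ 𝒜.charts),
        c ∈ (hS.chart hψ hφ).source := by
  obtain ⟨φ, hφ, hu⟩ := 𝒜.cover (JetSpace.target (SmoothStructure.elt c))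
  have hψ := IsManifold.chart_mem_maximalAtlas (I := 𝓡 n) (n := ∞)
    (JetSpace.source (SmoothStructure.elt c))
  exact ⟨_, φ, hψ, hφ, (hS.mem_chart hψ hφ).2 ⟨mem_chart_source _ _, hu⟩⟩

variable [IsManifold (𝓡 n) ∞ H] (hS : IsJetStructure 𝒜 r S)

include hS

theorem contMDiff_source :
    ContMDiff (𝓡 S.dim) (𝓡 n) ∞ (fun c : S.Space => JetSpace.source (SmoothStructure.elt c)) := by
  intro c
  obtain ⟨ψ, φ, hψ, hφ, hc⟩ := hS.exists_mem_chart_source c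
  have hev := (hS.chart hψ hφ).open_source.mem_nhds hc
  refine (isSmoothChart_of_mem_maximalAtlas hψ).contMDiffAt_of_comp ?_ ?_
  · filter_upwards [hev] with z hz
    exact ((hS.mem_chart hψ hφ).1 hz).1
  · refine (contDiff_fst.contMDiff.contMDiffAt.comp c
      ((hS.isSmoothChart_chart hψ hφ).contMDiffAt hc)).congr_of_eventuallyEq ?_
    filter_upwards [hev] with z hz
    exact (hS.chart_fst hψ hφ hz).symm

theorem contMDiff_target [IsManifold (𝓡 m) ∞ M] :
    ContMDiff (𝓡 S.dim) (𝓡 m) ∞ (fun c : S.Space => JetSpace.target (SmoothStructure.elt c)) := by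
  intro c
  obtain ⟨ψ, φ, hψ, hφ, hc⟩ := hS.exists_mem_chart_source c
  have hev := (hS.chart hψ hφ).open_source.mem_nhds hc
  refine (isSmoothChart_of_mem_maximalAtlas (𝒜.subset_maximalAtlas hφ)).contMDiffAt_of_comp ?_ ?_
  · filter_upwards [hev] with z hz
    exact ((hS.mem_chart hψ hφ).1 hz).2
  · have hp : ContDiff ℝ ∞ (fun t : JetModel n (𝒜.order r) => t.2.1) := by fun_prop
    refine (hp.contMDiff.contMDiffAt.comp c
      ((hS.isSmoothChart_chart hψ hφ).contMDiffAt hc)).congr_of_eventuallyEq ?_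
    filter_upwards [hev] with z hz
    exact (hS.chart_snd_fst hψ hφ hz).symm

theorem contMDiffAt_family {P : Type*} [NormedAddCommGroup P] [NormedSpace ℝ P] {σ : P → H}
    {Φ : P → C^∞⟮𝓡 n, H; 𝓡 m, M⟯} {t : P} (hσ : ContMDiffAt 𝓘(ℝ, P) (𝓡 n) ∞ σ t)
    (hΦ : ContMDiffAt (𝓘(ℝ, P).prod (𝓡 n)) (𝓡 m) ∞ (fun q : P × H => Φ q.1 q.2) (t, σ t)) :
    ContMDiffAt 𝓘(ℝ, P) (𝓡 S.dim) ∞ (fun s => S.point (JetSpace.mk F r (σ s) (Φ s))) t := by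
  obtain ⟨ψ, φ, hψ, hφ, hc⟩ := hS.exists_mem_chart_source (S.point (JetSpace.mk F r (σ t) (Φ t)))
  have hc' := (hS.mem_chart hψ hφ).1 hc
  have h1 : ∀ᶠ s in 𝓝 t, σ s ∈ ψ.source :=
    hσ.continuousAt.eventually (ψ.open_source.mem_nhds hc'.1)
  have h2 : ∀ᶠ s in 𝓝 t, Φ s (σ s) ∈ φ.source := by
    have := (hΦ.comp t (contMDiffAt_id.prodMk hσ)).continuousAt
    exact this.eventually (φ.open_source.mem_nhds hc'.2)
  refine (hS.isSmoothChart_chart hψ hφ).contMDiffAt_of_comp ?_ ?_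
  · filter_upwards [h1, h2] with s hs hs'
    exact (hS.mem_chart hψ hφ).2 ⟨hs, hs'⟩
  · have := contDiffAt_jetCoord_family hψ (𝒜.subset_maximalAtlas hφ) (𝒜.order r)
      (Φ := fun s => Φ s) hσ hΦ hc'.1 hc'.2
    refine this.contMDiffAt.congr_of_eventuallyEq ?_
    filter_upwards [h1, h2] with s hs hs'
    exact hS.chart_mk hψ hφ (h := σ s) (f := Φ s) hs hs'

theorem hasSmoothJetFamilies : HasSmoothJetFamilies S := fun _ _ _ hσ hΦ _ =>
  hS.contMDiffAt_family hσ.contMDiffAt hΦ.contMDiffAt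

-- Charts adapted to a foliation belong to the adapted atlas, so their derivatives can be read off
-- from a jet chart. Order zero is treated separately: it is a target coordinate, while the jet
-- fibres contain only derivatives of positive order.
omit [IsManifold (𝓡 n) ∞ H] in
theorem hasSmoothJetCoordinates : HasSmoothJetCoordinates S := by
  intro ψ hψ δ φ hφ' j hj k hk
  have hφ := 𝒜.adapted_subset δ hφ'
  have hk' : k ≤ 𝒜.order r j := hk.trans (𝒜.le_order r δ j hj)
  set e := hS.chart hψ hφ with he
  have hsm : ContMDiffOn (𝓡 S.dim) 𝓘(ℝ, JetModel n (𝒜.order r)) ∞ e e.source :=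
    (hS.isSmoothChart_chart hψ hφ).1
  rw [he, hS.chart_source] at hsm
  cases k with
  | zero =>
    refine ⟨fun c => (continuousMultilinearCurryFin0 ℝ (EuclideanSpace ℝ (Fin n)) ℝ).symm
      ((e c).2.1 j), fun h f hh hu => ?_, ?_⟩
    · beta_reduce
      rw [he, hS.chart_mk hψ hφ hh hu]
      ext v
      simp [jetCoord, ψ.left_inv hh]
    · have hd : ContDiff ℝ ∞ (fun t : JetModel n (𝒜.order r) =>
          (continuousMultilinearCurryFin0 ℝ (EuclideanSpace ℝ (Fin n)) ℝ).symm (t.2.1 j)) :=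
        (LinearIsometryEquiv.contDiff _).comp (by fun_prop)
      exact hd.contMDiff.comp_contMDiffOn hsm
  | succ k =>
    refine ⟨fun c => jetDerivs ((e c).2.2 j) ⟨k, hk'⟩, fun h f hh hu => ?_, ?_⟩
    · beta_reduce
      rw [he, hS.chart_mk hψ hφ hh hu]
      simp only [jetCoord]
      rw [jetDerivs_jetAt]
      · rfl
      · exact (eventually_contDiffAt_localRep hψ (𝒜.subset_maximalAtlas hφ) f.contMDiff hh hu).mono
          fun z hz => hz.coord j
    · have hw : ContDiff ℝ ∞ (fun t : JetModel n (𝒜.order r) => t.2.2) := by fun_prop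
      have hd : ContDiff ℝ ∞ (fun t : JetModel n (𝒜.order r) => jetDerivs (t.2.2 j)) :=
        (jetDerivs (E := EuclideanSpace ℝ (Fin n)) (r := 𝒜.order r j)).contDiff.comp
          (contDiff_pi.1 hw j)
      exact (contDiff_pi.1 hd ⟨k, hk'⟩).contMDiff.comp_contMDiffOn hsm

theorem isEmbeddedSubmanifold_source (h : H) :
    IsEmbeddedSubmanifold S {c | JetSpace.source c = h} := by
  obtain ⟨L⟩ := hS.model
  refine isEmbeddedSubmanifold_of_slices S _ L (ContinuousLinearEquiv.refl ℝ _) fun y hy => ?_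
  obtain ⟨ψ, φ, hψ, hφ, hc⟩ := hS.exists_mem_chart_source (S.point y)
  have hh : h ∈ ψ.source := hy ▸ ((hS.mem_chart hψ hφ).1 hc).1
  refine ⟨hS.chart hψ hφ, ψ h, hS.isSmoothChart_chart hψ hφ, hc, fun x hx => ?_⟩
  change JetSpace.source (SmoothStructure.elt x) = h ↔ (hS.chart hψ hφ x).1 = ψ h
  rw [hS.chart_fst hψ hφ hx]
  exact (ψ.injOn.eq_iff ((hS.mem_chart hψ hφ).1 hx).1 hh).symm

theorem isEmbeddedSubmanifold_target (u : M) :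
    IsEmbeddedSubmanifold S {c | JetSpace.target c = u} := by
  obtain ⟨L⟩ := hS.model
  refine isEmbeddedSubmanifold_of_slices S _ L (jetModelSwap n (𝒜.order r)) fun y hy => ?_
  obtain ⟨ψ, φ, hψ, hφ, hc⟩ := hS.exists_mem_chart_source (S.point y)
  have hu : u ∈ φ.source := hy ▸ ((hS.mem_chart hψ hφ).1 hc).2
  refine ⟨hS.chart hψ hφ, φ u, hS.isSmoothChart_chart hψ hφ, hc, fun x hx => ?_⟩
  change JetSpace.target (SmoothStructure.elt x) = u ↔ (hS.chart hψ hφ x).2.1 = φ u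
  rw [hS.chart_snd_fst hψ hφ hx]
  exact (φ.injOn.eq_iff ((hS.mem_chart hψ hφ).1 hx).2 hu).symm

theorem isEmbeddedSubmanifold_source_target (h : H) (u : M) :
    IsEmbeddedSubmanifold S {c | JetSpace.source c = h ∧ JetSpace.target c = u} := by
  obtain ⟨L⟩ := hS.model
  refine isEmbeddedSubmanifold_of_slices S _ L
    (ContinuousLinearEquiv.prodAssoc ℝ _ _ _).symm fun y hy => ?_
  obtain ⟨ψ, φ, hψ, hφ, hc⟩ := hS.exists_mem_chart_source (S.point y)
  have hc' := (hS.mem_chart hψ hφ).1 hc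
  have hh : h ∈ ψ.source := hy.1 ▸ hc'.1
  have hu : u ∈ φ.source := hy.2 ▸ hc'.2
  refine ⟨hS.chart hψ hφ, (ψ h, φ u), hS.isSmoothChart_chart hψ hφ, hc, fun x hx => ?_⟩
  change JetSpace.source (SmoothStructure.elt x) = h ∧ JetSpace.target (SmoothStructure.elt x) = u ↔
    ((hS.chart hψ hφ x).1, (hS.chart hψ hφ x).2.1) = (ψ h, φ u)
  have hx' := (hS.mem_chart hψ hφ).1 hx
  rw [hS.chart_fst hψ hφ hx, hS.chart_snd_fst hψ hφ hx, Prod.mk.injEq]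
  exact and_congr (ψ.injOn.eq_iff hx'.1 hh).symm (φ.injOn.eq_iff hx'.2 hu).symm

omit hS [IsManifold (𝓡 n) ∞ H] in
theorem _root_.JetSpace.mk_zero_eq {h : H} {f g : C^∞⟮𝓡 n, H; 𝓡 m, M⟯} (hfg : f h = g h) :
    JetSpace.mk F 0 h f = JetSpace.mk F 0 h g := by
  refine Quotient.sound ⟨rfl, hfg, fun φ _ δ γ _ h0 k hk => ?_⟩
  obtain rfl := Nat.le_zero.1 hk
  subst h0
  funext j
  have : f (γ 0) = g (γ 0) := hfg
  simp [leafCoord, this]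

end IsJetStructure

/-! ### Jets of order zero -/

section ZeroJets

variable {n : ℕ} {H : Type u} [TopologicalSpace H] [ChartedSpace (EuclideanSpace ℝ (Fin n)) H]
  {ι : Type} [Fintype ι] {m : ℕ} {M : Type v} [TopologicalSpace M]
  [ChartedSpace (EuclideanSpace ℝ (Fin m)) M] {F : Multifoliation ι m M}
  [IsManifold (𝓡 n) ∞ H] [IsManifold (𝓡 m) ∞ M]

/-- The inverse sends `(h, u)` to the jet at `h` of the constant map `u`; constant maps form a
smooth family. -/
theorem IsJetStructure.exists_diffeomorph_zero {𝒜 : AdaptedAtlas F}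
    {S : SmoothStructure (JetSpace n H F 0)} (hS : IsJetStructure 𝒜 0 S) :
    ∃ Ψ : Diffeomorph (𝓡 S.dim) ((𝓡 n).prod (𝓡 m)) S.Space (H × M) ∞, ∀ c : S.Space, Ψ c =
      (JetSpace.source (SmoothStructure.elt c), JetSpace.target (SmoothStructure.elt c)) := by
  let inv : H × M → S.Space := fun q => S.point (JetSpace.mk F 0 q.1 (ContMDiffMap.const q.2))
  refine ⟨{
    toFun := fun c =>
      (JetSpace.source (SmoothStructure.elt c), JetSpace.target (SmoothStructure.elt c))
    invFun := inv
    left_inv := fun c => ?_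
    right_inv := fun q => rfl
    contMDiff_toFun := hS.contMDiff_source.prodMk hS.contMDiff_target
    contMDiff_invFun := fun q => ?_ }, fun c => rfl⟩
  · obtain ⟨h, f, e⟩ := JetSpace.exists_mk (SmoothStructure.elt c)
    have e' : c = S.point (JetSpace.mk F 0 h f) := e.symm
    subst e'
    exact JetSpace.mk_zero_eq rfl
  · have hψ := isSmoothChart_of_mem_maximalAtlas
      (IsManifold.chart_mem_maximalAtlas (I := 𝓡 n) (n := ∞) q.1)
    have hφ := isSmoothChart_of_mem_maximalAtlas
      (IsManifold.chart_mem_maximalAtlas (I := 𝓡 m) (n := ∞) q.2)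
    refine hψ.contMDiffAt_prod hφ (mem_chart_source _ q.1) (mem_chart_source _ q.2) (f := inv) ?_
    have h1 := hψ.contMDiffAt_symm (mem_chart_target _ q.1)
    have h2 := hφ.contMDiffAt_symm (mem_chart_target _ q.2)
    refine hS.contMDiffAt_family
      (P := EuclideanSpace ℝ (Fin n) × EuclideanSpace ℝ (Fin m))
      (σ := fun t => (chartAt _ q.1).symm t.1)
      (Φ := fun t => ContMDiffMap.const ((chartAt _ q.2).symm t.2)) ?_ ?_
    · exact ContMDiffAt.comp (chartAt _ q.1 q.1, chartAt _ q.2 q.2) h1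
        contDiff_fst.contMDiff.contMDiffAt
    · refine ContMDiffAt.comp (g := (chartAt (EuclideanSpace ℝ (Fin m)) q.2).symm)
        (f := fun s : (EuclideanSpace ℝ (Fin n) × EuclideanSpace ℝ (Fin m)) × H => s.1.2) _ h2 ?_
      exact contDiff_snd.contMDiff.contMDiffAt.comp _ contMDiffAt_fst

end ZeroJets

/-! ## Bundles of jets -/

section Translation

variable {E : Type} [NormedAddCommGroup E] [NormedSpace ℝ E] [FiniteDimensional ℝ E]

theorem jetAt_comp_add_right (r : ℕ) (f : E → ℝ) (a x : E) :
    jetAt r (fun y => f (y + a)) x = jetAt r f (x + a) := by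
  unfold jetAt
  congr 1
  funext k
  exact iteratedFDeriv_comp_add_right _ _ _

theorem jetAt_const_add {r : ℕ} {f : E → ℝ} {x : E} (hf : ContDiffAt ℝ ∞ f x) (c : ℝ) :
    jetAt r (fun y => c + f y) x = jetAt r f x := by
  unfold jetAt
  congr 1
  funext k
  have e : (fun y => c + f y) = (fun _ => c) + f := rfl
  simp only [derivTuple]
  rw [e, iteratedFDeriv_add_apply contDiffAt_const (hf.of_le (by exact_mod_cast le_top)),
    iteratedFDeriv_const_of_ne (by omega)]
  simp

end Translation

section Transport

variable {n : ℕ} {H : Type u} [TopologicalSpace H] [ChartedSpace (EuclideanSpace ℝ (Fin n)) H]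
  {m : ℕ} {M : Type v} [TopologicalSpace M] [ChartedSpace (EuclideanSpace ℝ (Fin m)) M]

/-- Jets are moved to another source by translations in charts. -/
theorem exists_transport_source [T2Space H] [IsManifold (𝓡 n) ∞ H]
    {ψ ψ' : OpenPartialHomeomorph H (EuclideanSpace ℝ (Fin n))}
    (hψ : ψ ∈ IsManifold.maximalAtlas (𝓡 n) ∞ H) (hψ' : ψ' ∈ IsManifold.maximalAtlas (𝓡 n) ∞ H)
    {h h' : H} (hh : h ∈ ψ.source) (hh' : h' ∈ ψ'.source) (f : C^∞⟮𝓡 n, H; 𝓡 m, M⟯) :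
    ∃ f' : C^∞⟮𝓡 n, H; 𝓡 m, M⟯, f' h' = f h ∧
      ∀ (φ : OpenPartialHomeomorph M (EuclideanSpace ℝ (Fin m))) (o : Fin m → ℕ),
        (jetCoord o ψ' φ h' f').2 = (jetCoord o ψ φ h f).2 := by
  obtain ⟨τ, hτ, hτψ⟩ := exists_contMDiff_eventuallyEq_chart_symm hψ (ψ.map_source hh)
  obtain ⟨B, hB, hBψ⟩ := exists_contMDiff_eventuallyEq_chart hψ' hh'
  have hd : ContDiff ℝ ∞ (fun y => y + (ψ h - ψ' h')) := by fun_prop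
  -- Near `h'` this global map is the translation that takes `ψ' h'` to `ψ h`, read in the charts.
  -- Precomposition with it translates the local representative, so derivatives are carried over
  -- unchanged.
  let ν : C^∞⟮𝓡 n, H; 𝓡 n, H⟯ :=
    ⟨fun z => τ (B z + (ψ h - ψ' h')), hτ.comp (hd.contMDiff.comp hB)⟩
  have hν : ν h' = h := by
    change τ (B h' + (ψ h - ψ' h')) = h
    rw [hBψ.self_of_nhds, add_sub_cancel, hτψ.self_of_nhds.1, ψ.left_inv hh]
  have hval : f (ν h') = f h := by rw [hν]
  refine ⟨f.comp ν, hval, fun φ o => Prod.ext (congrArg φ hval) (funext fun j => ?_)⟩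
  have e1 : ∀ᶠ y in 𝓝 (ψ' h'), B (ψ'.symm y) = ψ' (ψ'.symm y) := by
    have := ψ'.continuousAt_symm (ψ'.map_source hh')
    refine this.eventually (p := fun z => B z = ψ' z) ?_
    rwa [ψ'.left_inv hh']
  have e2 : ∀ᶠ y in 𝓝 (ψ' h'), τ (y + (ψ h - ψ' h')) = ψ.symm (y + (ψ h - ψ' h')) := by
    have := hd.continuous.tendsto (ψ' h')
    rw [add_sub_cancel] at this
    exact (this.eventually hτψ).mono fun y hy => hy.1
  have e3 : (fun y => localRep ψ' φ (f.comp ν) y j) =ᶠ[𝓝 (ψ' h')]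
      fun y => localRep ψ φ f (y + (ψ h - ψ' h')) j := by
    filter_upwards [e1, e2, ψ'.open_target.mem_nhds (ψ'.map_source hh')] with y h1 h2 h3
    change (φ (f (τ (B (ψ'.symm y) + (ψ h - ψ' h'))))) j = _
    rw [h1, ψ'.right_inv h3, h2]
    rfl
  simp only [jetCoord]
  rw [jetAt_congr e3, jetAt_comp_add_right (o j) (fun y => localRep ψ φ f y j), add_sub_cancel]

/-- Jets are moved to another target by translations in charts. -/
theorem exists_transport_target [T2Space M] [IsManifold (𝓡 n) ∞ H] [IsManifold (𝓡 m) ∞ M]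
    {φ φ' : OpenPartialHomeomorph M (EuclideanSpace ℝ (Fin m))}
    (hφ : φ ∈ IsManifold.maximalAtlas (𝓡 m) ∞ M) (hφ' : φ' ∈ IsManifold.maximalAtlas (𝓡 m) ∞ M)
    {h : H} {f : C^∞⟮𝓡 n, H; 𝓡 m, M⟯} (hu : f h ∈ φ.source) {u' : M} (hu' : u' ∈ φ'.source) :
    ∃ f' : C^∞⟮𝓡 n, H; 𝓡 m, M⟯, f' h = u' ∧
      ∀ ψ ∈ IsManifold.maximalAtlas (𝓡 n) ∞ H, h ∈ ψ.source → ∀ o : Fin m → ℕ,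
        (jetCoord o ψ φ' h f').2.2 = (jetCoord o ψ φ h f).2.2 := by
  obtain ⟨τ, hτ, hτφ⟩ := exists_contMDiff_eventuallyEq_chart_symm hφ' (φ'.map_source hu')
  obtain ⟨B, hB, hBφ⟩ := exists_contMDiff_eventuallyEq_chart hφ hu
  have hd : ContDiff ℝ ∞ (fun y => (φ' u' - φ (f h)) + y) := by fun_prop
  -- Near `f h` this is a translation in the charts. Composing with it adds a constant to the local
  -- representative, which does not affect derivatives of positive order.
  let ν : C^∞⟮𝓡 m, M; 𝓡 m, M⟯ :=
    ⟨fun z => τ ((φ' u' - φ (f h)) + B z), hτ.comp (hd.contMDiff.comp hB)⟩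
  have hν : ν (f h) = u' := by
    change τ ((φ' u' - φ (f h)) + B (f h)) = u'
    rw [hBφ.self_of_nhds, sub_add_cancel, hτφ.self_of_nhds.1, φ'.left_inv hu']
  refine ⟨ν.comp f, hν, fun ψ hψ hh o => funext fun j => ?_⟩
  have e0 : Filter.Tendsto (fun y => f (ψ.symm y)) (𝓝 (ψ h)) (𝓝 (f h)) := by
    have h1 : ContinuousAt (fun y => f (ψ.symm y)) (ψ h) :=
      ContinuousAt.comp (g := f) f.contMDiff.continuous.continuousAt
        (ψ.continuousAt_symm (ψ.map_source hh))
    have := h1.tendsto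
    rwa [ψ.left_inv hh] at this
  have e1 : ∀ᶠ y in 𝓝 (ψ h), B (f (ψ.symm y)) = φ (f (ψ.symm y)) := e0.eventually hBφ
  have e2 : ∀ᶠ v in 𝓝 (f h), τ ((φ' u' - φ (f h)) + φ v) = φ'.symm ((φ' u' - φ (f h)) + φ v) ∧
      (φ' u' - φ (f h)) + φ v ∈ φ'.target := by
    have : ContinuousAt (fun v => (φ' u' - φ (f h)) + φ v) (f h) :=
      hd.continuous.continuousAt.comp (φ.continuousAt hu)
    have := this.tendsto
    rw [sub_add_cancel] at this
    exact this.eventually hτφ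
  have e3 : (fun y => localRep ψ φ' (ν.comp f) y j) =ᶠ[𝓝 (ψ h)]
      fun y => (φ' u' - φ (f h)) j + localRep ψ φ f y j := by
    filter_upwards [e1, e0.eventually e2] with y h1 h2
    change (φ' (τ ((φ' u' - φ (f h)) + B (f (ψ.symm y))))) j = _
    rw [h1, h2.1, φ'.right_inv h2.2]
    rfl
  simp only [jetCoord]
  rw [jetAt_congr e3, jetAt_const_add]
  exact (contDiffAt_localRep hψ hφ f.contMDiff.contMDiffAt hh hu).coord j

end Transport

/-- A map to a manifold with charts `ψ ∈ 𝒞` is the projection of a bundle, if there are charts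
`e ψ l` of its domain, for which `ψ` and the projection give some of the coordinates, and if the
points of a fibre can be moved to any other fibre such that the other coordinates do not change. -/
theorem isSmoothBundle_of_transport {X : Type u} [Nonempty X] (S : SmoothStructure X)
    {b : ℕ} {B : Type v} [TopologicalSpace B] [ChartedSpace (EuclideanSpace ℝ (Fin b)) B]
    [IsManifold (𝓡 b) ∞ B] {V C : Type} [NormedAddCommGroup V] [NormedSpace ℝ V]
    [NormedAddCommGroup C] [NormedSpace ℝ C] (π : X → B)
    (hπ : ContMDiff (𝓡 S.dim) (𝓡 b) ∞ (fun c : S.Space => π (SmoothStructure.elt c)))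
    (hemb : ∀ y, IsEmbeddedSubmanifold S {c | π c = y})
    {𝒞 : Set (OpenPartialHomeomorph B (EuclideanSpace ℝ (Fin b)))}
    (h𝒞 : 𝒞 ⊆ IsManifold.maximalAtlas (𝓡 b) ∞ B) (hcov : ∀ y, ∃ ψ ∈ 𝒞, y ∈ ψ.source)
    {Λ Q : Type*} (p : X → Q) (Ω : Λ → Set Q) (hΩ : ∀ q, ∃ l, q ∈ Ω l)
    (K : V ≃L[ℝ] EuclideanSpace ℝ (Fin b) × C) (e : 𝒞 → Λ → OpenPartialHomeomorph S.Space V)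
    (he : ∀ ψ l, IsSmoothChart S.dim (e ψ l))
    (hsrc : ∀ ψ l (c : S.Space), c ∈ (e ψ l).source ↔
      π (SmoothStructure.elt c) ∈ ψ.1.source ∧ p (SmoothStructure.elt c) ∈ Ω l)
    (hfst : ∀ ψ l, ∀ c ∈ (e ψ l).source, (K (e ψ l c)).1 = ψ.1 (π (SmoothStructure.elt c)))
    (htr : ∀ (ψ ψ' : 𝒞) (c : S.Space) (y : B), π (SmoothStructure.elt c) ∈ ψ.1.source →
      y ∈ ψ'.1.source → ∃ c' : S.Space, π (SmoothStructure.elt c') = y ∧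
        p (SmoothStructure.elt c') = p (SmoothStructure.elt c) ∧
          ∀ l, p (SmoothStructure.elt c) ∈ Ω l → (K (e ψ' l c')).2 = (K (e ψ l c)).2) :
    IsSmoothBundle S.dim b (fun c : S.Space => π (SmoothStructure.elt c)) := by
  let c₀ : S.Space := S.point (Classical.arbitrary X)
  set y₀ := π (SmoothStructure.elt c₀) with hy₀
  obtain ⟨ψ₀', hψ₀', hyψ₀⟩ := hcov y₀
  let ψ₀ : 𝒞 := ⟨ψ₀', hψ₀'⟩
  have hsurj : Function.Surjective (fun c : S.Space => π (SmoothStructure.elt c)) := by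
    intro y
    obtain ⟨ψ, hψ, hy⟩ := hcov y
    obtain ⟨c, hc, -⟩ := htr ψ₀ ⟨ψ, hψ⟩ c₀ y hyψ₀ hy
    exact ⟨c, hc⟩
  obtain ⟨T, hT⟩ := hemb y₀
  set i : T.Space → S.Space := fun t => S.point (SmoothStructure.elt t).val with hi
  have hit : ∀ t, π (SmoothStructure.elt (i t)) = y₀ := fun t => (SmoothStructure.elt t).2
  refine isSmoothBundle_of_local_product hsurj hπ T fun y₁ => ?_
  obtain ⟨ψ₁', hψ₁', hyψ₁⟩ := hcov y₁
  let ψ₁ : 𝒞 := ⟨ψ₁', hψ₁'⟩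
  -- The model fibre is the fibre `T` over `y₀`, and the fibre component of `c` is `c` transported
  -- there. The transported point is characterized in all charts `l` at once, so it defines one map
  -- over all of `ψ₁.1.source`. Elsewhere the value is arbitrary.
  have hf : ∀ c : S.Space, ∃ t : T.Space, π (SmoothStructure.elt c) ∈ ψ₁.1.source →
      p (SmoothStructure.elt (i t)) = p (SmoothStructure.elt c) ∧
      ∀ l, p (SmoothStructure.elt c) ∈ Ω l → (K (e ψ₀ l (i t))).2 = (K (e ψ₁ l c)).2 := by
    intro c
    by_cases hc : π (SmoothStructure.elt c) ∈ ψ₁.1.source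
    · obtain ⟨c', h1, h2⟩ := htr ψ₁ ψ₀ c y₀ hc hyψ₀
      exact ⟨T.point ⟨SmoothStructure.elt c', h1⟩, fun _ => h2⟩
    · exact ⟨T.point ⟨SmoothStructure.elt c₀, rfl⟩, fun h => absurd h hc⟩
  have hg : ∀ q : B × T.Space, ∃ c : S.Space, q.1 ∈ ψ₁.1.source →
      π (SmoothStructure.elt c) = q.1 ∧ p (SmoothStructure.elt c) = p (SmoothStructure.elt (i q.2)) ∧
      ∀ l, p (SmoothStructure.elt (i q.2)) ∈ Ω l → (K (e ψ₁ l c)).2 = (K (e ψ₀ l (i q.2))).2 := by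
    intro q
    by_cases hq : q.1 ∈ ψ₁.1.source
    · obtain ⟨c', h1⟩ := htr ψ₀ ψ₁ (i q.2) q.1 (by rw [hit]; exact hyψ₀) hq
      exact ⟨c', fun _ => h1⟩
    · exact ⟨c₀, fun h => absurd h hq⟩
  choose f hf using hf
  choose g hg using hg
  have hf0 : ∀ l c, π (SmoothStructure.elt c) ∈ ψ₁.1.source → p (SmoothStructure.elt c) ∈ Ω l →
      i (f c) ∈ (e ψ₀ l).source := fun l c hc hl =>
    (hsrc _ _ _).2 ⟨by rw [hit]; exact hyψ₀, by rwa [(hf c hc).1]⟩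
  -- In charts with the same `l`, transport only replaces the base coordinates, which makes `f` and
  -- `g` smooth and inverse to each other.
  have hfe : ∀ l c, π (SmoothStructure.elt c) ∈ ψ₁.1.source → p (SmoothStructure.elt c) ∈ Ω l →
      e ψ₀ l (i (f c)) = K.symm (ψ₀.1 y₀, (K (e ψ₁ l c)).2) := by
    intro l c hc hl
    rw [ContinuousLinearEquiv.eq_symm_apply]
    exact Prod.ext ((hfst _ _ _ (hf0 l c hc hl)).trans (by rw [hit])) ((hf c hc).2 l hl)
  have hg0 : ∀ l q, q.1 ∈ ψ₁.1.source → p (SmoothStructure.elt (i q.2)) ∈ Ω l →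
      g q ∈ (e ψ₁ l).source := fun l q hq hl =>
    (hsrc _ _ _).2 ⟨by rwa [(hg q hq).1], by rwa [(hg q hq).2.1]⟩
  have hge : ∀ l q, q.1 ∈ ψ₁.1.source → p (SmoothStructure.elt (i q.2)) ∈ Ω l →
      e ψ₁ l (g q) = K.symm (ψ₁.1 q.1, (K (e ψ₀ l (i q.2))).2) := by
    intro l q hq hl
    rw [ContinuousLinearEquiv.eq_symm_apply]
    exact Prod.ext ((hfst _ _ _ (hg0 l q hq hl)).trans (by rw [(hg q hq).1])) ((hg q hq).2.2 l hl)
  have hKs : ContDiff ℝ ∞ (fun w : EuclideanSpace ℝ (Fin b) × V => K.symm (w.1, (K w.2).2)) := by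
    fun_prop
  refine ⟨ψ₁.1.source, f, g, ψ₁.1.open_source, hyψ₁, fun c hc => ?_, fun q hq => ?_, fun c hc => ?_,
    fun y hy t => ?_⟩
  -- The fibre is embedded, so smoothness of `f` may be tested after inclusion into the total space.
  · refine (hT.contMDiffAt_of_comp ?_).contMDiffWithinAt
    obtain ⟨l, hl⟩ := hΩ (p (SmoothStructure.elt c))
    have hcs : c ∈ (e ψ₁ l).source := (hsrc _ _ _).2 ⟨hc, hl⟩
    have hev := (e ψ₁ l).open_source.mem_nhds hcs
    refine (he ψ₀ l).contMDiffAt_of_comp (f := fun c => i (f c)) ?_ ?_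
    · filter_upwards [hev] with z hz
      exact hf0 l z ((hsrc _ _ _).1 hz).1 ((hsrc _ _ _).1 hz).2
    · have h1 : ContDiff ℝ ∞ (fun w : V => K.symm (ψ₀.1 y₀, (K w).2)) := by fun_prop
      refine (h1.contMDiff.contMDiffAt.comp c ((he ψ₁ l).contMDiffAt hcs)).congr_of_eventuallyEq ?_
      filter_upwards [hev] with z hz
      exact hfe l z ((hsrc _ _ _).1 hz).1 ((hsrc _ _ _).1 hz).2
  · refine ContMDiffAt.contMDiffWithinAt ?_
    obtain ⟨l, hl⟩ := hΩ (p (SmoothStructure.elt (i q.2)))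
    have his : i q.2 ∈ (e ψ₀ l).source := (hsrc _ _ _).2 ⟨by rw [hit]; exact hyψ₀, hl⟩
    have him : ContMDiff (𝓡 T.dim) (𝓡 S.dim) ∞ i := hT.contMDiff
    have hev1 : ∀ᶠ q' in 𝓝 q, q'.1 ∈ ψ₁.1.source :=
      continuousAt_fst.eventually (ψ₁.1.open_source.mem_nhds hq.1)
    have hev2 : ∀ᶠ q' : B × T.Space in 𝓝 q, i q'.2 ∈ (e ψ₀ l).source :=
      (him.continuous.comp continuous_snd).continuousAt.eventually
        ((e ψ₀ l).open_source.mem_nhds his)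
    refine (he ψ₁ l).contMDiffAt_of_comp ?_ ?_
    · filter_upwards [hev1, hev2] with z hz hz'
      exact hg0 l z hz ((hsrc _ _ _).1 hz').2
    · have h1 : ContMDiffAt ((𝓡 b).prod (𝓡 T.dim)) 𝓘(ℝ, EuclideanSpace ℝ (Fin b) × V) ∞
          (fun q' : B × T.Space => (ψ₁.1 q'.1, e ψ₀ l (i q'.2))) q := by
        refine ContMDiffAt.prodMk_space ?_ ?_
        · exact (contMDiffAt_of_mem_maximalAtlas (h𝒞 ψ₁.2) hq.1).comp q contMDiffAt_fst
        · exact ((he ψ₀ l).contMDiffAt his).comp q (him.contMDiffAt.comp q contMDiffAt_snd)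
      refine (hKs.contMDiff.contMDiffAt.comp q h1).congr_of_eventuallyEq ?_
      filter_upwards [hev1, hev2] with z hz hz'
      exact hge l z hz ((hsrc _ _ _).1 hz').2
  · obtain ⟨l, hl⟩ := hΩ (p (SmoothStructure.elt c))
    have hcs : c ∈ (e ψ₁ l).source := (hsrc _ _ _).2 ⟨hc, hl⟩
    have hl' : p (SmoothStructure.elt (i (f c))) ∈ Ω l := by rwa [(hf c hc).1]
    refine (e ψ₁ l).injOn (hg0 l (π (SmoothStructure.elt c), f c) hc hl') hcs ?_
    rw [hge l (π (SmoothStructure.elt c), f c) hc hl', ContinuousLinearEquiv.symm_apply_eq]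
    exact Prod.ext (hfst _ _ _ hcs).symm ((hf c hc).2 l hl)
  · have h1 := (hg (y, t) hy).1
    refine ⟨h1, ?_⟩
    have hy' : π (SmoothStructure.elt (g (y, t))) ∈ ψ₁.1.source := by rwa [h1]
    obtain ⟨l, hl⟩ := hΩ (p (SmoothStructure.elt (i t)))
    have hl' : p (SmoothStructure.elt (g (y, t))) ∈ Ω l := by rwa [(hg (y, t) hy).2.1]
    have hts : i t ∈ (e ψ₀ l).source := (hsrc _ _ _).2 ⟨by rw [hit]; exact hyψ₀, hl⟩
    refine Subtype.ext ((e ψ₀ l).injOn (hf0 l _ hy' hl') hts ?_)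
    rw [hfe l _ hy' hl', ContinuousLinearEquiv.symm_apply_eq]
    exact Prod.ext ((hfst _ _ _ hts).trans (by rw [hit])).symm ((hg (y, t) hy).2.2 l hl)

/-! ### Linear algebra of lowering the order -/

section Lowering

/-- A surjective linear map is a projection. -/
theorem exists_equiv_prod_of_surjective {W W' : Type} [NormedAddCommGroup W] [NormedSpace ℝ W]
    [FiniteDimensional ℝ W] [NormedAddCommGroup W'] [NormedSpace ℝ W'] [FiniteDimensional ℝ W']
    (f : W →L[ℝ] W') (hf : Function.Surjective f) :
    ∃ (d : ℕ) (K : W ≃L[ℝ] W' × EuclideanSpace ℝ (Fin d)), ∀ w, (K w).1 = f w := by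
  obtain ⟨q, hq⟩ := Submodule.exists_isCompl (LinearMap.ker (f : W →ₗ[ℝ] W'))
  let g := Submodule.projectionOnto _ q hq
  have hg : LinearMap.ker g = q := Submodule.ker_projectionOnto hq
  let e : W ≃ₗ[ℝ] W' × LinearMap.ker (f : W →ₗ[ℝ] W') :=
    LinearMap.equivProdOfSurjectiveOfIsCompl (f : W →ₗ[ℝ] W') g (LinearMap.range_eq_top.2 hf)
      (Submodule.range_projectionOnto hq) (by rwa [hg])
  exact ⟨_, e.toContinuousLinearEquiv.trans
    ((ContinuousLinearEquiv.refl ℝ W').prodCongr toEuclidean), fun w => rfl⟩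

/-- Forgetting derivatives in all components. -/
def lowerFibres (n : ℕ) {m : ℕ} {o o' : Fin m → ℕ} (h : o' ≤ o) :
    ((j : Fin m) → JetFibre (EuclideanSpace ℝ (Fin n)) (o j)) →L[ℝ]
      ((j : Fin m) → JetFibre (EuclideanSpace ℝ (Fin n)) (o' j)) :=
  ContinuousLinearMap.pi fun j => lowerFibre (h j) ∘L ContinuousLinearMap.proj j

theorem lowerFibres_surjective (n : ℕ) {m : ℕ} {o o' : Fin m → ℕ} (h : o' ≤ o) :
    Function.Surjective (lowerFibres n h) := by
  intro w
  choose w' hw' using fun j => lowerFibre_surjective (E := EuclideanSpace ℝ (Fin n)) (h j) (w j)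
  exact ⟨w', funext hw'⟩

end Lowering

namespace IsJetStructure

variable {n : ℕ} {H : Type u} [TopologicalSpace H] [ChartedSpace (EuclideanSpace ℝ (Fin n)) H]
  {ι : Type} [Fintype ι] {m : ℕ} {M : Type v} [TopologicalSpace M]
  [ChartedSpace (EuclideanSpace ℝ (Fin m)) M] {F : Multifoliation ι m M}
  {𝒜 : AdaptedAtlas F} {r r' : ι → ℕ}
  {S : SmoothStructure (JetSpace n H F r)} {S' : SmoothStructure (JetSpace n H F r')}
  [IsManifold (𝓡 n) ∞ H]

/-- The auxiliary quantity kept fixed by transport is the target, so the same chart of `M` can be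
used before and after. For the target bundle below the roles are exchanged. -/
theorem isSmoothBundle_source [T2Space H] [Nonempty H] [Nonempty M] (hS : IsJetStructure 𝒜 r S) :
    IsSmoothBundle S.dim n (fun c : S.Space => JetSpace.source (SmoothStructure.elt c)) := by
  have : Nonempty (JetSpace n H F r) :=
    ⟨JetSpace.mk F r (Classical.arbitrary H) (ContMDiffMap.const (Classical.arbitrary M))⟩
  refine isSmoothBundle_of_transport S JetSpace.source hS.contMDiff_source
    hS.isEmbeddedSubmanifold_source (𝒞 := IsManifold.maximalAtlas (𝓡 n) ∞ H) subset_rfl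
    (fun y => ⟨_, IsManifold.chart_mem_maximalAtlas y, mem_chart_source _ y⟩)
    (Λ := 𝒜.charts) JetSpace.target (fun φ => φ.1.source) (fun u => ?_)
    (ContinuousLinearEquiv.refl ℝ _) (fun ψ φ => hS.chart ψ.2 φ.2)
    (fun ψ φ => hS.isSmoothChart_chart ψ.2 φ.2) (fun ψ φ c => hS.mem_chart ψ.2 φ.2)
    (fun ψ φ c hc => hS.chart_fst ψ.2 φ.2 hc) fun ψ ψ' c y hc hy => ?_
  · obtain ⟨φ, hφ, hu⟩ := 𝒜.cover u
    exact ⟨⟨φ, hφ⟩, hu⟩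
  · obtain ⟨h, f, e⟩ := JetSpace.exists_mk (SmoothStructure.elt c)
    have e' : c = S.point (JetSpace.mk F r h f) := e.symm
    subst e'
    obtain ⟨f', h1, h2⟩ := exists_transport_source ψ.2 ψ'.2 (h := h) hc hy f
    refine ⟨S.point (JetSpace.mk F r y f'), rfl, h1, fun φ hφ => ?_⟩
    have hφ' : f' y ∈ φ.1.source := by rw [h1]; exact hφ
    simp only [ContinuousLinearEquiv.coe_refl', id_eq]
    rw [hS.chart_mk ψ'.2 φ.2 hy hφ', hS.chart_mk ψ.2 φ.2 (h := h) (f := f) hc hφ]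
    exact h2 _ _

theorem isSmoothBundle_target [Nonempty H] [T2Space M] [Nonempty M] [IsManifold (𝓡 m) ∞ M]
    (hS : IsJetStructure 𝒜 r S) :
    IsSmoothBundle S.dim m (fun c : S.Space => JetSpace.target (SmoothStructure.elt c)) := by
  have : Nonempty (JetSpace n H F r) :=
    ⟨JetSpace.mk F r (Classical.arbitrary H) (ContMDiffMap.const (Classical.arbitrary M))⟩
  refine isSmoothBundle_of_transport S JetSpace.target hS.contMDiff_target
    hS.isEmbeddedSubmanifold_target 𝒜.subset_maximalAtlas 𝒜.cover
    (Λ := IsManifold.maximalAtlas (𝓡 n) ∞ H) JetSpace.source (fun ψ => ψ.1.source)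
    (fun h => ⟨⟨_, IsManifold.chart_mem_maximalAtlas h⟩, mem_chart_source _ h⟩)
    (jetModelSwap n (𝒜.order r)) (fun φ ψ => hS.chart ψ.2 φ.2)
    (fun φ ψ => hS.isSmoothChart_chart ψ.2 φ.2)
    (fun φ ψ c => (hS.mem_chart ψ.2 φ.2).trans and_comm)
    (fun φ ψ c hc => hS.chart_snd_fst ψ.2 φ.2 hc) fun φ φ' c u hc hu => ?_
  obtain ⟨h, f, e⟩ := JetSpace.exists_mk (SmoothStructure.elt c)
  have e' : c = S.point (JetSpace.mk F r h f) := e.symm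
  subst e'
  obtain ⟨f', h1, h2⟩ := exists_transport_target (𝒜.subset_maximalAtlas φ.2)
    (𝒜.subset_maximalAtlas φ'.2) (h := h) (f := f) hc hu
  refine ⟨S.point (JetSpace.mk F r h f'), h1, rfl, fun ψ hψ => ?_⟩
  have hφ' : f' h ∈ φ'.1.source := by rw [h1]; exact hu
  change ((hS.chart ψ.2 φ'.2 (S.point (JetSpace.mk F r h f'))).1,
      (hS.chart ψ.2 φ'.2 (S.point (JetSpace.mk F r h f'))).2.2) =
    ((hS.chart ψ.2 φ.2 (S.point (JetSpace.mk F r h f))).1,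
      (hS.chart ψ.2 φ.2 (S.point (JetSpace.mk F r h f))).2.2)
  rw [hS.chart_mk ψ.2 φ'.2 (h := h) hψ hφ', hS.chart_mk ψ.2 φ.2 (h := h) (f := f) hψ hc]
  exact Prod.ext rfl (h2 ψ.1 ψ.2 hψ _)

omit [IsManifold (𝓡 n) ∞ H] in
theorem chart_lower (hS : IsJetStructure 𝒜 r S) (hS' : IsJetStructure 𝒜 r' S') (hr : r' ≤ r)
    {ψ : OpenPartialHomeomorph H (EuclideanSpace ℝ (Fin n))}
    {φ : OpenPartialHomeomorph M (EuclideanSpace ℝ (Fin m))}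
    (hψ : ψ ∈ IsManifold.maximalAtlas (𝓡 n) ∞ H) (hφ : φ ∈ 𝒜.charts) {c : S.Space}
    (hc : c ∈ (hS.chart hψ hφ).source) :
    S'.point (JetSpace.lower hr (SmoothStructure.elt c)) ∈ (hS'.chart hψ hφ).source ∧
    hS'.chart hψ hφ (S'.point (JetSpace.lower hr (SmoothStructure.elt c))) =
      ((hS.chart hψ hφ c).1, (hS.chart hψ hφ c).2.1,
        lowerFibres n (𝒜.order_mono hr) (hS.chart hψ hφ c).2.2) := by
  have hc' := (hS.mem_chart hψ hφ).1 hc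
  obtain ⟨h, f, e⟩ := JetSpace.exists_mk (SmoothStructure.elt c)
  have e' : c = S.point (JetSpace.mk F r h f) := e.symm
  subst e'
  refine ⟨(hS'.mem_chart hψ hφ).2 hc', ?_⟩
  rw [hS.chart_mk hψ hφ (h := h) (f := f) hc'.1 hc'.2]
  refine (hS'.chart_mk hψ hφ (h := h) (f := f) hc'.1 hc'.2).trans
    (Prod.ext rfl (Prod.ext rfl (funext fun j => Eq.symm ?_)))
  exact lowerFibre_jetAt (𝒜.order_mono hr j)
    ((eventually_contDiffAt_localRep hψ (𝒜.subset_maximalAtlas hφ) f.contMDiff hc'.1 hc'.2).mono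
      fun z hz => hz.coord j)

/-- Over the same pair of charts, lowering keeps source and target and acts linearly and
surjectively on the derivatives. A linear splitting `K` of this surjection supplies the missing
coordinates, so the bundle is trivial over each jet chart, with a Euclidean fibre. -/
theorem isSmoothBundle_lower (hS : IsJetStructure 𝒜 r S) (hS' : IsJetStructure 𝒜 r' S')
    (hr : r' ≤ r) : IsSmoothBundle S.dim S'.dim
      (fun c : S.Space => S'.point (JetSpace.lower hr (SmoothStructure.elt c))) := by
  -- A jet and its lowering have the same source and target, so whole fibres lie in the domain of
  -- the chart above.
  have hmem : ∀ (c : S.Space) {ψ : OpenPartialHomeomorph H (EuclideanSpace ℝ (Fin n))}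
      {φ : OpenPartialHomeomorph M (EuclideanSpace ℝ (Fin m))}
      (hψ : ψ ∈ IsManifold.maximalAtlas (𝓡 n) ∞ H) (hφ : φ ∈ 𝒜.charts),
      S'.point (JetSpace.lower hr (SmoothStructure.elt c)) ∈ (hS'.chart hψ hφ).source →
        c ∈ (hS.chart hψ hφ).source := by
    intro c ψ φ hψ hφ hc
    have hc' := (hS'.mem_chart hψ hφ).1 hc
    obtain ⟨h, f, e⟩ := JetSpace.exists_mk (SmoothStructure.elt c)
    have e' : c = S.point (JetSpace.mk F r h f) := e.symm
    subst e'
    exact (hS.mem_chart hψ hφ).2 hc'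
  have hsurj : Function.Surjective
      (fun c : S.Space => S'.point (JetSpace.lower hr (SmoothStructure.elt c))) := by
    intro c
    obtain ⟨h, f, e⟩ := JetSpace.exists_mk (SmoothStructure.elt c)
    exact ⟨S.point (JetSpace.mk F r h f), e⟩
  have hsm : ContMDiff (𝓡 S.dim) (𝓡 S'.dim) ∞
      (fun c : S.Space => S'.point (JetSpace.lower hr (SmoothStructure.elt c))) := by
    intro c
    obtain ⟨ψ, φ, hψ, hφ, hc⟩ := hS.exists_mem_chart_source c
    have hev := (hS.chart hψ hφ).open_source.mem_nhds hc
    refine (hS'.isSmoothChart_chart hψ hφ).contMDiffAt_of_comp ?_ ?_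
    · filter_upwards [hev] with z hz
      exact (hS.chart_lower hS' hr hψ hφ hz).1
    · have hd : ContDiff ℝ ∞ (fun t : JetModel n (𝒜.order r) =>
          (t.1, t.2.1, lowerFibres n (𝒜.order_mono hr) t.2.2)) := by fun_prop
      refine (hd.contMDiff.contMDiffAt.comp c
        ((hS.isSmoothChart_chart hψ hφ).contMDiffAt hc)).congr_of_eventuallyEq ?_
      filter_upwards [hev] with z hz
      exact (hS.chart_lower hS' hr hψ hφ hz).2
  obtain ⟨d, K, hK⟩ := exists_equiv_prod_of_surjective _
    (lowerFibres_surjective n (𝒜.order_mono hr))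
  -- The fibre of a bundle has to live in the universe of the total space, hence the lifted
  -- Euclidean space.
  obtain ⟨T, E, hE, hEs, hEtgt⟩ := exists_smoothStructure_uliftEuclidean.{max u v} d
  have hEsymm : ∀ y, E (E.symm y) = y := fun y => E.right_inv (hEtgt ▸ trivial)
  have hEsymm' : ∀ t, E.symm (E t) = t := fun t => E.left_inv (hEs ▸ trivial)
  refine isSmoothBundle_of_local_product hsurj hsm T fun c₀ => ?_
  obtain ⟨ψ, φ, hψ, hφ, hc₀⟩ := hS'.exists_mem_chart_source c₀
  set e := hS.chart hψ hφ with he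
  set e' := hS'.chart hψ hφ with he'
  have hes := hS.isSmoothChart_chart hψ hφ
  have hes' := hS'.isSmoothChart_chart hψ hφ
  let G : JetModel n (𝒜.order r') × EuclideanSpace ℝ (Fin d) → JetModel n (𝒜.order r) :=
    fun w => (w.1.1, w.1.2.1, K.symm (w.1.2.2, w.2))
  have hG : ContDiff ℝ ∞ G := by fun_prop
  have hGt : ∀ y ∈ e'.source, ∀ w, G (e' y, w) ∈ e.target := by
    intro y hy w
    have := e'.map_source hy
    rw [he', hS'.chart_target] at this
    rw [he, hS.chart_target]
    exact this
  have hlow : ∀ y ∈ e'.source, ∀ w,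
      S'.point (JetSpace.lower hr (SmoothStructure.elt (e.symm (G (e' y, w))))) = y := by
    intro y hy w
    have ht := hGt y hy w
    obtain ⟨h1, h2⟩ := hS.chart_lower hS' hr hψ hφ (e.map_target ht)
    refine e'.injOn h1 hy (h2.trans ?_)
    rw [← he, e.right_inv ht, ← hK]
    simp [G]
  refine ⟨e'.source, fun c => E.symm (K (e c).2.2).2, fun q => e.symm (G (e' q.1, E q.2)),
    e'.open_source, hc₀, fun c hc => ?_, fun q hq => ?_, fun c hc => ?_, fun y hy t => ?_⟩
  · have hd : ContDiff ℝ ∞ (fun w : JetModel n (𝒜.order r) => (K w.2.2).2) := by fun_prop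
    refine ContMDiffAt.contMDiffWithinAt ?_
    exact (hE.contMDiffAt_symm (hEtgt ▸ trivial)).comp c
      (hd.contMDiff.contMDiffAt.comp c (hes.contMDiffAt (hmem c hψ hφ hc)))
  · refine ContMDiffAt.contMDiffWithinAt ?_
    have h1 : ContMDiffAt ((𝓡 S'.dim).prod (𝓡 T.dim))
        𝓘(ℝ, JetModel n (𝒜.order r') × EuclideanSpace ℝ (Fin d)) ∞
        (fun q : S'.Space × T.Space => (e' q.1, E q.2)) q := by
      refine ContMDiffAt.prodMk_space ?_ ?_
      · exact (hes'.contMDiffAt hq.1).comp q contMDiffAt_fst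
      · exact (hE.contMDiffAt (hEs ▸ trivial)).comp q contMDiffAt_snd
    exact (hes.contMDiffAt_symm (hGt q.1 hq.1 _)).comp q (hG.contMDiff.contMDiffAt.comp q h1)
  · have hc' := hmem c hψ hφ hc
    have h2 := (hS.chart_lower hS' hr hψ hφ hc').2
    simp only [hEsymm]
    have : G (e' (S'.point (JetSpace.lower hr (SmoothStructure.elt c))), (K (e c).2.2).2) = e c := by
      simp only [G]
      rw [he', h2, ← hK]
      exact Prod.ext rfl (Prod.ext rfl (K.symm_apply_apply _))
    rw [this, e.left_inv hc']
  · refine ⟨hlow y hy _, ?_⟩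
    beta_reduce
    rw [e.right_inv (hGt y hy _)]
    simp [G, hEsymm']

end IsJetStructure

end

theorem theorem1 {ι : Type} [Fintype ι] {n m : ℕ}
    {H : Type*} [TopologicalSpace H] [T2Space H] [SecondCountableTopology H] [Nonempty H]
    [ChartedSpace (EuclideanSpace ℝ (Fin n)) H] [IsManifold (𝓡 n) ∞ H]
    {M : Type*} [TopologicalSpace M] [T2Space M] [SecondCountableTopology M] [Nonempty M]
    [ChartedSpace (EuclideanSpace ℝ (Fin m)) M] [IsManifold (𝓡 m) ∞ M]
    (F : Multifoliation ι m M) :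
    ∃ S : ∀ r : ι → ℕ, SmoothStructure (JetSpace n H F r),
      (∀ r, HasSmoothJetCoordinates (S r) ∧ HasSmoothJetFamilies (S r)) ∧
      (∀ r (h : H) (u : M), IsEmbeddedSubmanifold (S r)
        {c | JetSpace.source c = h ∧ JetSpace.target c = u}) ∧
      (∀ r (h : H), IsEmbeddedSubmanifold (S r) {c | JetSpace.source c = h}) ∧
      (∀ r (u : M), IsEmbeddedSubmanifold (S r) {c | JetSpace.target c = u}) ∧
      (∀ r, IsSmoothBundle (S r).dim n (fun c : (S r).Space => JetSpace.source (SmoothStructure.elt c))) ∧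
      (∀ r, IsSmoothBundle (S r).dim m (fun c : (S r).Space => JetSpace.target (SmoothStructure.elt c))) ∧
      (∀ (r r' : ι → ℕ) (hr : r' ≤ r), IsSmoothBundle (S r).dim (S r').dim
        (fun c : (S r).Space => (S r').point (JetSpace.lower hr (SmoothStructure.elt c)))) ∧
      ∃ Ψ : Diffeomorph (𝓡 (S 0).dim) ((𝓡 n).prod (𝓡 m)) (S 0).Space (H × M) ∞,
        ∀ c : (S 0).Space, Ψ c = 
          (JetSpace.source (SmoothStructure.elt c), JetSpace.target (SmoothStructure.elt c)) := by
  -- A single adapted atlas serves all multiorders, so that jets of different orders can be compared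
  -- in charts over the same charts of `H` and `M`.
  obtain ⟨𝒜⟩ := nonempty_adaptedAtlas F
  choose S hS using fun r => exists_isJetStructure (n := n) (H := H) 𝒜 r
  exact ⟨S, fun r => ⟨(hS r).hasSmoothJetCoordinates, (hS r).hasSmoothJetFamilies⟩,
    fun r => (hS r).isEmbeddedSubmanifold_source_target,
    fun r => (hS r).isEmbeddedSubmanifold_source, fun r => (hS r).isEmbeddedSubmanifold_target,
    fun r => (hS r).isSmoothBundle_source, fun r => (hS r).isSmoothBundle_target,
    fun r r' hr => (hS r).isSmoothBundle_lower (hS r') hr, (hS 0).exists_diffeomorph_zero⟩
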